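/- Let $p$ be a prime number, let $r \geq 1$ be an integer, and let $X$ be a Noetherian $\mathbb{F}_p$-scheme which is $F$-finite, i.e. whose absolute Frobenius morphism $F \colon X \to X$ is finite. An ($r$-)Cartier module on $X$ is an $\mathcal{O}_X$-module $\mathcal{M}$ together with a morphism of $\mathcal{O}_X$-modules $\kappa_{\mathcal{M}} \colon F^r_*\mathcal{M} \to \mathcal{M}$; a morphism of Cartier modules is a morphism $\theta \colon \mathcal{M} \to \mathcal{N}$ of $\mathcal{O}_X$-modules with $\theta \circ \kappa_{\mathcal{M}} = \kappa_{\mathcal{N}} \circ F^r_*\theta$. A Cartier module is called quasi-coherent (resp. coherent) if its underlying $\mathcal{O}_X$-module is, and a quasi-coherent Cartier module is called ind-coherent if it is a filtered colimit of coherent Cartier modules. Let $\mathrm{IndCoh}_X^{C^r}$ denote the full subcategory of ind-coherent Cartier modules. Then every injective object of $\mathrm{IndCoh}_X^{C^r}$ is also injective as an object of $\mathrm{Mod}(\mathcal{O}_X)$, the category of all $\mathcal{O}_X$-modules (that is, its underlying $\mathcal{O}_X$-module is an injective $\mathcal{O}_X$-module). -/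

import Mathlib

universe u

open CategoryTheory AlgebraicGeometry

namespace CartierModules

/-- `X` is an `𝔽_p`-scheme: it admits a (necessarily unique) morphism to `Spec 𝔽_p`. -/
class IsFpScheme (p : ℕ) (X : Scheme.{u}) : Prop where
  nonempty_hom : Nonempty (X ⟶ Spec (CommRingCat.of (ULift.{u} (ZMod p))))

/-- On an `𝔽_p`-scheme, `p = 0` in every ring of sections. -/
theorem cast_eq_zero (p : ℕ) (X : Scheme.{u}) [h : IsFpScheme p X] (U : X.Opens) :
    (p : Γ(X, U)) = 0 := by
  obtain ⟨f⟩ := h.nonempty_hom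
  let φ : ULift.{u} (ZMod p) →+* Γ(X, ⊤) :=
    f.appTop.hom.comp (Scheme.ΓSpecIso (CommRingCat.of (ULift.{u} (ZMod p)))).inv.hom
  let ψ : ULift.{u} (ZMod p) →+* Γ(X, U) :=
    (X.presheaf.map (homOfLE (le_top : U ≤ ⊤)).op).hom.comp φ
  have h0 : ((p : ℕ) : ULift.{u} (ZMod p)) = 0 := by
    apply ULift.ext
    simp
  rw [← map_natCast ψ p, h0, map_zero]

/-- The ring endomorphism `a ↦ a ^ (p ^ r)` of a commutative ring in which the prime `p` is zero
(the zero ring is allowed). -/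
def frobRingHom (p : ℕ) [hp : Fact p.Prime] (r : ℕ) (R : Type u) [CommRing R]
    (h : (p : R) = 0) : R →+* R where
  toFun a := a ^ p ^ r
  map_one' := one_pow _
  map_mul' a b := mul_pow a b _
  map_zero' := zero_pow (pow_ne_zero r hp.out.ne_zero)
  map_add' a b := by
    rcases subsingleton_or_nontrivial R with _ | _
    · exact Subsingleton.elim _ _
    · have : CharP R p := (CharP.charP_iff_prime_eq_zero hp.out).mpr h
      exact add_pow_char_pow a b p r

@[simp]
theorem frobRingHom_apply (p : ℕ) [Fact p.Prime] (r : ℕ) (R : Type u) [CommRing R]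
    (h : (p : R) = 0) (a : R) : frobRingHom p r R h a = a ^ p ^ r := rfl

/-- The absolute Frobenius `F ^ r` as a morphism of presheafed spaces: the identity on points, and
`a ↦ a ^ (p ^ r)` on sections. -/
def frobPresheafed (p : ℕ) [Fact p.Prime] (r : ℕ) (X : Scheme.{u}) [IsFpScheme p X] :
    X.toPresheafedSpace.Hom X.toPresheafedSpace where
  base := 𝟙 _
  c :=
    { app := fun U => CommRingCat.ofHom
        (frobRingHom p r Γ(X, U.unop) (cast_eq_zero p X U.unop))
      naturality := fun U V i => by
        ext a
        exact (map_pow (X.presheaf.map i).hom a (p ^ r)).symm }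

theorem stalkMap_frobPresheafed (p : ℕ) [Fact p.Prime] (r : ℕ) (X : Scheme.{u}) [IsFpScheme p X]
    (x : X) (a : X.presheaf.stalk x) :
    ((frobPresheafed p r X).stalkMap x).hom a = a ^ p ^ r := by
  obtain ⟨U, hx, s, rfl⟩ := X.presheaf.exists_germ_eq a
  have := PresheafedSpace.stalkMap_germ_apply (frobPresheafed p r X) U x hx s
  refine this.trans ?_
  exact map_pow (X.presheaf.germ U x hx).hom s (p ^ r)

/-- The `r`-th iterate `F ^ r : X ⟶ X` of the absolute Frobenius of an `𝔽_p`-scheme. -/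
def frobenius (p : ℕ) [hp : Fact p.Prime] (r : ℕ) (X : Scheme.{u}) [IsFpScheme p X] : X ⟶ X where
  toHom := frobPresheafed p r X
  prop x := ⟨fun a ha => by
    have ha' : IsUnit ((show X.presheaf.stalk x from a) ^ p ^ r) :=
      stalkMap_frobPresheafed p r X x a ▸ ha
    exact (isUnit_pow_iff (pow_ne_zero r hp.out.ne_zero)).mp ha'⟩

theorem frobenius_app_apply (p : ℕ) [Fact p.Prime] (r : ℕ) (X : Scheme.{u}) [IsFpScheme p X]
    (U : X.Opens) (a : Γ(X, U)) : ((frobenius p r X).app U).hom a = a ^ p ^ r := rfl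

/-- `frobenius p r X` is indeed the `r`-fold composite of the absolute Frobenius. -/
theorem frobenius_zero (p : ℕ) [Fact p.Prime] (X : Scheme.{u}) [IsFpScheme p X] :
    frobenius p 0 X = 𝟙 X := by
  refine Scheme.Hom.ext rfl fun U => ?_
  have h : (frobenius p 0 X).app U = (𝟙 X : X ⟶ X).app U := by
    ext a
    exact (congrArg (a ^ ·) (pow_zero p)).trans (pow_one a)
  rw [h]
  exact (congrArg (_ ≫ ·) (X.presheaf.map_id _)).trans (Category.comp_id _)

theorem frobenius_succ (p : ℕ) [Fact p.Prime] (r : ℕ) (X : Scheme.{u}) [IsFpScheme p X] :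
    frobenius p (r + 1) X = frobenius p r X ≫ frobenius p 1 X := by
  refine Scheme.Hom.ext rfl fun U => ?_
  have h : (frobenius p (r + 1) X).app U = (frobenius p r X ≫ frobenius p 1 X).app U := by
    ext a
    have e : p ^ (r + 1) = p ^ 1 * p ^ r := by ring
    exact (congrArg (a ^ ·) e).trans (pow_mul a (p ^ 1) (p ^ r))
  rw [h]
  exact (congrArg (_ ≫ ·) (X.presheaf.map_id _)).trans (Category.comp_id _)

/-- `X` is `F`-finite: its absolute Frobenius is a finite morphism. -/
class IsFFinite (p : ℕ) [Fact p.Prime] (X : Scheme.{u}) [IsFpScheme p X] : Prop where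
  isFinite_frobenius : IsFinite (frobenius p 1 X)

/-- The category `Mod(𝒪_X[C^r])` of `r`-Cartier modules: an object `M` consists of an
`𝒪_X`-module `M.a` and an `𝒪_X`-linear map `M.str : F^r_* M.a ⟶ M.a`; morphisms are the
`𝒪_X`-linear maps commuting with the structure maps. -/
abbrev CartierModule (p : ℕ) [Fact p.Prime] (r : ℕ) (X : Scheme.{u}) [IsFpScheme p X] :=
  Endofunctor.Algebra (Scheme.Modules.pushforward (frobenius p r X))

/-- Coherent `𝒪_X`-modules on a (locally) Noetherian scheme: quasi-coherent of finite type. -/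
def IsCoherentModule {X : Scheme.{u}} (M : X.Modules) : Prop :=
  M.IsQuasicoherent ∧ SheafOfModules.IsFiniteType.{u} M

/-- Coherent Cartier modules. -/
def isCoherent (p : ℕ) [Fact p.Prime] (r : ℕ) (X : Scheme.{u}) [IsFpScheme p X] :
    ObjectProperty (CartierModule p r X) :=
  fun M => IsCoherentModule M.a

/-- Ind-coherent Cartier modules: quasi-coherent Cartier modules which are (small) filtered
colimits, in the category of Cartier modules, of coherent Cartier modules. -/
def isIndCoherent (p : ℕ) [Fact p.Prime] (r : ℕ) (X : Scheme.{u}) [IsFpScheme p X] :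
    ObjectProperty (CartierModule p r X) :=
  fun M => M.a.IsQuasicoherent ∧ ObjectProperty.ind.{u} (isCoherent p r X) M

/-- The full subcategory `IndCoh_X^{C^r}` of ind-coherent Cartier modules. -/
abbrev IndCoh (p : ℕ) [Fact p.Prime] (r : ℕ) (X : Scheme.{u}) [IsFpScheme p X] :=
  (isIndCoherent p r X).FullSubcategory

end CartierModules

/-! ### Sections, gluing and subsheaves of sheaves of modules. -/

namespace CartierModules

open TopologicalSpace Opposite

variable {X : Scheme.{u}}

/-! It suffices to embed every ind-coherent Cartier module `M` in an ind-coherent `J` whose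
underlying module is injective among all `𝒪_X`-modules: an injective object of the ind-coherent
category is then a direct summand of such a `J`, and summands of injective modules are injective.

Over an affine open `V` of a finite cover, let `E` be the injective hull of `Γ(M, V)`. The sheaf
`tilde E` is injective among all modules on the spectrum (`injective_tilde`), so the structure map
of `M` over `V` extends to a Cartier structure on `tilde E`. Its pushforward to `X` stays injective
(`exists_local_hull`), and `J` is the direct sum of these pushforwards over the cover.

The point is that `J` is ind-coherent. On a Noetherian scheme, a quasi-coherent Cartier module is
ind-coherent exactly when each section over an affine open lies in a finitely generated submodule
stable under the structure map (`isLocFinite_of_isIndCoherent`, `isIndCoherent_of_isLocFinite`).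
This local finiteness passes to essential extensions by Noetherian induction
(`isLocFinite_of_essential`), because `F`-finiteness makes the structure map send finitely generated
submodules into finitely generated ones. As it has to be tested on every member of the cover,
essentiality is first spread from one affine open to all others (`exists_smul_eq_app`).

The injectivity of `tilde E` against arbitrary modules rests on `exists_retraction`, argued without
stalks. Given `F ⟶ Y` mono, take a maximal family `K` of submodules of `Y` meeting `F` trivially. At
a generic point of the locus where `F + K` misses a section of `Y`, flasqueness of `F` and
Artin–Rees show that `K` could be enlarged.

Quasi-coherence is used in the form `Localizing`: over every open `U`, affine or not, sections over
`D(f)` are the localization at `f` of sections over `U`. On a Noetherian scheme the two notions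
agree. -/

/-- Restriction of sections of the structure sheaf. -/
noncomputable def rr (X : Scheme.{u}) {V U : X.Opens} (h : V ≤ U) : Γ(X, U) →+* Γ(X, V) :=
  (X.presheaf.map (homOfLE h).op).hom

/-- Restriction of sections of a sheaf of modules. -/
noncomputable def rs (M : X.Modules) {V U : X.Opens} (h : V ≤ U) : Γ(M, U) →+ Γ(M, V) :=
  (M.presheaf.map (homOfLE h).op).hom

@[simp]
lemma rr_rr {U V W : X.Opens} (h : V ≤ U) (h' : W ≤ V) (a : Γ(X, U)) :
    rr X h' (rr X h a) = rr X (h'.trans h) a := by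
  simp only [rr]
  rw [← CommRingCat.comp_apply, ← Functor.map_comp]
  rfl

@[simp]
lemma rr_self {U : X.Opens} (h : U ≤ U) (a : Γ(X, U)) : rr X h a = a := by
  simp [rr]

@[simp]
lemma rs_rs (M : X.Modules) {U V W : X.Opens} (h : V ≤ U) (h' : W ≤ V) (s : Γ(M, U)) :
    rs M h' (rs M h s) = rs M (h'.trans h) s := by
  simp only [rs]
  rw [← AddCommGrpCat.comp_apply, ← Functor.map_comp]
  rfl

@[simp]
lemma rs_self (M : X.Modules) {U : X.Opens} (h : U ≤ U) (s : Γ(M, U)) : rs M h s = s := by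
  simp [rs]

@[simp]
lemma rs_smul (M : X.Modules) {U V : X.Opens} (h : V ≤ U) (a : Γ(X, U)) (s : Γ(M, U)) :
    rs M h (a • s) = rr X h a • rs M h s :=
  Scheme.Modules.map_smul M (homOfLE h) a s

lemma app_rs {M N : X.Modules} (φ : M ⟶ N) {U V : X.Opens} (h : V ≤ U) (s : Γ(M, U)) :
    φ.app V (rs M h s) = rs N h (φ.app U s) :=
  congr($(φ.mapPresheaf.naturality (homOfLE h).op) s)

lemma app_smul {M N : X.Modules} (φ : M ⟶ N) {U : X.Opens} (a : Γ(X, U)) (s : Γ(M, U)) :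
    φ.app U (a • s) = a • φ.app U s :=
  φ.app_smul a s

/-- A section of a sheaf of modules is determined locally. -/
lemma section_ext (M : X.Modules) {U : X.Opens} {s t : Γ(M, U)}
    (H : ∀ x ∈ U, ∃ (V : X.Opens) (h : V ≤ U), x ∈ V ∧ rs M h s = rs M h t) : s = t := by
  choose V hV hx hst using fun x : U ↦ H x.1 x.2
  refine TopCat.Sheaf.eq_of_locally_eq' ⟨M.presheaf, M.isSheaf⟩ V U (fun i ↦ homOfLE (hV i)) ?_ s t
    fun i ↦ hst i
  intro x hxU
  exact Opens.mem_iSup.mpr ⟨⟨x, hxU⟩, hx _⟩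

/-- Gluing of sections which are uniquely characterised by a property. -/
lemma exists_glue (M : X.Modules) (U : X.Opens) (P : ∀ V : X.Opens, Γ(M, V) → Prop)
    (hP : ∀ V W (h : W ≤ V) s, P V s → P W (rs M h s))
    (huniq : ∀ V s t, P V s → P V t → s = t)
    (H : ∀ x ∈ U, ∃ V : X.Opens, V ≤ U ∧ x ∈ V ∧ ∃ s, P V s) :
    ∃ s : Γ(M, U), ∀ x ∈ U, ∃ (V : X.Opens) (h : V ≤ U), x ∈ V ∧ P V (rs M h s) := by
  choose V hV hx s hs using fun x : U ↦ H x.1 x.2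
  have hcov : U ≤ ⨆ i, V i := fun x hxU ↦ Opens.mem_iSup.mpr ⟨⟨x, hxU⟩, hx _⟩
  obtain ⟨t, ht, -⟩ := TopCat.Sheaf.existsUnique_gluing' ⟨M.presheaf, M.isSheaf⟩ V U
    (fun i ↦ homOfLE (hV i)) hcov s
    (fun i j ↦ huniq _ _ _ (hP _ _ (inf_le_left : V i ⊓ V j ≤ V i) _ (hs i))
      (hP _ _ (inf_le_right : V i ⊓ V j ≤ V j) _ (hs j)))
  refine ⟨t, fun x hxU ↦ ⟨V ⟨x, hxU⟩, hV _, hx _, ?_⟩⟩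
  have := ht ⟨x, hxU⟩
  change rs M _ t = _ at this
  rw [this]
  exact hs _

/-- A morphism of sheaves of modules from its action on sections. -/
noncomputable def modHomMk {M N : X.Modules} (φ : ∀ U : X.Opens, Γ(M, U) →+ Γ(N, U))
    (hsmul : ∀ (U : X.Opens) (a : Γ(X, U)) (s : Γ(M, U)), φ U (a • s) = a • φ U s)
    (hrs : ∀ (U V : X.Opens) (h : V ≤ U) (s : Γ(M, U)), φ V (rs M h s) = rs N h (φ U s)) :
    M ⟶ N :=
  ⟨PresheafOfModules.homMk
    { app U := AddCommGrpCat.ofHom (φ U.unop)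
      naturality U V i := by
        ext s
        exact hrs U.unop V.unop i.unop.le s }
    (fun U a s ↦ hsmul U.unop a s)⟩

lemma modHom_ext {M N : X.Modules} {f g : M ⟶ N} (H : ∀ U (s : Γ(M, U)), f.app U s = g.app U s) :
    f = g := by
  ext U s
  exact H U s

/-- A monomorphism of sheaves of modules is injective on sections. -/
lemma app_injective {M N : X.Modules} (f : M ⟶ N) [Mono f] (U : X.Opens) :
    Function.Injective (f.app U) := by
  have : Mono ((Scheme.Modules.toPresheaf X).map f) := inferInstance
  have : Mono (((Scheme.Modules.toPresheaf X).map f).app (op U)) :=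
    (NatTrans.mono_iff_mono_app _).mp this _
  exact (AddCommGrpCat.mono_iff_injective _).mp this

lemma mono_of_app_injective {M N : X.Modules} (f : M ⟶ N)
    (H : ∀ U, Function.Injective (f.app U)) : Mono f := by
  refine ⟨fun g h e ↦ modHom_ext fun U s ↦ H U ?_⟩
  have := congr(($e).app U s)
  exact this

/-- A subsheaf of modules. -/
@[ext]
structure Sub (M : X.Modules) where
  /-- The sections of the subsheaf. -/
  obj (U : X.Opens) : Submodule Γ(X, U) Γ(M, U)
  res {U V : X.Opens} (h : V ≤ U) {s : Γ(M, U)} : s ∈ obj U → rs M h s ∈ obj V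
  loc {U : X.Opens} {s : Γ(M, U)} :
    (∀ x ∈ U, ∃ (V : X.Opens) (h : V ≤ U), x ∈ V ∧ rs M h s ∈ obj V) → s ∈ obj U

namespace Sub

variable {M : X.Modules} (K : Sub M)

noncomputable instance : PartialOrder (Sub M) :=
  PartialOrder.lift Sub.obj fun _ _ h ↦ Sub.ext h

/-- The underlying family of submodules. -/
noncomputable def toPre : PresheafOfModules.Submodule M.val where
  obj U := K.obj U.unop
  map f := fun _ hs ↦ K.res f.unop.le hs

lemma toPre_isSheaf : TopCat.Presheaf.IsSheaf K.toPre.toPresheafOfModules.presheaf := by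
  refine (TopCat.Presheaf.isSheaf_iff_isSheafUniqueGluing _).mpr fun ι U sf hsf ↦ ?_
  have hM : TopCat.Presheaf.IsSheafUniqueGluing M.presheaf :=
    (TopCat.Presheaf.isSheaf_iff_isSheafUniqueGluing _).mp M.isSheaf
  let sf' (i : ι) : K.obj (U i) := sf i
  obtain ⟨t, ht, hu⟩ := hM U (fun i ↦ (sf' i).1) (fun i j ↦ congrArg Subtype.val (hsf i j))
  have hmem : t ∈ K.obj (iSup U) := by
    refine K.loc fun x hx ↦ ?_
    obtain ⟨i, hi⟩ := Opens.mem_iSup.mp hx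
    refine ⟨U i, le_iSup U i, hi, ?_⟩
    have h1 : rs M (le_iSup U i) t = (sf' i).1 := ht i
    rw [h1]
    exact (sf' i).2
  exact ⟨(⟨t, hmem⟩ : K.obj (iSup U)), fun i ↦ Subtype.ext (ht i),
    fun y hy ↦ Subtype.ext (hu _ fun i ↦ congrArg Subtype.val (hy i))⟩

/-- The sheaf of modules of a subsheaf of modules. -/
noncomputable def toModules : X.Modules where
  val := K.toPre.toPresheafOfModules
  isSheaf := K.toPre_isSheaf

/-- The inclusion of a subsheaf of modules. -/
noncomputable def ι : K.toModules ⟶ M := ⟨K.toPre.ι⟩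

/-- Sections of a subsheaf of modules. -/
noncomputable def sec {U : X.Opens} (s : Γ(M, U)) (hs : s ∈ K.obj U) : Γ(K.toModules, U) :=
  (⟨s, hs⟩ : K.obj U)

@[simp]
lemma ι_sec {U : X.Opens} (s : Γ(M, U)) (hs : s ∈ K.obj U) : K.ι.app U (K.sec s hs) = s := rfl

lemma ι_mem {U : X.Opens} (s : Γ(K.toModules, U)) : K.ι.app U s ∈ K.obj U :=
  (show K.obj U from s).2

lemma ι_injective (U : X.Opens) : Function.Injective (K.ι.app U) :=
  fun s t h ↦ Subtype.ext (a1 := (show K.obj U from s)) (a2 := (show K.obj U from t)) h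

/-- A morphism factors through a subsheaf as soon as its sections do. -/
noncomputable def lift {N : X.Modules} (φ : N ⟶ M) (h : ∀ U (s : Γ(N, U)), φ.app U s ∈ K.obj U) :
    N ⟶ K.toModules :=
  modHomMk (fun U ↦
    { toFun s := K.sec (φ.app U s) (h U s)
      map_zero' := K.ι_injective U (by simp)
      map_add' s t := K.ι_injective U (by simp) })
    (fun U a s ↦ K.ι_injective U (by
      rw [app_smul]
      exact app_smul φ a s))
    (fun U V i s ↦ K.ι_injective V (by
      rw [app_rs]
      exact app_rs φ i s))

end Sub

end CartierModules

/-! ### Structure maps of Cartier modules on sections. -/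

namespace CartierModules

open TopologicalSpace Opposite

section Frobenius

variable {p : ℕ} [Fact p.Prime] {r : ℕ} {X : Scheme.{u}} [IsFpScheme p X]

/-- A morphism out of `F ^ r_* M`, from its action on sections. -/
noncomputable def frobHomMk {M N : X.Modules} (φ : ∀ U : X.Opens, Γ(M, U) →+ Γ(N, U))
    (hsmul : ∀ (U : X.Opens) (a : Γ(X, U)) (s : Γ(M, U)), φ U (a ^ p ^ r • s) = a • φ U s)
    (hrs : ∀ (U V : X.Opens) (h : V ≤ U) (s : Γ(M, U)), φ V (rs M h s) = rs N h (φ U s)) :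
    (Scheme.Modules.pushforward (frobenius p r X)).obj M ⟶ N :=
  modHomMk (M := (Scheme.Modules.pushforward (frobenius p r X)).obj M) φ hsmul hrs

/-- The action on sections of a morphism out of `F ^ r_* M`. -/
noncomputable def frobApp {M N : X.Modules}
    (φ : (Scheme.Modules.pushforward (frobenius p r X)).obj M ⟶ N) (U : X.Opens) :
    Γ(M, U) →+ Γ(N, U) :=
  (φ.app U).hom

lemma frobApp_smul {M N : X.Modules}
    (φ : (Scheme.Modules.pushforward (frobenius p r X)).obj M ⟶ N) (U : X.Opens)
    (a : Γ(X, U)) (s : Γ(M, U)) : frobApp φ U (a ^ p ^ r • s) = a • frobApp φ U s :=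
  app_smul φ a s

lemma frobApp_rs {M N : X.Modules}
    (φ : (Scheme.Modules.pushforward (frobenius p r X)).obj M ⟶ N) {U V : X.Opens} (h : V ≤ U)
    (s : Γ(M, U)) : frobApp φ V (rs M h s) = rs N h (frobApp φ U s) :=
  app_rs φ h s

/-- The structure map of a Cartier module on sections. -/
noncomputable def kap (M : CartierModule p r X) (U : X.Opens) : Γ(M.a, U) →+ Γ(M.a, U) :=
  frobApp M.str U

/-- Scalars act on `F^r_*` through their `p ^ r`-th powers. In this form Frobenius enters the
commutative algebra below. -/
lemma kap_smul (M : CartierModule p r X) (U : X.Opens) (a : Γ(X, U)) (s : Γ(M.a, U)) :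
    kap M U (a ^ p ^ r • s) = a • kap M U s :=
  frobApp_smul _ _ _ _

lemma kap_rs (M : CartierModule p r X) {U V : X.Opens} (h : V ≤ U) (s : Γ(M.a, U)) :
    kap M V (rs M.a h s) = rs M.a h (kap M U s) :=
  frobApp_rs _ _ _

lemma hom_kap {M N : CartierModule p r X} (f : M ⟶ N) (U : X.Opens) (s : Γ(M.a, U)) :
    f.f.app U (kap M U s) = kap N U (f.f.app U s) := by
  have := congr(($(f.h)).app U (show Γ((Scheme.Modules.pushforward (frobenius p r X)).obj M.a, U)
    from s))
  exact this.symm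

/-- Morphisms of Cartier modules from morphisms of modules compatible with the structure maps on
sections. -/
noncomputable def cartierHomMk {M N : CartierModule p r X} (f : M.a ⟶ N.a)
    (h : ∀ U (s : Γ(M.a, U)), f.app U (kap M U s) = kap N U (f.app U s)) : M ⟶ N where
  f := f
  h := modHom_ext fun U s ↦ (h U s).symm

/-- A subsheaf is stable under the structure map of a Cartier module. -/
def Sub.Stable (M : CartierModule p r X) (K : Sub M.a) : Prop :=
  ∀ (U : X.Opens) (s : Γ(M.a, U)), s ∈ K.obj U → kap M U s ∈ K.obj U

/-- The Cartier submodule of a stable subsheaf. -/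
noncomputable def Sub.toCartier {M : CartierModule p r X} (K : Sub M.a) (hK : K.Stable M) :
    CartierModule p r X where
  a := K.toModules
  str := frobHomMk (fun U ↦
    { toFun s := K.sec (kap M U (K.ι.app U s)) (hK U _ (K.ι_mem s))
      map_zero' := K.ι_injective U (by simp)
      map_add' s t := K.ι_injective U (by simp) })
    (fun U a s ↦ K.ι_injective U (by
      have h1 : K.ι.app U (a ^ p ^ r • s) = a ^ p ^ r • K.ι.app U s := app_smul _ _ _
      have h2 := app_smul K.ι a (K.sec (kap M U (K.ι.app U s)) (hK U _ (K.ι_mem s)))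
      refine Eq.trans ?_ h2.symm
      change kap M U (K.ι.app U (a ^ p ^ r • s)) = _
      rw [h1, kap_smul]
      rfl))
    (fun U V i s ↦ K.ι_injective V (by
      rw [app_rs]
      change kap M V (K.ι.app V (rs _ i s)) = rs M.a i (kap M U (K.ι.app U s))
      rw [app_rs, kap_rs]))

/-- The inclusion of the Cartier submodule of a stable subsheaf. -/
noncomputable def Sub.cartierι {M : CartierModule p r X} (K : Sub M.a) (hK : K.Stable M) :
    K.toCartier hK ⟶ M :=
  cartierHomMk K.ι fun _ _ ↦ rfl

end Frobenius

end CartierModules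

/-! ### Local finiteness of `q⁻¹`-linear endomorphisms. -/

namespace CartierModules

section LocallyFinite

variable {R : Type*} [CommRing R] {E : Type*} [AddCommGroup E] [Module R E] (κ : E →+ E)

/-- An element is locally finite for an additive endomorphism if it lies in a finitely generated
stable submodule. -/
def IsLocFinite (R : Type*) [CommRing R] {E : Type*} [AddCommGroup E] [Module R E] (κ : E →+ E)
    (e : E) : Prop :=
  ∃ N : Submodule R E, N.FG ∧ (∀ n ∈ N, κ n ∈ N) ∧ e ∈ N

variable {κ}

lemma IsLocFinite.exists_common {S : Set E} (hS : S.Finite) (h : ∀ s ∈ S, IsLocFinite R κ s) :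
    ∃ N : Submodule R E, N.FG ∧ (∀ n ∈ N, κ n ∈ N) ∧ S ⊆ N := by
  induction S, hS using Set.Finite.induction_on with
  | empty => exact ⟨⊥, Submodule.fg_bot, by simp, by simp⟩
  | @insert a S ha hS ih =>
    obtain ⟨N, hN, hκ, hSN⟩ := ih fun s hs ↦ h s (Set.mem_insert_of_mem _ hs)
    obtain ⟨N', hN', hκ', hSN'⟩ := h a (Set.mem_insert _ _)
    refine ⟨N ⊔ N', hN.sup hN', fun n hn ↦ ?_, ?_⟩
    · obtain ⟨x, hx, y, hy, rfl⟩ := Submodule.mem_sup.mp hn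
      rw [map_add]
      exact Submodule.add_mem_sup (hκ x hx) (hκ' y hy)
    · rintro s (rfl | hs)
      · exact Submodule.mem_sup_right hSN'
      · exact Submodule.mem_sup_left (hSN hs)

variable (R κ) in
/-- The submodule of locally finite elements. -/
def locFinite : Submodule R E where
  carrier := {e | IsLocFinite R κ e}
  zero_mem' := ⟨⊥, Submodule.fg_bot, by simp, by simp⟩
  add_mem' {x y} hx hy := by
    obtain ⟨N, hN, hκ, hS⟩ := IsLocFinite.exists_common (S := {x, y}) (Set.toFinite _)
      (by rintro s (rfl | rfl) <;> assumption)
    exact ⟨N, hN, hκ, N.add_mem (hS (by simp)) (hS (by simp))⟩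
  smul_mem' a x := fun ⟨N, hN, hκ, hx⟩ ↦ ⟨N, hN, hκ, N.smul_mem a hx⟩

/-- The ring `R` is finite over its `q`-th power map. -/
def PowFinite (q : ℕ) (R : Type*) [CommRing R] : Prop :=
  ∃ B : Finset R, ∀ a : R, ∃ c : R → R, a = ∑ b ∈ B, c b ^ q * b

/-- Writing `a = ∑ c_b ^ q * b` gives `κ (a • s) = ∑ c_b • κ (b • s)`, so finitely many elements `κ
(b • s)` control the image of a finitely generated submodule. This is where `F`-finiteness enters.
-/
lemma map_mem_span_of_mem_span {q : ℕ} (hκ : ∀ (a : R) (e : E), κ (a ^ q • e) = a • κ e)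
    {B : Finset R} (hB : ∀ a : R, ∃ c : R → R, a = ∑ b ∈ B, c b ^ q * b) {S : Set E} {e : E}
    (he : e ∈ Submodule.span R S) :
    κ e ∈ Submodule.span R (Set.image2 (fun b s ↦ κ (b • s)) (B : Set R) S) := by
  suffices H : ∀ a : R, κ (a • e) ∈
      Submodule.span R (Set.image2 (fun b s ↦ κ (b • s)) (B : Set R) S) by simpa using H 1
  induction he using Submodule.span_induction with
  | mem x hx =>
    intro a
    obtain ⟨c, rfl⟩ := hB a
    rw [Finset.sum_smul, map_sum]
    refine Submodule.sum_mem _ fun b hb ↦ ?_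
    rw [mul_smul, hκ]
    exact Submodule.smul_mem _ _ (Submodule.subset_span ⟨b, hb, x, hx, rfl⟩)
  | zero => simp
  | add x y _ _ hx hy =>
    intro a
    rw [smul_add, map_add]
    exact Submodule.add_mem _ (hx a) (hy a)
  | smul b x _ hx =>
    intro a
    rw [← mul_smul]
    exact hx _

/-- Over a Noetherian ring which is finite over its `q`-th power map, a `q⁻¹`-linear endomorphism is
locally finite as soon as its locally finite elements form an essential submodule. -/
theorem isLocFinite_of_essential [IsNoetherianRing R] {q : ℕ} (hq : q ≠ 0) (hR : PowFinite q R)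
    (hκ : ∀ (a : R) (e : E), κ (a ^ q • e) = a • κ e)
    (hess : ∀ e : E, e ≠ 0 → ∃ r : R, r • e ≠ 0 ∧ IsLocFinite R κ (r • e)) (e : E) :
    IsLocFinite R κ e := by
  classical
  set T := locFinite R κ with hT
  let I (e : E) : Ideal R := T.comap (LinearMap.toSpanSingleton R E e)
  have hI (a : R) (e : E) : a ∈ I e ↔ a • e ∈ T := by simp [I]
  by_contra hcon
  -- Among the elements outside `T`, choose `e` with maximal ideal `I e` of scalars carrying it into
  -- `T`. If `I e` kills some `x` outside `T`, then `I e = I x` by maximality, which contradicts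
  -- essentiality at `x`.
  obtain ⟨𝔞, ⟨e, heT, rfl⟩, hmax⟩ := set_has_maximal_iff_noetherian.mpr ‹IsNoetherianRing R›
    (I '' {e | e ∉ T}) ⟨_, e, hcon, rfl⟩
  have htors (x : E) (hx : ∀ a ∈ I e, a • x = 0) : x ∈ T := by
    by_contra hxT
    have hle : I e ≤ I x := fun a ha ↦ by
      rw [hI, hx a ha]
      exact T.zero_mem
    have heq : I e = I x := by
      by_contra hne
      exact hmax _ ⟨x, hxT, rfl⟩ (lt_of_le_of_ne hle hne)
    obtain ⟨a, ha0, haT⟩ := hess x fun h0 ↦ hxT (h0 ▸ T.zero_mem)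
    exact ha0 (hx a (heq ▸ (hI a x).mpr haT))
  obtain ⟨G, hG⟩ := (isNoetherian_def.mp ‹IsNoetherianRing R›) (I e)
  obtain ⟨N, hNfg, hNκ, hGN⟩ := IsLocFinite.exists_common (κ := κ) (R := R)
    (S := (fun g ↦ g • e) '' (G : Set R)) (G.finite_toSet.image _) (by
      rintro _ ⟨g, hg, rfl⟩
      exact (hI g e).mp (hG ▸ Ideal.subset_span hg))
  -- `W` is the colon submodule `(N : I e)`. It contains `e`, and it is stable because `a • κ x = κ
  -- (a ^ q • x)`.
  let W : Submodule R E :=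
    { carrier := {x | ∀ a ∈ I e, a • x ∈ N}
      zero_mem' := by simp
      add_mem' hx hy a ha := by
        rw [smul_add]
        exact N.add_mem (hx a ha) (hy a ha)
      smul_mem' b x hx a ha := by
        rw [smul_comm]
        exact N.smul_mem b (hx a ha) }
  have hWG (x : E) (hx : ∀ g ∈ G, g • x ∈ N) : x ∈ W := by
    intro a ha
    have : I e ≤ N.comap (LinearMap.toSpanSingleton R E x) := by
      rw [← hG, Ideal.span_le]
      intro g hg
      simpa using hx g hg
    simpa using this ha
  have heW : e ∈ W := hWG e fun g hg ↦ hGN ⟨g, hg, rfl⟩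
  have hWκ (x : E) (hx : x ∈ W) : κ x ∈ W := fun a ha ↦ by
    rw [← hκ]
    exact hNκ _ (hx _ (Ideal.pow_mem_of_mem _ ha _ (Nat.pos_of_ne_zero hq)))
  -- The kernel of `φ` is killed by `I e`, hence lies in `T`, and its range is finitely generated.
  -- So `W` is generated by finitely many elements modulo `T`.
  let φ : W →ₗ[R] (G → N) := LinearMap.pi fun g ↦
    ((LinearMap.lsmul R E g.1).comp W.subtype).codRestrict N fun x ↦
      x.2 g.1 (hG ▸ Ideal.subset_span g.2)
  have hφ (x : W) (g : G) : ((φ x g : N) : E) = g.1 • (x : E) := rfl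
  have : Module.Finite R N := .of_fg hNfg
  have : IsNoetherian R N := isNoetherian_of_isNoetherianRing_of_finite R N
  obtain ⟨A, hA⟩ := (isNoetherian_def.mp (inferInstance : IsNoetherian R (G → N)))
    (LinearMap.range φ)
  have hAr : (A : Set (G → N)) ⊆ Set.range φ := by
    rw [← LinearMap.coe_range, ← hA]
    exact Submodule.subset_span
  obtain ⟨A₀, hA₀, hA₀'⟩ : ∃ A₀ : Set W, A₀.Finite ∧ φ '' A₀ = A := by
    choose! pre hpre using fun a (ha : a ∈ (A : Set (G → N))) ↦ hAr ha
    refine ⟨pre '' A, A.finite_toSet.image _, ?_⟩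
    rw [← Set.image_comp]
    exact (Set.image_congr fun a ha ↦ hpre a ha).trans (Set.image_id _)
  let S : Set E := insert e ((fun w : W ↦ (w : E)) '' A₀)
  have hSfin : S.Finite := (hA₀.image _).insert _
  have hSW : Submodule.span R S ≤ W := by
    rw [Submodule.span_le]
    rintro _ (rfl | ⟨w, -, rfl⟩)
    · exact heW
    · exact w.2
  have hdecomp (x : E) (hx : x ∈ W) : ∃ w ∈ Submodule.span R S, x - w ∈ T := by
    have h1 : φ ⟨x, hx⟩ ∈ (Submodule.span R A₀).map φ := by
      rw [Submodule.map_span, hA₀', hA]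
      exact ⟨_, rfl⟩
    obtain ⟨w, hw, hwx⟩ := h1
    refine ⟨w, ?_, htors _ fun a ha ↦ ?_⟩
    · have : (w : E) ∈ (Submodule.span R A₀).map W.subtype := ⟨w, hw, rfl⟩
      rw [Submodule.map_span] at this
      exact Submodule.span_mono (Set.subset_insert _ _) this
    · have : I e ≤ LinearMap.ker (LinearMap.toSpanSingleton R E (x - w)) := by
        rw [← hG, Ideal.span_le]
        intro g hg
        have := congr((($hwx ⟨g, hg⟩ : N) : E))
        rw [hφ, hφ] at this
        simp [smul_sub, this]
      simpa using this ha
  obtain ⟨B, hB⟩ := hR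
  let Q := Set.image2 (fun b s ↦ κ (b • s)) (B : Set R) S
  have hQfin : Q.Finite := B.finite_toSet.image2 _ hSfin
  have hQW (x : E) (hx : x ∈ Q) : x ∈ W := by
    obtain ⟨b, -, s, hs, rfl⟩ := hx
    exact hWκ _ (W.smul_mem _ (hSW (Submodule.subset_span hs)))
  choose! w hw hwT using fun x (hx : x ∈ Q) ↦ hdecomp x (hQW x hx)
  obtain ⟨N', hN'fg, hN'κ, hQN'⟩ := IsLocFinite.exists_common (κ := κ) (R := R)
    (S := (fun x ↦ x - w x) '' Q) (hQfin.image _) (by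
      rintro _ ⟨x, hx, rfl⟩
      exact hwT x hx)
  -- `κ` maps the span of `S` into the span of the finite set `Q`, and each `x ∈ Q` is `w x` in the
  -- span of `S` plus an error in the stable module `N'`. Hence the sum is stable and contains `e`.
  refine heT ⟨Submodule.span R S ⊔ N', (Submodule.fg_span hSfin).sup hN'fg, fun n hn ↦ ?_,
    Submodule.mem_sup_left (Submodule.subset_span (Set.mem_insert _ _))⟩
  obtain ⟨x, hx, y, hy, rfl⟩ := Submodule.mem_sup.mp hn
  rw [map_add]
  refine Submodule.add_mem _ ?_ (Submodule.mem_sup_right (hN'κ y hy))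
  have h1 := map_mem_span_of_mem_span hκ hB hx
  refine Submodule.span_le.mpr ?_ h1
  intro z hz
  rw [← add_sub_cancel (w z) z]
  exact Submodule.add_mem_sup (hw z hz) (hQN' ⟨z, hz, rfl⟩)

end LocallyFinite

/-! ### Injective hulls of modules. -/

section Hull

/-- Every module embeds in an injective module as an essential submodule. -/
theorem exists_injective_hull (R : Type u) [CommRing R] (M : Type u) [AddCommGroup M] [Module R M] :
    ∃ (E : Type u) (_ : AddCommGroup E) (_ : Module R E) (f : M →ₗ[R] E),
      Module.Injective R E ∧ Function.Injective f ∧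
        ∀ e : E, e ≠ 0 → ∃ (r : R) (m : M), r • e ≠ 0 ∧ r • e = f m := by
  obtain ⟨Q, _, _, hQ, f, hf⟩ : ∃ (Q : Type u) (_ : AddCommGroup Q) (_ : Module R Q),
      ∃ (_ : Module.Injective R Q) (f : M →ₗ[R] Q), Function.Injective f := by
    let i := Injective.ι (ModuleCat.of R M)
    let Q : ModuleCat.{u} R := Injective.under (ModuleCat.of R M)
    have : Injective (ModuleCat.of R Q) := inferInstanceAs (Injective (Injective.under _))
    refine ⟨Q, inferInstance, inferInstance,
      Module.injective_module_of_injective_object R Q, i.hom, ?_⟩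
    exact (ModuleCat.mono_iff_injective i).mp inferInstance
  -- `E` will be a maximal essential extension of `M` inside the injective module `Q`, and `K` a
  -- maximal submodule meeting `E` trivially. The aim is that `E` is a retract of `Q`.
  let P (E : Submodule R Q) : Prop := LinearMap.range f ≤ E ∧
    ∀ e ∈ E, e ≠ 0 → ∃ r : R, r • e ≠ 0 ∧ r • e ∈ LinearMap.range f
  obtain ⟨E, -, hE⟩ := zorn_le_nonempty₀ {E | P E} (fun c hc hch y hy ↦ by
    refine ⟨sSup c, ⟨?_, fun e he he0 ↦ ?_⟩, fun z hz ↦ le_sSup hz⟩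
    · exact (hc hy).1.trans (le_sSup hy)
    · obtain ⟨F, hF, heF⟩ := (Submodule.mem_sSup_of_directed ⟨y, hy⟩ hch.directedOn).mp he
      exact (hc hF).2 e heF he0) (LinearMap.range f)
    ⟨le_rfl, fun e he he0 ↦ ⟨1, by simpa using he0, by simpa using he⟩⟩
  obtain ⟨K, -, hK⟩ := zorn_le_nonempty₀ {K : Submodule R Q | ∀ x ∈ K, x ∈ E → x = 0}
    (fun c hc hch y hy ↦ by
      refine ⟨sSup c, fun x hx hxE ↦ ?_, fun z hz ↦ le_sSup hz⟩
      obtain ⟨F, hF, hxF⟩ := (Submodule.mem_sSup_of_directed ⟨y, hy⟩ hch.directedOn).mp hx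
      exact hc hF x hxF hxE) ⊥ (fun x hx _ ↦ by simpa using hx)
  obtain ⟨⟨hEM, hEess⟩, hEmax⟩ := hE
  obtain ⟨hK0, hKmax⟩ := hK
  -- `E` embeds in `Q / K`, so its inclusion in `Q` extends to `Q / K`; the composite `ρ` is the
  -- identity on `E`.
  obtain ⟨g, hg⟩ := hQ.out (K.mkQ.comp E.subtype) (by
    rw [← LinearMap.ker_eq_bot, LinearMap.ker_eq_bot']
    intro x hx
    have : (x : Q) ∈ K := by simpa using hx
    exact Subtype.ext (hK0 x this x.2)) E.subtype
  let ρ : Q →ₗ[R] Q := g.comp K.mkQ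
  have hρE (x : Q) (hx : x ∈ E) : ρ x = x := hg ⟨x, hx⟩
  have hρK (x : Q) (hx : ρ x = 0) : x ∈ K := by
    have : LinearMap.ker ρ ≤ K := hKmax (y := LinearMap.ker ρ)
      (fun x hx hxE ↦ by rw [← hρE x hxE]; exact hx)
      (fun x hx ↦ by
        have : K.mkQ x = 0 := by simpa using hx
        simp [ρ, this])
    exact this hx
  -- The range of `ρ` is again an essential extension of `M`, so maximality of `E` applies. Indeed,
  -- if `ρ y ≠ 0` then `y ∉ K`, so `K + R y` meets `E` by maximality of `K`; applying `ρ` yields a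
  -- nonzero multiple of `ρ y` in `E`.
  have hρr (x : Q) : ρ x ∈ E := by
    have : LinearMap.range ρ ≤ E := hEmax (y := LinearMap.range ρ) ⟨?_, ?_⟩ ?_
    · exact this ⟨x, rfl⟩
    · rintro y hy
      exact ⟨y, hρE y (hEM hy)⟩
    · rintro _ ⟨y, rfl⟩ hy0
      have hyK : y ∉ K := fun h ↦ hy0 (by
        have : K.mkQ y = 0 := by simpa using h
        simp [ρ, this])
      obtain ⟨z, hz, hzE, hz0⟩ : ∃ z ∈ K ⊔ Submodule.span R {y}, z ∈ E ∧ z ≠ 0 := by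
        by_contra! hcon
        have := hKmax (y := K ⊔ Submodule.span R {y}) (fun x hx hxE ↦ hcon x hx hxE) le_sup_left
        exact hyK (this (Submodule.mem_sup_right (Submodule.mem_span_singleton_self y)))
      obtain ⟨k, hk, _, hy', rfl⟩ := Submodule.mem_sup.mp hz
      obtain ⟨a, rfl⟩ := Submodule.mem_span_singleton.mp hy'
      have hk0 : K.mkQ k = 0 := by simpa using hk
      have h1 : ρ (k + a • y) = a • ρ y := by
        rw [map_add, map_smul, LinearMap.comp_apply, hk0, map_zero, zero_add]
      rw [hρE _ hzE] at h1
      obtain ⟨b, hb0, hbM⟩ := hEess _ hzE hz0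
      refine ⟨b * a, ?_, ?_⟩
      · rwa [mul_smul, ← h1]
      · rwa [mul_smul, ← h1]
    · exact fun y hy ↦ ⟨y, hρE y hy⟩
  refine ⟨E, inferInstance, inferInstance, f.codRestrict E fun m ↦ hEM ⟨m, rfl⟩,
    ⟨fun {A B} _ _ _ _ i hi φ ↦ ?_⟩, fun x y h ↦ hf congr(($h : Q)), fun e he ↦ ?_⟩
  · obtain ⟨ψ, hψ⟩ := hQ.out i hi (E.subtype.comp φ)
    refine ⟨(ρ.codRestrict E hρr).comp ψ, fun x ↦ Subtype.ext ?_⟩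
    have := hψ x
    simp only [LinearMap.comp_apply] at this
    simp [this, hρE]
  · obtain ⟨r, h0, m, hm⟩ := hEess e e.2 (by simpa using he)
    refine ⟨r, m, fun h ↦ h0 (by simpa using congr(($h : Q))), Subtype.ext hm.symm⟩

end Hull

end CartierModules

/-! ### Torsion in injective modules over a Noetherian ring. -/

namespace CartierModules

open TopologicalSpace Opposite

section InjectiveModules

variable {R : Type u} [CommRing R] {E : Type u} [AddCommGroup E] [Module R E]

/-- Elements annihilated by a power of the ideal `I`. -/
def IsTors (I : Ideal R) (e : E) : Prop := ∃ n : ℕ, ∀ a ∈ I ^ n, a • e = 0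

variable (E) in
/-- The submodule of elements annihilated by a power of the ideal `I`. -/
def torsSub (I : Ideal R) : Submodule R E where
  carrier := {e | IsTors I e}
  zero_mem' := ⟨0, by simp⟩
  add_mem' := by
    rintro x y ⟨n, hn⟩ ⟨m, hm⟩
    refine ⟨max n m, fun a ha ↦ ?_⟩
    rw [smul_add, hn a (Ideal.pow_le_pow_right (le_max_left _ _) ha),
      hm a (Ideal.pow_le_pow_right (le_max_right _ _) ha), add_zero]
  smul_mem' b x := by
    rintro ⟨n, hn⟩
    exact ⟨n, fun a ha ↦ by rw [smul_comm, hn a ha, smul_zero]⟩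

/-- Extension of partially defined linear maps out of the ring to an injective module. -/
lemma exists_extend_rel [hE : Module.Injective R E] (G : Submodule R (R × E))
    (hG : ∀ e, ((0 : R), e) ∈ G → e = 0) : ∃ e₀ : E, ∀ b e, (b, e) ∈ G → e = b • e₀ := by
  obtain ⟨h, hh⟩ := hE.out ((LinearMap.fst R R E).comp G.subtype) (by
    rw [← LinearMap.ker_eq_bot, LinearMap.ker_eq_bot']
    rintro ⟨⟨b, e⟩, hbe⟩ (rfl : b = 0)
    obtain rfl := hG e hbe
    rfl) ((LinearMap.snd R R E).comp G.subtype)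
  refine ⟨h 1, fun b e hbe ↦ ?_⟩
  have : h b = e := hh ⟨(b, e), hbe⟩
  rw [← map_smul, smul_eq_mul, mul_one, this]

/-- `G` is the graph of a linear map from an ideal `J` to the `I`-torsion of `E`. As `J` is finitely
generated, one power `I ^ n` kills all values. By Artin–Rees `J ∩ I ^ (n + k) ⊆ I ^ n J`, where the
map vanishes, so it extends by zero to `I ^ (n + k)`. Any further extension to `R` is multiplication
by an element killed by `I ^ (n + k)`. -/
lemma exists_extend_rel_tors [IsNoetherianRing R] [hE : Module.Injective R E] (I : Ideal R)
    (G : Submodule R (R × E)) (hG : ∀ e, ((0 : R), e) ∈ G → e = 0)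
    (ht : ∀ b e, (b, e) ∈ G → IsTors I e) :
    ∃ e₀ : E, IsTors I e₀ ∧ ∀ b e, (b, e) ∈ G → e = b • e₀ := by
  let fst := LinearMap.fst R R E
  let snd := LinearMap.snd R R E
  have hinj (x y : R × E) (hx : x ∈ G) (hy : y ∈ G) (h : x.1 = y.1) : x = y := by
    have := hG (x - y).2 (by
      convert! G.sub_mem hx hy using 1
      ext
      · simp [h]
      · rfl)
    exact Prod.ext h (sub_eq_zero.mp this)
  obtain ⟨n, hn⟩ : ∃ n : ℕ, ∀ x ∈ I ^ n • G, x.2 = 0 := by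
    obtain ⟨S, hS⟩ := (isNoetherian_def.mp ‹IsNoetherianRing R›) (G.map fst)
    have h1 (b : R) (hb : b ∈ S) : ∃ n : ℕ, ∀ e, (b, e) ∈ G → ∀ a ∈ I ^ n, a • e = 0 := by
      obtain ⟨⟨_, e⟩, he, rfl⟩ : b ∈ G.map fst := hS ▸ Submodule.subset_span hb
      obtain ⟨n, hn⟩ := ht _ _ he
      refine ⟨n, fun e' he' ↦ ?_⟩
      obtain rfl : e = e' := congr(($(hinj _ _ he he' rfl)).2)
      exact hn
    choose! n hn using h1
    have h2 (b : R) (hb : b ∈ G.map fst) : ∀ e, (b, e) ∈ G → ∀ a ∈ I ^ (S.sup n), a • e = 0 := by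
      rw [← hS] at hb
      induction hb using Submodule.span_induction with
      | mem b hb =>
        exact fun e he a ha ↦ hn b hb e he a (Ideal.pow_le_pow_right (Finset.le_sup hb) ha)
      | zero =>
        intro e he a _
        rw [hG e he, smul_zero]
      | add x y hx hy ihx ihy =>
        intro e he a ha
        rw [hS] at hx hy
        obtain ⟨⟨_, e₁⟩, he₁, rfl⟩ := hx
        obtain ⟨⟨_, e₂⟩, he₂, rfl⟩ := hy
        obtain rfl : e = e₁ + e₂ := congr(($(hinj _ _ he (G.add_mem he₁ he₂) rfl)).2)
        rw [smul_add, ihx e₁ he₁ a ha, ihy e₂ he₂ a ha, add_zero]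
      | smul c x hx ihx =>
        intro e he a ha
        rw [hS] at hx
        obtain ⟨⟨_, e₁⟩, he₁, rfl⟩ := hx
        obtain rfl : e = c • e₁ := congr(($(hinj _ _ he (G.smul_mem c he₁) rfl)).2)
        rw [smul_comm, ihx e₁ he₁ a ha, smul_zero]
    refine ⟨S.sup n, fun x hx ↦ ?_⟩
    induction hx using Submodule.smul_induction_on' with
    | smul a ha x hx => exact h2 x.1 ⟨x, hx, rfl⟩ x.2 hx a ha
    | add x _ y _ hx hy => simp [hx, hy]
  obtain ⟨k, hk⟩ := Ideal.exists_pow_inf_eq_pow_smul I (G.map fst)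
  let G' : Submodule R (R × E) := G ⊔ Submodule.map (LinearMap.inl R R E) (I ^ (n + k) : Ideal R)
  obtain ⟨e₀, he₀⟩ := exists_extend_rel G' (by
    intro e he
    obtain ⟨x, hx, _, ⟨c, hc, rfl⟩, hxy⟩ := Submodule.mem_sup.mp he
    have hx1 : x.1 = -c := by simpa [add_eq_zero_iff_eq_neg] using congr(($hxy).1)
    have hx2 : x.2 = e := by simpa using congr(($hxy).2)
    have : x.1 ∈ I ^ (n + k) • (⊤ : Submodule R R) ⊓ G.map fst :=
      ⟨by simpa [hx1] using hc, ⟨x, hx, rfl⟩⟩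
    rw [hk _ (Nat.le_add_left k n), Nat.add_sub_cancel] at this
    have : x.1 ∈ I ^ n • G.map fst := Submodule.smul_mono le_rfl inf_le_right this
    rw [← Submodule.map_smul''] at this
    obtain ⟨y, hy, hxy⟩ := this
    have := hinj x y hx (Submodule.smul_le_right hy) hxy.symm
    rw [← hx2, this, hn y hy])
  refine ⟨e₀, ⟨n + k, fun a ha ↦ ?_⟩, fun b e hbe ↦ he₀ b e (Submodule.mem_sup_left hbe)⟩
  exact (he₀ a 0 (Submodule.mem_sup_right ⟨a, ha, rfl⟩)).symm

variable (E) in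
/-- The torsion submodule of an injective module over a Noetherian ring is a direct summand. -/
lemma exists_torsSub_projection [IsNoetherianRing R] [hE : Module.Injective R E] (I : Ideal R) :
    ∃ π : E →ₗ[R] E, (∀ e, IsTors I (π e)) ∧ ∀ e, IsTors I e → π e = e := by
  have hB : Module.Baer R (torsSub E I) := by
    intro J g
    obtain ⟨e₀, he₀, h⟩ := exists_extend_rel_tors (E := E) I
      (LinearMap.range (J.subtype.prod ((torsSub E I).subtype.comp g))) (by
        rintro e ⟨j, hj⟩
        have h1 : (j : R) = 0 := congr(($hj).1)
        obtain rfl : j = 0 := Subtype.ext h1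
        simpa using congr(($hj).2).symm) (by
        rintro b e ⟨j, hj⟩
        have h1 : (g j : E) = e := congr(($hj).2)
        exact h1 ▸ (g j).2)
    refine ⟨LinearMap.toSpanSingleton R _ ⟨e₀, he₀⟩, fun x hx ↦ Subtype.ext ?_⟩
    have := h x (g ⟨x, hx⟩) ⟨⟨x, hx⟩, rfl⟩
    simp [this]
  have hinj : Module.Injective R (torsSub E I) := hB.injective
  obtain ⟨π, hπ⟩ := hinj.out (torsSub E I).subtype (torsSub E I).injective_subtype LinearMap.id
  exact ⟨(torsSub E I).subtype.comp π, fun e ↦ (π e).2, fun e he ↦ congrArg Subtype.val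
    (hπ ⟨e, he⟩)⟩

end InjectiveModules

/-! ### Localizing sheaves: flasqueness and injectivity of sections. -/

section BasicOpens

variable {X : Scheme.{u}}

lemma isUnit_rr {U : X.Opens} (f : Γ(X, U)) : IsUnit (rr X (X.basicOpen_le f) f) :=
  RingedSpace.isUnit_res_basicOpen _ f

lemma isUnit_rr_of_le {U V : X.Opens} (f : Γ(X, U)) (hV : V ≤ X.basicOpen f) (h : V ≤ U) :
    IsUnit (rr X h f) := by
  rw [← rr_rr (X.basicOpen_le f) hV]
  exact (isUnit_rr f).map _

lemma basicOpen_rr {U V : X.Opens} (h : V ≤ U) (f : Γ(X, U)) :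
    X.basicOpen (rr X h f) = V ⊓ X.basicOpen f :=
  X.basicOpen_res f (homOfLE h).op

lemma IsAffineOpen.exists_rr_eq {V : X.Opens} (hV : IsAffineOpen V) (h : Γ(X, V))
    (b : Γ(X, X.basicOpen h)) :
    ∃ (n : ℕ) (c : Γ(X, V)), rr X (X.basicOpen_le h) c = rr X (X.basicOpen_le h) h ^ n * b := by
  have := hV.isLocalization_basicOpen h
  obtain ⟨⟨c, ⟨_, n, rfl⟩⟩, hc⟩ := IsLocalization.surj (Submonoid.powers h) b
  refine ⟨n, c, ?_⟩
  rw [mul_comm, ← map_pow]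
  exact hc.symm

/-- Opens in an affine open of a Noetherian scheme are finite unions of basic opens. -/
lemma IsAffineOpen.exists_finset_basicOpen [IsNoetherian X] {V : X.Opens} (hV : IsAffineOpen V)
    {W : X.Opens} (hW : W ≤ V) :
    ∃ S : Finset Γ(X, V), (∀ f ∈ S, X.basicOpen f ≤ W) ∧ ∀ x ∈ W, ∃ f ∈ S, x ∈ X.basicOpen f := by
  classical
  choose f hf hx using fun x : W ↦ hV.exists_basicOpen_le x (hW x.2)
  obtain ⟨T, hT⟩ := (NoetherianSpace.isCompact (W : Set X)).elim_finite_subcover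
    (fun x : W ↦ (X.basicOpen (f x) : Set X)) (fun x ↦ (X.basicOpen (f x)).isOpen)
    (fun x hxW ↦ Set.mem_iUnion.mpr ⟨⟨x, hxW⟩, hx _⟩)
  refine ⟨T.image f, fun g hg ↦ ?_, fun x hxW ↦ ?_⟩
  · obtain ⟨y, -, rfl⟩ := Finset.mem_image.mp hg
    exact hf y
  · obtain ⟨y, hy, hxy⟩ := Set.mem_iUnion₂.mp (hT hxW)
    exact ⟨f y, Finset.mem_image_of_mem _ hy, hxy⟩

/-- Opens of a Noetherian scheme are finite unions of affine opens. -/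
lemma exists_finite_affine_cover [IsNoetherian X] (W : X.Opens) :
    ∃ S : Set X.Opens, S.Finite ∧ (∀ V ∈ S, IsAffineOpen V ∧ V ≤ W) ∧ ∀ x ∈ W, ∃ V ∈ S, x ∈ V := by
  have h1 (x : W) : ∃ V : X.Opens, IsAffineOpen V ∧ V ≤ W ∧ x.1 ∈ V := by
    obtain ⟨_, ⟨V, hV, rfl⟩, hxV, hVW⟩ := X.isBasis_affineOpens.exists_subset_of_mem_open x.2 W.isOpen
    exact ⟨V, hV, hVW, hxV⟩
  choose V hV hVW hx using h1
  obtain ⟨T, hT⟩ := (NoetherianSpace.isCompact (W : Set X)).elim_finite_subcover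
    (fun x : W ↦ (V x : Set X)) (fun x ↦ (V x).isOpen)
    (fun x hxW ↦ Set.mem_iUnion.mpr ⟨⟨x, hxW⟩, hx _⟩)
  refine ⟨V '' T, T.finite_toSet.image _, ?_, fun x hxW ↦ ?_⟩
  · rintro _ ⟨x, -, rfl⟩
    exact ⟨hV x, hVW x⟩
  · obtain ⟨y, hy, hxy⟩ := Set.mem_iUnion₂.mp (hT hxW)
    exact ⟨V y, ⟨y, hy, rfl⟩, hxy⟩

/-- Sections over a basic open extend up to a power, and sections vanishing on a basic open are
annihilated by a power. -/
structure Localizing (M : X.Modules) : Prop where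
  exists_lift {U : X.Opens} (f : Γ(X, U)) (s : Γ(M, X.basicOpen f)) :
    ∃ (n : ℕ) (t : Γ(M, U)), rs M (X.basicOpen_le f) t = rr X (X.basicOpen_le f) f ^ n • s
  exists_pow_smul_eq_zero {U : X.Opens} (f : Γ(X, U)) (t : Γ(M, U)) :
    rs M (X.basicOpen_le f) t = 0 → ∃ n : ℕ, f ^ n • t = 0

lemma smul_eq_zero_of_isUnit {R M : Type*} [Ring R] [AddCommGroup M] [Module R M] {a : R}
    (ha : IsUnit a) {m : M} (h : a • m = 0) : m = 0 :=
  ha.smul_eq_zero.mp h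

lemma smul_cancel_of_isUnit {R M : Type*} [Ring R] [AddCommGroup M] [Module R M] {a : R}
    (ha : IsUnit a) {m m' : M} (h : a • m = a • m') : m = m' :=
  ha.smul_left_cancel.mp h

namespace Localizing

variable {M : X.Modules} (hM : Localizing M)
include hM

/-- Sections over `V ≤ W` vanish on the open `W` covered by basic opens `D(f)` if and only if they
are torsion for the ideal generated by the `f`. -/
lemma rs_eq_zero_iff {V W : X.Opens} (hWV : W ≤ V) (S : Finset Γ(X, V))
    (hS : ∀ f ∈ S, X.basicOpen f ≤ W) (hS' : ∀ x ∈ W, ∃ f ∈ S, x ∈ X.basicOpen f) (m : Γ(M, V)) :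
    rs M hWV m = 0 ↔ IsTors (Ideal.span (S : Set Γ(X, V))) m := by
  constructor
  · intro h
    have h1 (f : Γ(X, V)) (hf : f ∈ S) : ∃ n : ℕ, f ^ n • m = 0 :=
      hM.exists_pow_smul_eq_zero f m (by rw [← rs_rs M hWV (hS f hf), h, map_zero])
    choose! n hn using h1
    let J : Ideal Γ(X, V) := LinearMap.ker (LinearMap.toSpanSingleton Γ(X, V) _ m)
    have h2 : Ideal.span (S : Set Γ(X, V)) ≤ J.radical := by
      rw [Ideal.span_le]
      intro f hf
      exact ⟨n f, by simpa [J] using hn f hf⟩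
    obtain ⟨N, hN⟩ := Ideal.exists_pow_le_of_le_radical_of_fg h2 ⟨S, rfl⟩
    exact ⟨N, fun a ha ↦ by simpa [J] using hN ha⟩
  · rintro ⟨n, hn⟩
    refine section_ext M fun x hx ↦ ?_
    obtain ⟨f, hf, hxf⟩ := hS' x hx
    refine ⟨X.basicOpen f, hS f hf, hxf, ?_⟩
    rw [rs_rs, map_zero]
    refine smul_eq_zero_of_isUnit ((isUnit_rr f).pow n) ?_
    rw [← map_pow, ← rs_smul, hn _ (Ideal.pow_mem_pow (Ideal.subset_span hf) n), map_zero]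

/-- Sections of a localizing sheaf with injective sections over an affine open `V` extend to `V`. -/
lemma rs_surjective [IsNoetherian X] {V W : X.Opens} (hV : IsAffineOpen V) (hWV : W ≤ V)
    [Module.Injective Γ(X, V) Γ(M, V)] : Function.Surjective (rs M hWV) := by
  intro t
  have : IsNoetherianRing Γ(X, V) := IsLocallyNoetherian.component_noetherian ⟨V, hV⟩
  obtain ⟨S, hS, hS'⟩ := IsAffineOpen.exists_finset_basicOpen hV hWV
  -- The torsion submodule is the kernel of restriction to `W`. Requiring `π e = 0` singles out one
  -- lift of each multiple of `t` that lifts, so the relation `G` below is the graph of a partial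
  -- map.
  obtain ⟨π, hπ, hπ'⟩ := exists_torsSub_projection Γ(M, V) (Ideal.span (S : Set Γ(X, V)))
  have hker := hM.rs_eq_zero_iff hWV S hS hS'
  have h1 (f : Γ(X, V)) (hf : f ∈ S) :
      ∃ (n : ℕ) (e : Γ(M, V)), rs M hWV e = rr X hWV f ^ n • t := by
    obtain ⟨n, e, he⟩ := hM.exists_lift f (rs M (hS f hf) t)
    have hD : X.basicOpen (rr X hWV f) ≤ X.basicOpen f := (basicOpen_rr hWV f).trans_le inf_le_right
    obtain ⟨m, hm⟩ := hM.exists_pow_smul_eq_zero (rr X hWV f) (rs M hWV e - rr X hWV f ^ n • t) (by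
      have := congrArg (rs M hD) he
      simp only [rs_rs, rs_smul, map_pow, rr_rr] at this
      simp [this])
    refine ⟨m + n, f ^ m • e, ?_⟩
    rw [rs_smul, map_pow, pow_add, mul_smul, ← sub_eq_zero, ← smul_sub, hm]
  let G : Submodule Γ(X, V) (Γ(X, V) × Γ(M, V)) :=
    { carrier := {x | rs M hWV x.2 = rr X hWV x.1 • t ∧ π x.2 = 0}
      zero_mem' := by simp
      add_mem' := by
        rintro x y ⟨h, h'⟩ ⟨k, k'⟩
        simp [h, h', k, k', add_smul]
      smul_mem' := by
        rintro a x ⟨h, h'⟩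
        simp [h, h', mul_smul] }
  have hG (b : Γ(X, V)) (e : Γ(M, V)) (he : rs M hWV e = rr X hWV b • t) : (b, e - π e) ∈ G := by
    refine ⟨?_, ?_⟩
    · simp [(hker _).mpr (hπ e), he]
    · simp [hπ' _ (hπ e)]
  obtain ⟨e₀, he₀⟩ := exists_extend_rel G (by
    rintro e ⟨h, h'⟩
    rw [map_zero, zero_smul] at h
    rw [← hπ' e ((hker e).mp h)]
    exact h')
  refine ⟨e₀, section_ext M fun x hx ↦ ?_⟩
  obtain ⟨f, hf, hxf⟩ := hS' x hx
  refine ⟨X.basicOpen f, hS f hf, hxf, ?_⟩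
  obtain ⟨n, e, he⟩ := h1 f hf
  have h2 := he₀ (f ^ n) _ (hG (f ^ n) e (by rw [he, map_pow]))
  have h3 := congrArg (rs M hWV) h2
  rw [map_sub, (hker _).mpr (hπ e), sub_zero, he, rs_smul, map_pow] at h3
  have h4 := congrArg (rs M (hS f hf)) h3
  simp only [rs_smul, map_pow, rr_rr] at h4
  exact (smul_cancel_of_isUnit ((isUnit_rr f).pow n) h4).symm

/-- Sections of a localizing sheaf over a basic open of an affine open are injective if they
are injective over the affine open. -/
lemma injective_basicOpen [IsNoetherian X] {V : X.Opens} (hV : IsAffineOpen V) (h : Γ(X, V))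
    [Module.Injective Γ(X, V) Γ(M, V)] :
    Module.Injective Γ(X, X.basicOpen h) Γ(M, X.basicOpen h) := by
  have : IsNoetherianRing Γ(X, V) := IsLocallyNoetherian.component_noetherian ⟨V, hV⟩
  let _ : Algebra Γ(X, V) Γ(X, X.basicOpen h) := (rr X (X.basicOpen_le h)).toAlgebra
  have : IsLocalization (Submonoid.powers h) Γ(X, X.basicOpen h) := hV.isLocalization_basicOpen h
  let _ : Module Γ(X, V) Γ(M, X.basicOpen h) := Module.compHom _ (rr X (X.basicOpen_le h))
  have hsm (a : Γ(X, V)) (m : Γ(M, X.basicOpen h)) : a • m = rr X (X.basicOpen_le h) a • m := rfl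
  have : IsScalarTower Γ(X, V) Γ(X, X.basicOpen h) Γ(M, X.basicOpen h) :=
    IsScalarTower.of_algebraMap_smul fun _ _ ↦ rfl
  let f : Γ(M, V) →ₗ[Γ(X, V)] Γ(M, X.basicOpen h) :=
    { rs M (X.basicOpen_le h) with
      map_smul' a m := rs_smul M _ a m }
  have : IsLocalizedModule (Submonoid.powers h) f := by
    refine IsLocalizedModule.Away.mk_of_addCommGroup ?_ (fun x ↦ ?_) (fun x hx ↦ ?_)
    · rw [Module.End.isUnit_iff]
      refine ⟨fun x y hxy ↦ smul_cancel_of_isUnit (isUnit_rr h) hxy, fun y ↦ ?_⟩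
      obtain ⟨u, hu⟩ := isUnit_rr h
      refine ⟨(↑u⁻¹ : Γ(X, X.basicOpen h)) • y, ?_⟩
      rw [Module.algebraMap_end_apply, hsm, ← hu, smul_smul, Units.mul_inv, one_smul]
    · obtain ⟨n, t, ht⟩ := hM.exists_lift h x
      refine ⟨n, t, ?_⟩
      rw [hsm, map_pow]
      exact ht.symm
    · exact hM.exists_pow_smul_eq_zero h x hx
  exact Module.injective_of_isLocalizedModule (Submonoid.powers h) f

end Localizing

end BasicOpens

end CartierModules

/-! ### Localizing sheaves with injective sections are injective among all modules. -/

namespace CartierModules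

open TopologicalSpace Opposite

variable {X : Scheme.{u}}

/-- In a Noetherian scheme, a nonempty subset which is relatively closed in an open contains the
generic point of one of its irreducible components. -/
lemma exists_generic_point [IsNoetherian X] {U : X.Opens} {Z : Set X} (hZU : Z ⊆ U)
    (hne : Z.Nonempty)
    (hZ : ∀ x ∈ U, x ∉ Z → ∃ V : X.Opens, x ∈ V ∧ ∀ y ∈ V, y ∉ Z) :
    ∃ (V : X.Opens) (x : X), V ≤ U ∧ x ∈ V ∧ x ∈ Z ∧
      ∀ W : X.Opens, W ≤ V → (∃ y ∈ W, y ∈ Z) → x ∈ W := by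
  -- Choose a nonempty `Z ∩ V` with minimal closure. Shrinking `V` without losing all of `Z` keeps
  -- the closure, which is therefore irreducible. Its generic point lies in `Z` because `Z` is
  -- closed in `U`.
  have hwf : WellFounded (fun s t : Closeds X ↦ s < t) := wellFounded_lt
  obtain ⟨C, ⟨V, hVU, ⟨z, hzV, hzZ⟩, rfl⟩, hmin⟩ := hwf.has_min
    {C | ∃ V : X.Opens, V ≤ U ∧ (∃ y ∈ V, y ∈ Z) ∧ C = Closeds.closure (Z ∩ V)}
    ⟨_, U, le_rfl, ⟨hne.some, hZU hne.some_mem, hne.some_mem⟩, rfl⟩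
  have hkey (W : X.Opens) (h : ∃ y ∈ W, y ∈ Z ∩ V) :
      closure (Z ∩ V) ⊆ closure (Z ∩ (V ⊓ W : X.Opens)) := by
    obtain ⟨y, hyW, hyZ, hyV⟩ := h
    have h1 := hmin (Closeds.closure (Z ∩ (V ⊓ W : X.Opens)))
      ⟨V ⊓ W, inf_le_left.trans hVU, ⟨y, ⟨hyV, hyW⟩, hyZ⟩, rfl⟩
    have h2 : Closeds.closure (Z ∩ (V ⊓ W : X.Opens)) ≤ Closeds.closure (Z ∩ (V : Set X)) :=
      closure_mono (Set.inter_subset_inter_right _ (inf_le_left : V ⊓ W ≤ V))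
    exact (eq_of_le_of_not_lt h2 h1).ge
  have hopen (W : X.Opens) (h : ((closure (Z ∩ V) : Set X) ∩ W).Nonempty) :
      ∃ y ∈ W, y ∈ Z ∩ V := by
    obtain ⟨y, hy, hyW⟩ := h
    obtain ⟨y', hy', hyZ⟩ := mem_closure_iff.mp hy W W.isOpen hyW
    exact ⟨y', hy', hyZ⟩
  have hirr : IsIrreducible (closure (Z ∩ V) : Set X) := by
    refine ⟨⟨z, subset_closure ⟨hzZ, hzV⟩⟩, fun A B hA hB hAne hBne ↦ ?_⟩
    have h1 := hkey ⟨A, hA⟩ (hopen ⟨A, hA⟩ hAne)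
    obtain ⟨y, hy, hyB⟩ := hBne
    obtain ⟨y', hy'B, hy'Z, hy'V, hy'A⟩ := mem_closure_iff.mp (h1 hy) B hB hyB
    exact ⟨y', subset_closure ⟨hy'Z, hy'V⟩, hy'A, hy'B⟩
  obtain ⟨x, hx⟩ := QuasiSober.sober hirr isClosed_closure
  have hmem (W : X.Opens) (h : ∃ y ∈ W, y ∈ Z ∩ V) : x ∈ W := by
    obtain ⟨y, hyW, hyZ⟩ := h
    exact (hx.mem_open_set_iff W.isOpen).mpr ⟨y, subset_closure hyZ, hyW⟩
  have hxV : x ∈ V := hmem V ⟨z, hzV, hzZ, hzV⟩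
  refine ⟨V, x, hVU, hxV, ?_, fun W hW ⟨y, hyW, hyZ⟩ ↦ hmem W ⟨y, hyW, hyZ, hW hyW⟩⟩
  by_contra hxZ
  obtain ⟨W, hxW, hW⟩ := hZ x (hVU hxV) hxZ
  obtain ⟨y, hyW, hyZ, -⟩ := hopen W ⟨x, hx.mem, hxW⟩
  exact hW y hyW hyZ

variable {F Y : X.Modules} (ι : F ⟶ Y)

/-- A maximal family of submodules stable under restriction and independent from the image of a
monomorphism `ι`. -/
lemma exists_maximal_complement [Mono ι] :
    ∃ K : ∀ U : X.Opens, Submodule Γ(X, U) Γ(Y, U),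
      (∀ (U V : X.Opens) (h : V ≤ U), ∀ s ∈ K U, rs Y h s ∈ K V) ∧
      (∀ (U : X.Opens) (m : Γ(F, U)), ι.app U m ∈ K U → m = 0) ∧
      ∀ K' : ∀ U : X.Opens, Submodule Γ(X, U) Γ(Y, U),
      (∀ (U V : X.Opens) (h : V ≤ U), ∀ s ∈ K' U, rs Y h s ∈ K' V) →
      (∀ (U : X.Opens) (m : Γ(F, U)), ι.app U m ∈ K' U → m = 0) → K ≤ K' → K' ≤ K := by
  obtain ⟨K, -, ⟨h1, h2⟩, h3⟩ := zorn_le_nonempty₀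
    {K : ∀ U : X.Opens, Submodule Γ(X, U) Γ(Y, U) |
      (∀ (U V : X.Opens) (h : V ≤ U), ∀ s ∈ K U, rs Y h s ∈ K V) ∧
      (∀ (U : X.Opens) (m : Γ(F, U)), ι.app U m ∈ K U → m = 0)}
    (fun c hc hch y hy ↦ by
      have : Nonempty c := ⟨⟨y, hy⟩⟩
      have hmem (U : X.Opens) (s : Γ(Y, U)) : s ∈ (sSup c) U ↔ ∃ K ∈ c, s ∈ K U := by
        rw [sSup_apply, Submodule.mem_iSup_of_directed]
        · simp
        · intro a b
          obtain ⟨d, hd, h⟩ := hch.directedOn a.1 a.2 b.1 b.2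
          exact ⟨⟨d, hd⟩, h.1 U, h.2 U⟩
      refine ⟨sSup c, ⟨fun U V h s hs ↦ ?_, fun U m hm ↦ ?_⟩, fun z hz ↦ le_sSup hz⟩
      · obtain ⟨K, hK, hs⟩ := (hmem _ _).mp hs
        exact (hmem _ _).mpr ⟨K, hK, (hc hK).1 U V h s hs⟩
      · obtain ⟨K, hK, hm⟩ := (hmem _ _).mp hm
        exact (hc hK).2 U m hm) ⊥ ⟨fun U V h s hs ↦ by
          obtain rfl : s = 0 := hs
          simp, fun U m hm ↦ app_injective ι U (by
          rw [map_zero]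
          exact hm)⟩
  exact ⟨K, h1, h2, fun K' h h' hle ↦ h3 ⟨h, h'⟩ hle⟩

/-- A monomorphism out of a localizing sheaf with injective global sections on a Noetherian affine
scheme admits a retraction. -/
theorem exists_retraction [IsNoetherian X] [IsAffine X] (hF : Localizing F)
    [Module.Injective Γ(X, ⊤) Γ(F, ⊤)] [Mono ι] : ∃ ρ : Y ⟶ F, ι ≫ ρ = 𝟙 F := by
  obtain ⟨K, hKres, hK0, hKmax⟩ := exists_maximal_complement ι
  -- The sections that are locally in `K` still form a family independent from `F`, so maximality
  -- makes `K` a subsheaf.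
  have hKloc (U : X.Opens) (s : Γ(Y, U))
      (hs : ∀ x ∈ U, ∃ (V : X.Opens) (h : V ≤ U), x ∈ V ∧ rs Y h s ∈ K V) : s ∈ K U := by
    let K' (U : X.Opens) : Submodule Γ(X, U) Γ(Y, U) :=
      { carrier := {s | ∀ x ∈ U, ∃ (V : X.Opens) (h : V ≤ U), x ∈ V ∧ rs Y h s ∈ K V}
        zero_mem' := fun x hx ↦ ⟨U, le_rfl, hx, by simp⟩
        add_mem' := fun {s t} hs ht x hx ↦ by
          obtain ⟨V, hV, hxV, hsV⟩ := hs x hx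
          obtain ⟨V', hV', hxV', htV'⟩ := ht x hx
          refine ⟨V ⊓ V', inf_le_left.trans hV, ⟨hxV, hxV'⟩, ?_⟩
          rw [map_add, ← rs_rs Y hV inf_le_left, ← rs_rs Y hV' (inf_le_right : V ⊓ V' ≤ V')]
          exact (K _).add_mem (hKres _ _ _ _ hsV) (hKres _ _ _ _ htV')
        smul_mem' := fun a s hs x hx ↦ by
          obtain ⟨V, hV, hxV, hsV⟩ := hs x hx
          refine ⟨V, hV, hxV, ?_⟩
          rw [rs_smul]
          exact (K _).smul_mem _ hsV }
    refine hKmax K' (fun U V h s hs x hx ↦ ?_) (fun U m hm ↦ ?_) (fun U s hs x hx ↦ ?_) U hs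
    · obtain ⟨V', hV', hxV', hsV'⟩ := hs x (h hx)
      refine ⟨V ⊓ V', inf_le_left, ⟨hx, hxV'⟩, ?_⟩
      rw [rs_rs, ← rs_rs Y hV' inf_le_right]
      exact hKres _ _ _ _ hsV'
    · refine section_ext F fun x hx ↦ ?_
      obtain ⟨V, hV, hxV, hmV⟩ := hm x hx
      refine ⟨V, hV, hxV, ?_⟩
      rw [← app_rs] at hmV
      rw [hK0 V _ hmV, map_zero]
    · exact ⟨U, le_rfl, hx, by simpa using hs⟩
  let H (U : X.Opens) (s : Γ(Y, U)) : Prop := ∃ m : Γ(F, U), s - ι.app U m ∈ K U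
  have hHuniq (U : X.Opens) (s : Γ(Y, U)) (m m' : Γ(F, U)) (hm : s - ι.app U m ∈ K U)
      (hm' : s - ι.app U m' ∈ K U) : m = m' := by
    rw [← sub_eq_zero]
    refine hK0 U _ ?_
    convert! (K U).sub_mem hm' hm using 1
    simp
  have hHrs (U V : X.Opens) (h : V ≤ U) (s : Γ(Y, U)) (m : Γ(F, U)) (hm : s - ι.app U m ∈ K U) :
      rs Y h s - ι.app V (rs F h m) ∈ K V := by
    rw [app_rs, ← map_sub]
    exact hKres _ _ _ _ hm
  have hHloc (U : X.Opens) (s : Γ(Y, U))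
      (hs : ∀ x ∈ U, ∃ (V : X.Opens) (h : V ≤ U), x ∈ V ∧ H V (rs Y h s)) : H U s := by
    obtain ⟨m, hm⟩ := exists_glue F U (fun V m ↦ ∃ h : V ≤ U, rs Y h s - ι.app V m ∈ K V)
      (fun V W h m ⟨h', hm⟩ ↦ ⟨h.trans h', by
        rw [← rs_rs Y h' h]
        exact hHrs _ _ h _ _ hm⟩)
      (fun V m m' ⟨h, hm⟩ ⟨_, hm'⟩ ↦ hHuniq V _ m m' hm hm')
      (fun x hx ↦ by
        obtain ⟨V, hV, hxV, m, hm⟩ := hs x hx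
        exact ⟨V, hV, hxV, m, hV, hm⟩)
    refine ⟨m, hKloc U _ fun x hx ↦ ?_⟩
    obtain ⟨V, hV, hxV, _, hmV⟩ := hm x hx
    refine ⟨V, hV, hxV, ?_⟩
    rw [map_sub, ← app_rs]
    exact hmV
  have hHtop (U : X.Opens) (s : Γ(Y, U)) : H U s := by
    by_contra hs
    -- `Z` is the locus near which `s` is not in `F + K`. The contradiction will be that `s` does
    -- lie in `F + K` around a generic point `x` of `Z`.
    let Z : Set X := {x | x ∈ U ∧ ∀ (V : X.Opens) (h : V ≤ U), x ∈ V → ¬ H V (rs Y h s)}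
    obtain ⟨V₀, x, hV₀U, hxV₀, hxZ, hgen⟩ := exists_generic_point (U := U) (Z := Z)
      (fun x hx ↦ hx.1) (by
        by_contra hne
        refine hs (hHloc U s fun x hx ↦ ?_)
        by_contra! hcon
        exact hne ⟨x, hx, hcon⟩)
      (fun x hxU hxZ ↦ by
        have : ∃ (V : X.Opens) (h : V ≤ U), x ∈ V ∧ H V (rs Y h s) := by
          by_contra! hcon
          exact hxZ ⟨hxU, hcon⟩
        obtain ⟨V, hV, hxV, hsV⟩ := this
        exact ⟨V, hxV, fun y hy hyZ ↦ hyZ.2 V hV hy hsV⟩)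
    have htop : IsAffineOpen (⊤ : X.Opens) := isAffineOpen_top X
    have : IsNoetherianRing Γ(X, ⊤) := IsLocallyNoetherian.component_noetherian ⟨⊤, htop⟩
    -- These `a`, for which `a s` lies in `F + K` near `x`, form a finitely generated ideal. Hence
    -- one basic open `V` around `x` serves for all of them.
    let P𝔞 (a : Γ(X, ⊤)) : Prop := ∃ (V : X.Opens) (h : V ≤ V₀), x ∈ V ∧
      H V (rr X (le_top : V ≤ ⊤) a • rs Y (h.trans hV₀U) s)
    have hadd (a b : Γ(X, ⊤)) (ha : P𝔞 a) (hb : P𝔞 b) : P𝔞 (a + b) := by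
      obtain ⟨V, hV, hxV, m, hm⟩ := ha
      obtain ⟨V', hV', hxV', m', hm'⟩ := hb
      refine ⟨V ⊓ V', inf_le_left.trans hV, ⟨hxV, hxV'⟩,
        rs F inf_le_left m + rs F inf_le_right m', ?_⟩
      have h1 := (K _).add_mem (hHrs _ _ (inf_le_left : V ⊓ V' ≤ V) _ _ hm)
        (hHrs _ _ (inf_le_right : V ⊓ V' ≤ V') _ _ hm')
      rw [rs_smul, rs_smul, rr_rr, rr_rr, rs_rs, rs_rs] at h1
      convert! h1 using 1
      rw [map_add, map_add, add_smul]
      abel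
    have hsmul (b a : Γ(X, ⊤)) (ha : P𝔞 a) : P𝔞 (b * a) := by
      obtain ⟨V, hV, hxV, m, hm⟩ := ha
      refine ⟨V, hV, hxV, rr X (le_top : V ≤ ⊤) b • m, ?_⟩
      rw [app_smul, map_mul, mul_smul, ← smul_sub]
      exact (K V).smul_mem _ hm
    let 𝔞 : Ideal Γ(X, ⊤) :=
      { carrier := {a | P𝔞 a}
        zero_mem' := ⟨V₀, le_rfl, hxV₀, 0, by
          rw [map_zero, zero_smul, map_zero, sub_zero]
          exact (K _).zero_mem⟩
        add_mem' := fun ha hb ↦ hadd _ _ ha hb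
        smul_mem' := fun b a ha ↦ hsmul b a ha }
    obtain ⟨S, hS⟩ := (isNoetherian_def.mp this) 𝔞
    obtain ⟨V₁, hV₁, hxV₁, hSV₁⟩ : ∃ (V : X.Opens) (h : V ≤ V₀), x ∈ V ∧ ∀ a ∈ S,
        H V (rr X (le_top : V ≤ ⊤) a • rs Y (h.trans hV₀U) s) := by
      have hS' : ∀ a ∈ S, a ∈ 𝔞 := fun a ha ↦ hS ▸ Submodule.subset_span ha
      clear hS
      classical
      induction S using Finset.induction_on with
      | empty => exact ⟨V₀, le_rfl, hxV₀, by simp⟩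
      | insert a S _ ih =>
        obtain ⟨V, hV, hxV, hSV⟩ := ih fun b hb ↦ hS' b (Finset.mem_insert_of_mem hb)
        obtain ⟨V', hV', hxV', m, hm⟩ := hS' a (Finset.mem_insert_self _ _)
        refine ⟨V ⊓ V', inf_le_left.trans hV, ⟨hxV, hxV'⟩, fun b hb ↦ ?_⟩
        obtain rfl | hb := Finset.mem_insert.mp hb
        · exact ⟨_, by simpa using hHrs _ _ (inf_le_right : V ⊓ V' ≤ V') _ _ hm⟩
        · obtain ⟨m, hm⟩ := hSV b hb
          exact ⟨_, by simpa using hHrs _ _ (inf_le_left : V ⊓ V' ≤ V) _ _ hm⟩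
    obtain ⟨h, hhV₁, hxh⟩ := htop.exists_basicOpen_le ⟨x, hxV₁⟩ (Opens.mem_top x)
    set V := X.basicOpen h with hVdef
    have hVU : V ≤ U := hhV₁.trans (hV₁.trans hV₀U)
    have h𝔞 (a : Γ(X, ⊤)) (ha : a ∈ 𝔞) : H V (rr X (le_top : V ≤ ⊤) a • rs Y hVU s) := by
      rw [← hS] at ha
      induction ha using Submodule.span_induction with
      | mem a ha =>
        obtain ⟨m, hm⟩ := hSV₁ a ha
        exact ⟨_, by simpa using hHrs _ _ hhV₁ _ _ hm⟩
      | zero => exact ⟨0, by simp⟩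
      | add a b _ _ iha ihb =>
        obtain ⟨m, hm⟩ := iha
        obtain ⟨m', hm'⟩ := ihb
        refine ⟨m + m', ?_⟩
        convert! (K V).add_mem hm hm' using 1
        simp [add_smul]
        abel
      | smul b a _ iha =>
        obtain ⟨m, hm⟩ := iha
        refine ⟨rr X (le_top : V ≤ ⊤) b • m, ?_⟩
        rw [app_smul, smul_eq_mul, map_mul, mul_smul, ← smul_sub]
        exact (K V).smul_mem _ hm
    have hVaff : IsAffineOpen V := htop.basicOpen h
    have : Module.Injective Γ(X, V) Γ(F, V) := hF.injective_basicOpen htop h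
    have : IsNoetherianRing Γ(X, V) := IsLocallyNoetherian.component_noetherian ⟨V, hVaff⟩
    -- `W` is the largest open of `V` over which `s` lies in `F + K`. By genericity of `x` it
    -- contains every open of `V` that avoids `x`.
    let W : X.Opens := sSup {V' | ∃ h : V' ≤ V, H V' (rs Y (h.trans hVU) s)}
    have hWV : W ≤ V := sSup_le fun V' hV' ↦ hV'.1
    have hDW (D : X.Opens) (hD : D ≤ V) (hxD : x ∉ D) : D ≤ W := by
      intro y hy
      have hyZ : y ∉ Z := fun hyZ ↦ hxD (hgen D (hD.trans (hhV₁.trans hV₁)) ⟨y, hy, hyZ⟩)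
      have : ∃ (V : X.Opens) (h : V ≤ U), y ∈ V ∧ H V (rs Y h s) := by
        by_contra! hcon
        exact hyZ ⟨hVU (hD hy), hcon⟩
      obtain ⟨V', hV', hyV', m, hm⟩ := this
      refine Opens.mem_sSup.mpr ⟨V' ⊓ V, ⟨inf_le_right, rs F inf_le_left m, ?_⟩, hyV', hD hy⟩
      simpa using hHrs _ _ (inf_le_left : V' ⊓ V ≤ V') _ _ hm
    obtain ⟨t, ht⟩ : H W (rs Y (hWV.trans hVU) s) := by
      refine hHloc _ _ fun y hy ↦ ?_
      obtain ⟨V', ⟨hV', hsV'⟩, hyV'⟩ := Opens.mem_sSup.mp hy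
      refine ⟨V', le_sSup ⟨hV', hsV'⟩, hyV', ?_⟩
      rwa [rs_rs]
    -- Flasqueness extends the `F`-component of `s` over `W` to `V`; subtracting it leaves a section
    -- that lies in `K` over `W`.
    obtain ⟨e, he⟩ := hF.rs_surjective hVaff hWV t
    obtain ⟨s₁, hs₁⟩ : ∃ s₁ : Γ(Y, V), s₁ = rs Y hVU s - ι.app V e := ⟨_, rfl⟩
    have hs₁W : rs Y hWV s₁ ∈ K W := by
      simp only [hs₁]
      rwa [map_sub, rs_rs, ← app_rs, he]
    -- The graph of the partial map sending `a` to the `F`-component of `a s₁`. Its values vanish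
    -- over `W`, so they are torsion and the map is multiplication by an `f₁` that also vanishes
    -- over `W`. Then `s₂ = s₁ - f₁` is still in `K` over `W`, and `a s₂ ∈ K` whenever `a s₁ ∈ F +
    -- K`.
    let G : Submodule Γ(X, V) (Γ(X, V) × Γ(F, V)) :=
      { carrier := {x | x.1 • s₁ - ι.app V x.2 ∈ K V}
        zero_mem' := by simp
        add_mem' := by
          rintro x y hx hy
          simp only [Set.mem_ofPred_eq] at hx hy ⊢
          convert! (K V).add_mem hx hy using 1
          simp [add_smul]
          abel
        smul_mem' := by
          rintro a x hx
          simp only [Set.mem_ofPred_eq] at hx ⊢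
          convert! (K V).smul_mem a hx using 1
          change (a * x.1) • s₁ - ι.app V (a • x.2) = _
          rw [smul_sub, ← app_smul, ← mul_smul] }
    obtain ⟨S', hS', hS''⟩ := IsAffineOpen.exists_finset_basicOpen hVaff hWV
    have htors := hF.rs_eq_zero_iff hWV S' hS' hS''
    obtain ⟨f₁, hf₁, hGf₁⟩ := exists_extend_rel_tors (Ideal.span (S' : Set Γ(X, V))) G
      (fun m hm ↦ hK0 V m (by
        have hm : (0 : Γ(X, V)) • s₁ - ι.app V m ∈ K V := hm
        simpa using (K V).neg_mem hm))
      (fun a m hm ↦ (htors m).mp (hK0 W _ (by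
        have hm : a • s₁ - ι.app V m ∈ K V := hm
        have h1 := hKres _ _ hWV _ hm
        have h2 := (K W).sub_mem ((K W).smul_mem (rr X hWV a) hs₁W) h1
        rw [map_sub, rs_smul, sub_sub_cancel] at h2
        rwa [app_rs])))
    rw [← htors] at hf₁
    obtain ⟨s₂, hs₂⟩ : ∃ s₂ : Γ(Y, V), s₂ = s₁ - ι.app V f₁ := ⟨_, rfl⟩
    have hs₂W : rs Y hWV s₂ ∈ K W := by
      simp only [hs₂]
      rwa [map_sub, ← app_rs, hf₁, map_zero, sub_zero]
    have hs₂G (a : Γ(X, V)) (m : Γ(F, V)) (ham : (a, m) ∈ G) : a • s₂ ∈ K V := by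
      obtain rfl := hGf₁ a m ham
      simp only [hs₂]
      rw [smul_sub, ← app_smul]
      exact ham
    -- If adding `s₂` to `K` keeps it independent from `F`, maximality gives `s₂ ∈ K`, so that `s =
    -- s₂ + e + f₁` is in `F + K` over `V ∋ x`.
    let K' (U' : X.Opens) : Submodule Γ(X, U') Γ(Y, U') :=
      K U' ⊔ ⨆ h : U' ≤ V, Submodule.span _ {rs Y h s₂}
    have hK' (U' : X.Opens) (y : Γ(Y, U')) :
        y ∈ K' U' ↔ y ∈ K U' ∨ ∃ (h : U' ≤ V) (a : Γ(X, U')), y - a • rs Y h s₂ ∈ K U' := by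
      by_cases h : U' ≤ V
      · simp only [K', iSup_pos h, Submodule.mem_sup, Submodule.mem_span_singleton]
        constructor
        · rintro ⟨k, hk, _, ⟨a, rfl⟩, rfl⟩
          exact Or.inr ⟨h, a, by simpa using hk⟩
        · rintro (hy | ⟨_, a, ha⟩)
          · exact ⟨y, hy, 0, ⟨0, zero_smul _ _⟩, add_zero _⟩
          · exact ⟨_, ha, _, ⟨a, rfl⟩, sub_add_cancel _ _⟩
      · simp [K', h]
    have hs₂K : s₂ ∈ K V := by
      refine hKmax K' ?_ ?_ (fun U' ↦ le_sup_left) V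
        ((hK' V s₂).mpr (Or.inr ⟨le_rfl, 1, by simp⟩))
      · intro U' V' h' y hy
        rw [hK'] at hy ⊢
        obtain hy | ⟨hU', a, ha⟩ := hy
        · exact Or.inl (hKres _ _ _ _ hy)
        · refine Or.inr ⟨h'.trans hU', rr X h' a, ?_⟩
          simpa using hKres _ _ h' _ ha
      · intro U' m hm
        obtain hm | ⟨hU', a, ha⟩ := (hK' _ _).mp hm
        · exact hK0 _ _ hm
        refine section_ext F fun y hy ↦ ?_
        obtain ⟨g, hgU', hyg⟩ := htop.exists_basicOpen_le ⟨y, hy⟩ (Opens.mem_top y)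
        refine ⟨X.basicOpen g, hgU', hyg, ?_⟩
        rw [map_zero]
        have hgV : X.basicOpen g ≤ V := hgU'.trans hU'
        have haD : ι.app _ (rs F hgU' m) - rr X hgU' a • rs Y hgV s₂ ∈ K (X.basicOpen g) := by
          simpa [app_rs] using hKres _ _ hgU' _ ha
        -- If `D(g)` avoids `x`, it lies in `W`, where `s₂ ∈ K`. Otherwise write `a = c / g ^ n`
        -- with `c` global. The relation puts `c` in `𝔞`, hence `c s` in `F + K` over all of `V`,
        -- hence `c s₂` in `K`; this forces `g ^ n m = 0` on `D(g)`.
        by_cases hxg : x ∈ X.basicOpen g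
        · obtain ⟨n, c, hc⟩ := IsAffineOpen.exists_rr_eq htop g (rr X hgU' a)
          have hu := (isUnit_rr g).pow n
          have h1 : ι.app _ (rr X (X.basicOpen_le g) g ^ n • rs F hgU' m) -
              rr X (X.basicOpen_le g) c • rs Y hgV s₂ ∈ K (X.basicOpen g) := by
            rw [hc, mul_smul, app_smul, ← smul_sub]
            exact (K _).smul_mem _ haD
          have hc𝔞 : c ∈ 𝔞 := by
            refine ⟨X.basicOpen g, hgV.trans (hhV₁.trans hV₁), hxg,
              rr X (X.basicOpen_le g) c • rs F hgV (e + f₁) +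
              rr X (X.basicOpen_le g) g ^ n • rs F hgU' m, ?_⟩
            convert! (K _).neg_mem h1 using 1
            simp only [hs₂, hs₁, map_add, map_sub, rs_rs, app_smul, app_rs, smul_sub, smul_add]
            abel
          obtain ⟨m', hm'⟩ := h𝔞 c hc𝔞
          have h2 := hs₂G (rr X (le_top : V ≤ ⊤) c) (m' - rr X (le_top : V ≤ ⊤) c • e) (by
            change rr X (le_top : V ≤ ⊤) c • s₁ - ι.app V (m' - rr X (le_top : V ≤ ⊤) c • e) ∈ K V
            convert! hm' using 1
            rw [hs₁, map_sub, smul_sub, app_smul]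
            abel)
          have h3 := hKres _ _ hgV _ h2
          rw [rs_smul, rr_rr] at h3
          have h4 := (K _).add_mem h1 h3
          rw [sub_add_cancel] at h4
          exact smul_eq_zero_of_isUnit hu (hK0 _ _ h4)
        · have hgW := hDW _ hgV hxg
          have h1 := hKres _ _ hgW _ hs₂W
          rw [rs_rs] at h1
          have h2 := (K _).add_mem haD ((K _).smul_mem (rr X hgU' a) h1)
          rw [sub_add_cancel] at h2
          exact hK0 _ _ h2
    refine hxZ.2 V hVU hxh ⟨e + f₁, ?_⟩
    convert! hs₂K using 1
    simp only [hs₂, hs₁, map_add]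
    abel
  choose ρ hρ using hHtop
  have hρ' (U : X.Opens) (s : Γ(Y, U)) (m : Γ(F, U)) (hm : s - ι.app U m ∈ K U) : ρ U s = m :=
    hHuniq U s _ _ (hρ U s) hm
  refine ⟨modHomMk (fun U ↦
    { toFun := ρ U
      map_zero' := hρ' U _ _ (by simp)
      map_add' s t := hρ' U _ _ (by
        convert! (K U).add_mem (hρ U s) (hρ U t) using 1
        rw [map_add]
        abel) }) (fun U a s ↦ hρ' U _ _ (by
          change a • s - ι.app U (a • ρ U s) ∈ K U
          rw [app_smul, ← smul_sub]
          exact (K U).smul_mem _ (hρ U s)))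
      (fun U V h s ↦ hρ' V _ _ (hHrs _ _ h _ _ (hρ U s))), modHom_ext fun U m ↦ ?_⟩
  exact hρ' U _ m (by
    change ι.app U m - ι.app U m ∈ K U
    rw [sub_self]
    exact (K U).zero_mem)

/-- A localizing sheaf with injective global sections on a Noetherian affine scheme is injective. -/
theorem injective_of_localizing [IsNoetherian X] [IsAffine X] (hF : Localizing F)
    [Module.Injective Γ(X, ⊤) Γ(F, ⊤)] : Injective F := by
  refine ⟨fun {A B} g f _ ↦ ?_⟩
  -- The pushout of the monomorphism `f` along `g` is a monomorphism out of `F`; a retraction of it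
  -- extends `g` along `f`.
  obtain ⟨ρ, hρ⟩ := exists_retraction (Limits.pushout.inl g f) hF
  refine ⟨Limits.pushout.inr g f ≫ ρ, ?_⟩
  rw [← Category.assoc, ← Limits.pushout.condition, Category.assoc, hρ, Category.comp_id]

end CartierModules

/-! ### Quasi-coherent modules are localizing. -/

namespace CartierModules

open TopologicalSpace Opposite

section Restrict

variable {X Y : Scheme.{u}}

/-- Sections of a restriction along an open immersion are sections over the image. -/
noncomputable def unres (M : X.Modules) (j : Y ⟶ X) [IsOpenImmersion j] (W : Y.Opens) :
    Γ(M.restrict j, W) ≃+ Γ(M, j ''ᵁ W) :=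
  (M.restrictAppIso j W).addCommGroupIsoToAddEquiv

variable (M : X.Modules) (j : Y ⟶ X) [IsOpenImmersion j]

lemma unres_rs {W W' : Y.Opens} (h : W' ≤ W) (s : Γ(M.restrict j, W)) :
    unres M j W' (rs _ h s) = rs M (j.image_mono h) (unres M j W s) := rfl

lemma unres_smul {W : Y.Opens} (a : Γ(Y, W)) (s : Γ(M.restrict j, W)) :
    unres M j W (a • s) = (j.appIso W).inv.hom a • unres M j W s := rfl

lemma appIso_inv_rr {U : X.Opens} {W : Y.Opens} (h : j ''ᵁ W ≤ U) (h' : W ≤ j ⁻¹ᵁ U) (a : Γ(X, U)) :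
    (j.appIso W).inv.hom (rr Y h' ((j.app U).hom a)) = rr X h a := by
  exact congr($(j.appLE_appIso_inv h').hom a)

variable {V : X.Opens} (hV : IsAffineOpen V)

lemma IsAffineOpen.image_le (W : (Spec Γ(X, V)).Opens) : hV.fromSpec ''ᵁ W ≤ V :=
  (hV.fromSpec.image_le_opensRange W).trans hV.opensRange_fromSpec.le

lemma IsAffineOpen.le_image_top : V ≤ hV.fromSpec ''ᵁ ⊤ := by
  rw [hV.fromSpec.image_top_eq_opensRange, hV.opensRange_fromSpec]

lemma IsAffineOpen.image_basicOpen (f : Γ(X, V)) :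
    hV.fromSpec ''ᵁ PrimeSpectrum.basicOpen f = X.basicOpen f :=
  hV.fromSpec_image_basicOpen f

lemma IsAffineOpen.unres_smul' {W : (Spec Γ(X, V)).Opens} (a : Γ(X, V))
    (s : Γ(M.restrict hV.fromSpec, W)) :
    unres M hV.fromSpec W (a • s) =
      rr X (IsAffineOpen.image_le hV W) a • unres M hV.fromSpec W s := by
  rw [Scheme.Modules.smul_Spec_def, unres_smul,
    ← appIso_inv_rr hV.fromSpec _ (by rw [hV.fromSpec_preimage_self]; exact le_top) a,
    hV.fromSpec_app_self]
  congr 2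

end Restrict

section Localizing

variable {X : Scheme.{u}} {M : X.Modules}

/-- Every open, including each overlap of affine opens, is a finite union of affine opens, so
finitely many exponents are replaced by a bound. Annihilation comes first: it is what makes local
lifts agree on overlaps after multiplication by a power of `f`. -/
lemma localizing_of_affine [IsNoetherian X]
    (h₁ : ∀ (V : X.Opens), IsAffineOpen V → ∀ (f : Γ(X, V)) (s : Γ(M, X.basicOpen f)),
      ∃ (n : ℕ) (t : Γ(M, V)), rs M (X.basicOpen_le f) t = rr X (X.basicOpen_le f) f ^ n • s)
    (h₂ : ∀ (V : X.Opens), IsAffineOpen V → ∀ (f : Γ(X, V)) (t : Γ(M, V)),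
      rs M (X.basicOpen_le f) t = 0 → ∃ n : ℕ, f ^ n • t = 0) : Localizing M := by
  have key (U : X.Opens) (f : Γ(X, U)) (t : Γ(M, U)) (ht : rs M (X.basicOpen_le f) t = 0) :
      ∃ n : ℕ, f ^ n • t = 0 := by
    obtain ⟨S, hS, hS', hc⟩ := exists_finite_affine_cover U
    have h3 (V : X.Opens) (hV : V ∈ S) : ∃ n : ℕ, rr X (hS' V hV).2 f ^ n • rs M (hS' V hV).2 t = 0 := by
      refine h₂ V (hS' V hV).1 _ _ ?_
      have h4 : X.basicOpen (rr X (hS' V hV).2 f) ≤ X.basicOpen f := by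
        rw [basicOpen_rr]
        exact inf_le_right
      rw [rs_rs, ← rs_rs M (X.basicOpen_le f) h4, ht, map_zero]
    choose! n hn using h3
    obtain ⟨N, hN⟩ : ∃ N, ∀ V ∈ S, n V ≤ N := by
      obtain ⟨N, hN⟩ := (hS.image n).bddAbove
      exact ⟨N, fun V hV ↦ hN ⟨V, hV, rfl⟩⟩
    refine ⟨N, section_ext M fun x hx ↦ ?_⟩
    obtain ⟨V, hV, hxV⟩ := hc x hx
    refine ⟨V, (hS' V hV).2, hxV, ?_⟩
    rw [map_zero, rs_smul, map_pow, ← Nat.sub_add_cancel (hN V hV), pow_add, mul_smul, hn V hV,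
      smul_zero]
  refine ⟨fun {U} f s ↦ ?_, fun {U} f t ht ↦ key U f t ht⟩
  obtain ⟨S, hS, hS', hc⟩ := exists_finite_affine_cover U
  have hle (V : X.Opens) (hV : V ≤ U) : X.basicOpen (rr X hV f) ≤ X.basicOpen f := by
    rw [basicOpen_rr]
    exact inf_le_right
  have h3 (V : S) : ∃ (n : ℕ) (t : Γ(M, V.1)), rs M (X.basicOpen_le (rr X (hS' V.1 V.2).2 f)) t =
      rr X (X.basicOpen_le (rr X (hS' V.1 V.2).2 f)) (rr X (hS' V.1 V.2).2 f) ^ n • rs M (hle V.1 (hS' V.1 V.2).2) s :=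
    h₁ V.1 (hS' V.1 V.2).1 _ _
  choose n t ht using h3
  have := hS.to_subtype
  obtain ⟨N, hN⟩ : ∃ N, ∀ V : S, n V ≤ N := by
    obtain ⟨N, hN⟩ := (Set.finite_range n).bddAbove
    exact ⟨N, fun V ↦ hN ⟨V, rfl⟩⟩
  let t' (V : S) : Γ(M, V.1) := rr X (hS' V.1 V.2).2 f ^ (N - n V) • t V
  have ht' (V : S) : rs M (X.basicOpen_le (rr X (hS' V.1 V.2).2 f)) (t' V) =
      rr X ((X.basicOpen_le (rr X (hS' V.1 V.2).2 f)).trans (hS' V.1 V.2).2) f ^ N • rs M (hle V.1 (hS' V.1 V.2).2) s := by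
    simp only [t']
    rw [rs_smul, ht, map_pow, ← mul_smul, ← pow_add, Nat.sub_add_cancel (hN V), rr_rr]
  have h5 (V V' : S) : ∃ m : ℕ, rr X (inf_le_left.trans (hS' V.1 V.2).2 : V.1 ⊓ V'.1 ≤ U) f ^ m •
      (rs M inf_le_left (t' V) - rs M inf_le_right (t' V') : Γ(M, V.1 ⊓ V'.1)) = 0 := by
    refine key _ _ _ ?_
    have h6 : X.basicOpen (rr X (inf_le_left.trans (hS' V.1 V.2).2 : V.1 ⊓ V'.1 ≤ U) f) ≤
        X.basicOpen (rr X (hS' V.1 V.2).2 f) := by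
      rw [basicOpen_rr, basicOpen_rr]
      exact inf_le_inf_right _ inf_le_left
    have h7 : X.basicOpen (rr X (inf_le_left.trans (hS' V.1 V.2).2 : V.1 ⊓ V'.1 ≤ U) f) ≤
        X.basicOpen (rr X (hS' V'.1 V'.2).2 f) := by
      rw [basicOpen_rr, basicOpen_rr]
      exact inf_le_inf_right _ inf_le_right
    rw [map_sub, rs_rs, rs_rs, ← rs_rs M (X.basicOpen_le _) h6, ← rs_rs M (X.basicOpen_le _) h7,
      ht', ht', rs_smul, rs_smul, rs_rs, rs_rs, map_pow, map_pow, rr_rr, rr_rr, sub_self]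
  choose m hm using h5
  obtain ⟨K, hK⟩ : ∃ K, ∀ V V' : S, m V V' ≤ K := by
    obtain ⟨N, hN⟩ := (Set.finite_range fun x : S × S ↦ m x.1 x.2).bddAbove
    exact ⟨N, fun V V' ↦ hN ⟨(V, V'), rfl⟩⟩
  obtain ⟨T, hT⟩ := exists_glue M U
    (fun W z ↦ ∃ (V : S) (h : W ≤ V.1), z = rr X (h.trans (hS' V.1 V.2).2) f ^ K • rs M h (t' V))
    (by
      rintro W W' h _ ⟨V, hWV, rfl⟩
      refine ⟨V, h.trans hWV, ?_⟩
      rw [rs_smul, map_pow, rr_rr, rs_rs])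
    (by
      rintro W _ _ ⟨V, hWV, rfl⟩ ⟨V', hWV', rfl⟩
      have h8 := congrArg (rs M (le_inf hWV hWV')) (hm V V')
      rw [rs_smul, map_pow, rr_rr, map_sub, rs_rs, rs_rs, map_zero] at h8
      rw [← sub_eq_zero, ← smul_sub, ← Nat.sub_add_cancel (hK V V'), pow_add, mul_smul, h8,
        smul_zero])
    (fun x hx ↦ by
      obtain ⟨V, hV, hxV⟩ := hc x hx
      exact ⟨V, (hS' V hV).2, hxV, _, ⟨V, hV⟩, le_rfl, rfl⟩)
  refine ⟨K + N, T, section_ext M fun x hx ↦ ?_⟩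
  obtain ⟨W, hWU, hxW, V, hWV, hW⟩ := hT x (X.basicOpen_le f hx)
  refine ⟨W ⊓ X.basicOpen f, inf_le_right, ⟨hxW, hx⟩, ?_⟩
  have h9 : W ⊓ X.basicOpen f ≤ X.basicOpen (rr X (hS' V.1 V.2).2 f) := by
    rw [basicOpen_rr]
    exact inf_le_inf_right _ hWV
  rw [rs_rs, ← rs_rs M hWU inf_le_left, hW, rs_smul, rs_rs, ← rs_rs M (X.basicOpen_le _) h9, ht',
    rs_smul, rs_smul, rs_rs, map_pow, map_pow, map_pow, rr_rr, rr_rr, rr_rr, ← mul_smul, pow_add]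

/-- Quasi-coherent modules on a Noetherian scheme are localizing. -/
theorem localizing_of_isQuasicoherent [IsNoetherian X] [M.IsQuasicoherent] : Localizing M := by
  have hloc (V : X.Opens) (hV : IsAffineOpen V) (f : Γ(X, V)) :=
    (isIso_fromTildeΓ_iff_isLocalizing (M.restrict hV.fromSpec)).mp inferInstance f
  refine localizing_of_affine (fun V hV f s ↦ ?_) fun V hV f t ht ↦ ?_
  · have := hloc V hV f
    obtain ⟨⟨t, ⟨_, n, rfl⟩⟩, h⟩ := IsLocalizedModule.surj (Submonoid.powers f)
      ((modulesSpecToSheaf.obj (M.restrict hV.fromSpec)).obj.map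
        (PrimeSpectrum.basicOpen f).leTop.op).hom
      ((unres M hV.fromSpec (PrimeSpectrum.basicOpen f)).symm
        (rs M (IsAffineOpen.image_basicOpen hV f).le s))
    have h' := congrArg (unres M hV.fromSpec (PrimeSpectrum.basicOpen f)) h
    refine ⟨n, rs M (IsAffineOpen.le_image_top hV) (unres M hV.fromSpec ⊤ t), ?_⟩
    have h1 := (IsAffineOpen.unres_smul' M hV (f ^ n) _).symm.trans h'
    have h2 := congrArg (rs M (IsAffineOpen.image_basicOpen hV f).ge)
      (h1.trans (unres_rs M hV.fromSpec le_top t))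
    rw [rs_smul, rr_rr, rs_rs, map_pow, AddEquiv.apply_symm_apply, rs_rs, rs_self] at h2
    rw [rs_rs, h2]
  · have := hloc V hV f
    have h1 := (IsLocalizedModule.eq_zero_iff (Submonoid.powers f)
      ((modulesSpecToSheaf.obj (M.restrict hV.fromSpec)).obj.map
        (PrimeSpectrum.basicOpen f).leTop.op).hom
      (m := (unres M hV.fromSpec ⊤).symm (rs M (IsAffineOpen.image_le hV _) t))).mp (by
        apply (unres M hV.fromSpec (PrimeSpectrum.basicOpen f)).injective
        refine (unres_rs M hV.fromSpec le_top _).trans ?_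
        rw [AddEquiv.apply_symm_apply, rs_rs,
          ← rs_rs M (X.basicOpen_le f) (IsAffineOpen.image_basicOpen hV f).le, ht, map_zero]
        rfl)
    obtain ⟨⟨_, n, rfl⟩, h⟩ := h1
    have h2 := (IsAffineOpen.unres_smul' M hV (f ^ n) _).symm.trans
      (congrArg (unres M hV.fromSpec ⊤) h)
    have h3 := congrArg (rs M (IsAffineOpen.le_image_top hV)) h2
    rw [rs_smul, rr_rr, AddEquiv.apply_symm_apply, rs_rs, rs_self, rr_self] at h3
    refine ⟨n, h3.trans ?_⟩
    exact map_zero (rs M _)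

end Localizing

end CartierModules

/-! ### Injectivity of `tilde E`, and transport between spectra and slices. -/

namespace CartierModules

open TopologicalSpace Opposite

section Tilde

variable {R : CommRingCat.{u}} (E : ModuleCat.{u} R)

lemma toOpen_smul (U : (Spec R).Opens) (a : R) (e : E) :
    (show Γ(tilde E, U) from (tilde.toOpen E U).hom (a • e)) =
      (show Γ(tilde E, U) from (a • (show Γ(tilde E, U) from (tilde.toOpen E U).hom e))) :=
  (tilde.toOpen E U).hom.map_smul a e

/-- `injective_of_localizing` asks for injectivity over `Γ(Spec R, ⊤)`, so the `R`-module `E` is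
transported along the isomorphism of this ring with `R`. -/
theorem injective_tilde [IsNoetherianRing R] [Module.Injective R E] : Injective (tilde E) := by
  have hloc : Localizing (tilde E) := localizing_of_isQuasicoherent
  let e := (Scheme.ΓSpecIso R).symm.commRingCatIsoToRingEquiv
  let := RingHomInvPair.of_ringEquiv e
  let := RingHomInvPair.of_ringEquiv e.symm
  let f : E ≃ₛₗ[(e : R →+* Γ(Spec R, ⊤))] Γ(tilde E, ⊤) :=
    { (tilde.isoTop E).toLinearEquiv.toAddEquiv with
      map_smul' a x := by
        refine (toOpen_smul E ⊤ a x).trans ?_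
        rw [Scheme.Modules.smul_Spec_def]
        change rr (Spec R) le_top _ • _ = _
        rw [rr_self]
        rfl }
  have : Module.Injective Γ(Spec R, ⊤) Γ(tilde E, ⊤) := Module.Injective.of_ringEquiv e f
  exact injective_of_localizing hloc

end Tilde

section Over

variable {X : Scheme.{u}} (M : X.Modules) {V : X.Opens} (hV : IsAffineOpen V)

instance (W : X.Opens) : (Scheme.Modules.overEquiv W).functor.IsLeftAdjoint := inferInstance

/-- Transport of sheaves of modules from the spectrum of the sections over an affine open. -/
noncomputable def specToOver :
    SheafOfModules.{u} (Spec Γ(X, V)).ringCatSheaf ⥤ SheafOfModules.{u} (X.ringCatSheaf.over V) :=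
  Scheme.Modules.restrictFunctor hV.isoSpec.hom ⋙ (Scheme.Modules.overEquiv V).inverse

instance : (specToOver hV).IsLeftAdjoint :=
  inferInstanceAs (Scheme.Modules.restrictFunctor hV.isoSpec.hom ⋙
    (Scheme.Modules.overEquiv V).inverse).IsLeftAdjoint

/-- A presentation can be carried along a functor that preserves colimits and the structure sheaf;
this isomorphism supplies the second condition. -/
noncomputable def specToOverUnit :
    SheafOfModules.unit.{u} _ ≅ (specToOver hV).obj (SheafOfModules.unit.{u} _) :=
  (Opens.sheafOfModulesEquivOverInverseUnit V X.ringCatSheaf).symm ≪≫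
    (Scheme.Modules.overEquiv V).inverse.mapIso
      (Scheme.Modules.restrictUnitIso hV.isoSpec.hom).symm

noncomputable def specToOverRestrict : (specToOver hV).obj (M.restrict hV.fromSpec) ≅ M.over V :=
  (Scheme.Modules.overEquiv V).inverse.mapIso
    ((Scheme.Modules.restrictFunctorComp hV.isoSpec.hom hV.fromSpec).symm.app M ≪≫
    (Scheme.Modules.restrictFunctorCongr hV.isoSpec_hom_fromSpec).app M ≪≫
    (Scheme.Modules.overFunctorEquiv V).symm.app M) ≪≫
    ((Scheme.Modules.overEquiv V).unitIso.app (M.over V)).symm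

noncomputable def presentationOver (P : (M.restrict hV.fromSpec).Presentation) :
    (M.over V).Presentation :=
  have : Limits.PreservesColimitsOfSize.{u, u} (specToOver hV) := inferInstance
  (P.map (specToOver hV) (specToOverUnit hV)).ofIsIso (specToOverRestrict M hV).hom

/-- The passage to the spectrum includes shrinking from `W`, since a module of finite type is given
by generators over opens that need not be affine. -/
noncomputable def overToSpec {W : X.Opens} (h : V ≤ W) :
    SheafOfModules.{u} (X.ringCatSheaf.over W) ⥤ SheafOfModules.{u} (Spec Γ(X, V)).ringCatSheaf :=
  (Scheme.Modules.overEquiv W).functor ⋙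
    Scheme.Modules.restrictFunctor (hV.isoSpec.inv ≫ X.homOfLE h)

instance {W : X.Opens} (h : V ≤ W) : (overToSpec hV h).IsLeftAdjoint :=
  inferInstanceAs ((Scheme.Modules.overEquiv W).functor ⋙
    Scheme.Modules.restrictFunctor (hV.isoSpec.inv ≫ X.homOfLE h)).IsLeftAdjoint

noncomputable def overToSpecUnit {W : X.Opens} (h : V ≤ W) :
    SheafOfModules.unit.{u} _ ≅ (overToSpec hV h).obj (SheafOfModules.unit.{u} _) :=
  (Scheme.Modules.restrictUnitIso (hV.isoSpec.inv ≫ X.homOfLE h)).symm ≪≫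
  (Scheme.Modules.restrictFunctor (hV.isoSpec.inv ≫ X.homOfLE h)).mapIso
    (Opens.sheafOfModulesEquivOverUnit W X.ringCatSheaf).symm

noncomputable def overToSpecOver {W : X.Opens} (h : V ≤ W) :
    (overToSpec hV h).obj (M.over W) ≅ M.restrict hV.fromSpec :=
  (Scheme.Modules.restrictFunctor (hV.isoSpec.inv ≫ X.homOfLE h)).mapIso
    ((Scheme.Modules.overFunctorEquiv W).app M) ≪≫
    (Scheme.Modules.restrictFunctorComp (hV.isoSpec.inv ≫ X.homOfLE h) W.ι).symm.app M ≪≫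
    (Scheme.Modules.restrictFunctorCongr (by simp [hV.isoSpec_inv_ι])).app M


/-- The restriction to an affine open of a sheaf of modules generated by sections over a larger
open. -/
noncomputable def generatingSectionsRestrict {W : X.Opens} (h : V ≤ W)
    (G : (M.over W).GeneratingSections) : (M.restrict hV.fromSpec).GeneratingSections :=
  have : Limits.PreservesColimitsOfSize.{u, u} (overToSpec hV h) := inferInstance
  have : Epi (C := SheafOfModules.{u} (Spec Γ(X, V)).ringCatSheaf) (overToSpecOver M hV h).hom :=
    @IsIso.epi_of_iso _ _ _ _ _ (Iso.isIso_hom _)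
  (G.map (overToSpec hV h) (overToSpecUnit hV h)).ofEpi (overToSpecOver M hV h).hom

end Over

/-! ### Coherence in terms of sections over affine opens. -/

section Coherent

variable {X : Scheme.{u}} {M : X.Modules}

lemma isLocalizing_restrict (hM : Localizing M) {V : X.Opens} (hV : IsAffineOpen V) :
    IsLocalizing (modulesSpecToSheaf.obj (M.restrict hV.fromSpec)) := by
  intro f
  have hun (s : Γ(M.restrict hV.fromSpec, PrimeSpectrum.basicOpen f)) :
      rs M (IsAffineOpen.image_basicOpen hV f).le (rs M (IsAffineOpen.image_basicOpen hV f).ge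
        (unres M hV.fromSpec _ s)) = unres M hV.fromSpec _ s := by
    rw [rs_rs, rs_self]
  constructor
  · rintro ⟨_, n, rfl⟩
    rw [map_pow]
    exact ((M.restrict hV.fromSpec).isUnit_algebraMap_end_of_le_basicOpen f le_rfl).pow n
  · intro s
    obtain ⟨n, t, ht⟩ := hM.exists_lift f (rs M (IsAffineOpen.image_basicOpen hV f).ge
      (unres M hV.fromSpec _ s))
    refine ⟨⟨(unres M hV.fromSpec ⊤).symm (rs M (IsAffineOpen.image_le hV _) t),
      ⟨_, n, rfl⟩⟩, ?_⟩
    apply (unres M hV.fromSpec (PrimeSpectrum.basicOpen f)).injective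
    refine (IsAffineOpen.unres_smul' M hV (f ^ n) s).trans ?_
    refine Eq.trans ?_ (unres_rs M hV.fromSpec le_top _).symm
    have h1 := congrArg (rs M (IsAffineOpen.image_basicOpen hV f).le) ht
    rw [rs_rs, rs_smul, map_pow, rr_rr] at h1
    have h2 := h1.trans (congrArg _ (hun s))
    rw [← map_pow] at h2
    refine h2.symm.trans ?_
    refine (rs_rs M (IsAffineOpen.image_le hV ⊤) (hV.fromSpec.image_mono le_top) t).symm.trans ?_
    exact congrArg (rs M _) (AddEquiv.apply_symm_apply (unres M hV.fromSpec ⊤) _).symm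
  · intro s t hst
    have h1 := congrArg (unres M hV.fromSpec (PrimeSpectrum.basicOpen f)) hst
    have h2 := ((unres_rs M hV.fromSpec le_top s).symm.trans h1).trans
      (unres_rs M hV.fromSpec le_top t)
    obtain ⟨n, hn⟩ := hM.exists_pow_smul_eq_zero f (rs M (IsAffineOpen.le_image_top hV)
      (unres M hV.fromSpec ⊤ s) - rs M (IsAffineOpen.le_image_top hV) (unres M hV.fromSpec ⊤ t)) (by
        have h3 := congrArg (rs M (IsAffineOpen.image_basicOpen hV f).ge) h2
        rw [rs_rs, rs_rs] at h3
        rw [map_sub, rs_rs, rs_rs, h3, sub_self])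
    refine ⟨⟨_, n, rfl⟩, ?_⟩
    apply (unres M hV.fromSpec ⊤).injective
    refine (IsAffineOpen.unres_smul' M hV (f ^ n) s).trans
      (Eq.trans ?_ (IsAffineOpen.unres_smul' M hV (f ^ n) t).symm)
    have h4 := congrArg (rs M (IsAffineOpen.image_le hV ⊤)) hn
    rw [smul_sub, map_sub, rs_smul, rs_smul, rs_rs, rs_rs, rs_self, rs_self, map_zero,
      sub_eq_zero] at h4
    exact h4

/-- The sections over an affine open, as global sections on the spectrum. -/
noncomputable def sectionsEquiv (M : X.Modules) {V : X.Opens} (hV : IsAffineOpen V) :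
    Γ(M, V) ≃ₗ[Γ(X, V)]
      ((modulesSpecToSheaf.obj (M.restrict hV.fromSpec)).presheaf.obj (op ⊤)) where
  toFun s := (unres M hV.fromSpec ⊤).symm (rs M (IsAffineOpen.image_le hV _) s)
  invFun s := rs M (IsAffineOpen.le_image_top hV) (unres M hV.fromSpec ⊤ s)
  left_inv s := by
    beta_reduce
    rw [AddEquiv.apply_symm_apply, rs_rs, rs_self]
  right_inv s := by
    apply (unres M hV.fromSpec ⊤).injective
    rw [AddEquiv.apply_symm_apply, rs_rs, rs_self]
  map_add' s t := by
    rw [map_add, map_add]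
    rfl
  map_smul' a s := by
    apply (unres M hV.fromSpec ⊤).injective
    refine Eq.trans ?_ (IsAffineOpen.unres_smul' M hV a _).symm
    rw [AddEquiv.apply_symm_apply, rs_smul, AddEquiv.apply_symm_apply]

/-- A localizing sheaf of modules has local presentations, finite ones if its sections over affine
opens are finite. -/
lemma exists_quasicoherentData (hM : Localizing M) {ι : Type u} (V : ι → X.Opens)
    (hV : ∀ i, IsAffineOpen (V i)) (hcov : ∀ x : X, ∃ i, x ∈ V i) :
    ∃ q : SheafOfModules.QuasicoherentData.{u} (R := X.ringCatSheaf) M, (∀ i, Module.Finite Γ(X, V i) Γ(M, V i)) →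
      q.localGeneratorsData.IsFiniteType := by
  have hpres (i : ι) : ∃ P : (M.over (V i)).Presentation, Module.Finite Γ(X, V i) Γ(M, V i) →
      P.generators.IsFiniteType := by
    have : IsIso (C := SheafOfModules.{u} (Spec Γ(X, V i)).ringCatSheaf)
        (Scheme.Modules.fromTildeΓ (M.restrict (hV i).fromSpec)) :=
      (isIso_fromTildeΓ_iff_isLocalizing _).mpr (isLocalizing_restrict hM (hV i))
    obtain ⟨S, hS, hS'⟩ : ∃ S : Set ((modulesSpecToSheaf.obj
        (M.restrict (hV i).fromSpec)).presheaf.obj (op ⊤)), Submodule.span Γ(X, V i) S = ⊤ ∧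
        (Module.Finite Γ(X, V i) Γ(M, V i) → S.Finite) := by
      -- One presentation has to serve both cases: finitely many generators when they exist, all
      -- sections otherwise.
      by_cases hfin : Module.Finite Γ(X, V i) Γ(M, V i)
      · have := Module.Finite.equiv (sectionsEquiv M (hV i))
        obtain ⟨S, hS⟩ := this.fg_top
        exact ⟨S, hS, fun _ ↦ S.finite_toSet⟩
      · exact ⟨Set.univ, by simp, fun h ↦ (hfin h).elim⟩
    let P := presentationTilde.{u} _ S hS _ (Submodule.span_eq _)
    let P' : (M.restrict (hV i).fromSpec).Presentation :=
      P.ofIsIso (Scheme.Modules.fromTildeΓ (M.restrict (hV i).fromSpec))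
    refine ⟨presentationOver M (hV i) P', fun hfin ↦ ⟨?_⟩⟩
    have := (hS' hfin).to_subtype
    exact inferInstanceAs (Finite S)
  choose P hP using hpres
  refine ⟨{ I := ι, X := V, coversTop := ?_, presentation := P }, fun hfin ↦
    SheafOfModules.LocalGeneratorsData.IsFiniteType.mk.{u, u, u, u} fun i ↦ hP i (hfin i)⟩
  rw [Opens.coversTop_iff, IsOpenCover, eq_top_iff]
  intro x _
  exact Opens.mem_iSup.mpr (hcov x)

theorem isQuasicoherent_of_localizing (hM : Localizing M) : M.IsQuasicoherent := by
  obtain ⟨q, -⟩ := exists_quasicoherentData hM (fun V : X.affineOpens ↦ V.1) (fun V ↦ V.2)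
    (fun x ↦ by
      obtain ⟨_, ⟨V, hV, rfl⟩, hx, -⟩ := X.isBasis_affineOpens.exists_subset_of_mem_open (Set.mem_univ x)
        isOpen_univ
      exact ⟨⟨V, hV⟩, hx⟩)
  exact q.isQuasicoherent

theorem isCoherentModule_of_localizing (hM : Localizing M) {ι : Type u} (V : ι → X.Opens)
    (hV : ∀ i, IsAffineOpen (V i)) (hcov : ∀ x : X, ∃ i, x ∈ V i)
    (hfin : ∀ i, Module.Finite Γ(X, V i) Γ(M, V i)) : IsCoherentModule M := by
  obtain ⟨q, hq⟩ := exists_quasicoherentData hM V hV hcov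
  exact ⟨q.isQuasicoherent, SheafOfModules.IsFiniteType.mk.{u, u, u} ⟨_, hq hfin⟩⟩

/-- Source and target are both of the form `tilde`, which is full and faithful. So `π` comes from a
linear map out of a finite free module, and this map is an epimorphism, that is, surjective. -/
lemma finite_of_epi_free {R : CommRingCat.{u}} (N : (Spec R).Modules) (hN : IsIso N.fromTildeΓ)
    {ι : Type u} [Finite ι] (π : SheafOfModules.free.{u} (R := (Spec R).ringCatSheaf) ι ⟶ N)
    (hπ : Epi π) : Module.Finite R ((modulesSpecToSheaf.obj N).presheaf.obj (op ⊤)) := by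
  let π' : (show (Spec R).Modules from SheafOfModules.free.{u} (R := (Spec R).ringCatSheaf) ι) ⟶ N :=
    π
  have : Epi π' := hπ
  let φ : tilde (ModuleCat.of R (ι →₀ R)) ⟶
      tilde ((modulesSpecToSheaf.obj N).presheaf.obj (op ⊤)) :=
    (tildeFinsupp ι).hom ≫ π' ≫ inv N.fromTildeΓ
  let g := (tilde.functor R).preimage φ
  have hg : (tilde.functor R).map g = φ := (tilde.functor R).map_preimage φ
  have : Epi ((tilde.functor R).map g) := by
    rw [hg]
    exact epi_comp' (@IsIso.epi_of_iso _ _ _ _ _ (Iso.isIso_hom _))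
      (epi_comp' this (@IsIso.epi_of_iso _ _ _ _ _ (@IsIso.inv_isIso _ _ _ _ _ hN)))
  have : Epi g := (tilde.functor R).epi_of_epi_map this
  exact Module.Finite.of_surjective g.hom ((ModuleCat.epi_iff_surjective g).mp this)

/-- Local generators give finiteness over a basic open around each point of `V`. The functions
involved generate the unit ideal, and finiteness descends from such a family of localizations. -/
theorem IsCoherentModule.finite [IsNoetherian X] (hM : IsCoherentModule M) {V : X.Opens}
    (hV : IsAffineOpen V) : Module.Finite Γ(X, V) Γ(M, V) := by
  have := hM.1
  have hloc : Localizing M := localizing_of_isQuasicoherent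
  obtain ⟨σ, hσ⟩ := hM.2
  have hcov : ⨆ i, σ.X i = (⊤ : X.Opens) := (Opens.coversTop_iff _ _).mp σ.coversTop
  have key (x : V) : ∃ h : Γ(X, V), x.1 ∈ X.basicOpen h ∧
      Module.Finite Γ(X, X.basicOpen h) Γ(M, X.basicOpen h) := by
    obtain ⟨i, hi⟩ := Opens.mem_iSup.mp (hcov.ge (Opens.mem_top x.1))
    obtain ⟨h, hh, hx⟩ := hV.exists_basicOpen_le ⟨x.1, hi⟩ x.2
    refine ⟨h, hx, ?_⟩
    have hD := hV.basicOpen h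
    have := (hσ.isFiniteType i).finite
    let G := generatingSectionsRestrict M hD hh (σ.generators i)
    have : Finite G.I := this
    have : IsIso (Scheme.Modules.fromTildeΓ (M.restrict hD.fromSpec)) :=
      (isIso_fromTildeΓ_iff_isLocalizing _).mpr (isLocalizing_restrict hloc hD)
    have := finite_of_epi_free (M.restrict hD.fromSpec) this G.π G.epi
    exact Module.Finite.equiv (sectionsEquiv M hD).symm
  choose h hx hfin using key
  have hspan : Ideal.span (Set.range h) = ⊤ := by
    rw [← hV.iSup_basicOpen_eq_self_iff]
    refine le_antisymm (iSup_le fun f ↦ X.basicOpen_le _) fun x hxV ↦ ?_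
    exact Opens.mem_iSup.mpr ⟨⟨_, ⟨x, hxV⟩, rfl⟩, hx ⟨x, hxV⟩⟩
  let Rp (g : Set.range h) : Type u := Γ(X, X.basicOpen g.1)
  let Mp (g : Set.range h) : Type u := Γ(M, X.basicOpen g.1)
  let (g : Set.range h) : CommRing (Rp g) := inferInstanceAs (CommRing Γ(X, X.basicOpen g.1))
  let (g : Set.range h) : AddCommGroup (Mp g) :=
    inferInstanceAs (AddCommGroup Γ(M, X.basicOpen g.1))
  let (g : Set.range h) : Module (Rp g) (Mp g) :=
    inferInstanceAs (Module Γ(X, X.basicOpen g.1) Γ(M, X.basicOpen g.1))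
  let (g : Set.range h) : Algebra Γ(X, V) (Rp g) := (rr X (X.basicOpen_le g.1)).toAlgebra
  have (g : Set.range h) : IsLocalization.Away g.1 (Rp g) := hV.isLocalization_basicOpen g.1
  let (g : Set.range h) : Module Γ(X, V) (Mp g) := Module.compHom _ (rr X (X.basicOpen_le g.1))
  have (g : Set.range h) : IsScalarTower Γ(X, V) (Rp g) (Mp g) :=
    ⟨fun a b m ↦ mul_smul (rr X (X.basicOpen_le g.1) a) (show Γ(X, X.basicOpen g.1) from b)
      (show Γ(M, X.basicOpen g.1) from m)⟩
  let f (g : Set.range h) : Γ(M, V) →ₗ[Γ(X, V)] Mp g :=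
    { rs M (X.basicOpen_le g.1) with
      map_smul' := fun a m ↦ rs_smul M (X.basicOpen_le g.1) a m }
  have (g : Set.range h) : IsLocalizedModule.Away g.1 (f g) := by
    constructor
    · rintro ⟨_, n, rfl⟩
      rw [Module.End.isUnit_iff]
      have hu := (isUnit_rr g.1).pow n
      rw [← map_pow] at hu
      constructor
      · intro m m' hmm
        exact smul_cancel_of_isUnit (M := Γ(M, X.basicOpen g.1)) hu hmm
      · intro m
        obtain ⟨v, hv⟩ := hu.exists_right_inv
        refine ⟨(v • (show Γ(M, X.basicOpen g.1) from m) : Γ(M, X.basicOpen g.1)), ?_⟩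
        change rr X (X.basicOpen_le g.1) (g.1 ^ n) •
          (v • (show Γ(M, X.basicOpen g.1) from m) : Γ(M, X.basicOpen g.1)) = m
        rw [← mul_smul, hv, one_smul]
    · intro s
      obtain ⟨n, t, ht⟩ := hloc.exists_lift g.1 s
      rw [← map_pow] at ht
      exact ⟨⟨t, ⟨_, n, rfl⟩⟩, ht.symm⟩
    · intro s t hst
      obtain ⟨n, hn⟩ := hloc.exists_pow_smul_eq_zero g.1 (s - t) (by
        rw [map_sub, sub_eq_zero]
        exact hst)
      refine ⟨⟨_, n, rfl⟩, ?_⟩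
      rw [smul_sub, sub_eq_zero] at hn
      exact hn
  refine Module.Finite.of_localizationSpan' (Rₚ := Rp) (Set.range h) hspan f ?_
  rintro ⟨_, x, rfl⟩
  exact hfin x

end Coherent

end CartierModules

/-! ### Subsheaves defined by modules of sections up to denominators. -/

namespace CartierModules

open TopologicalSpace Opposite

section Denominators

variable {X : Scheme.{u}} {M : X.Modules}

/-- A prime containing `𝔠` but not `h` is a point of `D(h)`; the hypothesis there puts `h * g` in
the prime although neither factor is in it. So `h` is in the radical of `𝔠`. -/
lemma IsAffineOpen.exists_pow_mem {V : X.Opens} (hV : IsAffineOpen V) (𝔠 : Ideal Γ(X, V))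
    (h : Γ(X, V)) (H : ∀ x ∈ X.basicOpen h, ∃ g : Γ(X, V), x ∈ X.basicOpen g ∧
      ∃ n : ℕ, (h * g) ^ n ∈ 𝔠) : ∃ n : ℕ, h ^ n ∈ 𝔠 := by
  change h ∈ 𝔠.radical
  rw [Ideal.radical_eq_sInf, Submodule.mem_sInf]
  rintro 𝔭 ⟨h𝔠, h𝔭⟩
  by_contra hh
  have hmem (f : Γ(X, V)) : hV.fromSpec ⟨𝔭, h𝔭⟩ ∈ X.basicOpen f ↔ f ∉ 𝔭 := by
    change (⟨𝔭, h𝔭⟩ : PrimeSpectrum Γ(X, V)) ∈ hV.fromSpec ⁻¹ᵁ X.basicOpen f ↔ _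
    rw [hV.fromSpec_preimage_basicOpen]
    rfl
  obtain ⟨g, hg, n, hn⟩ := H _ ((hmem h).mpr hh)
  obtain h' | h' := h𝔭.mem_or_mem (h𝔭.mem_of_pow_mem n (h𝔠 hn))
  · exact hh h'
  · exact (hmem g).mp hg h'

/-- On `D(h)`, the section `t` is in the localization of the module `N` of sections over `V`. -/
def DenIn {V : X.Opens} (N : Submodule Γ(X, V) Γ(M, V)) {U : X.Opens} (t : Γ(M, U))
    (h : Γ(X, V)) : Prop :=
  ∃ (hU : X.basicOpen h ≤ U) (n : ℕ) (m : Γ(M, V)), m ∈ N ∧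
    rr X (X.basicOpen_le h) h ^ n • rs M hU t = rs M (X.basicOpen_le h) m

variable {V : X.Opens} {N : Submodule Γ(X, V) Γ(M, V)} {U : X.Opens} {t : Γ(M, U)} {h : Γ(X, V)}

lemma denIn_rs_iff {W : X.Opens} {hWU : W ≤ U} (hW : X.basicOpen h ≤ W) :
    DenIn N (rs M hWU t) h ↔ DenIn N t h := by
  constructor
  · rintro ⟨hU, n, m, hm, e⟩
    rw [rs_rs] at e
    exact ⟨hU.trans hWU, n, m, hm, e⟩
  · rintro ⟨hU, n, m, hm, e⟩
    refine ⟨hW, n, m, hm, ?_⟩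
    rw [rs_rs]
    exact e

lemma DenIn.exists_le (ht : DenIn N t h) :
    ∃ (hU : X.basicOpen h ≤ U) (n₀ : ℕ), ∀ n, n₀ ≤ n → ∃ m ∈ N,
      rr X (X.basicOpen_le h) h ^ n • rs M hU t = rs M (X.basicOpen_le h) m := by
  obtain ⟨hU, n, m, hm, e⟩ := ht
  refine ⟨hU, n, fun n' hn ↦ ⟨h ^ (n' - n) • m, N.smul_mem _ hm, ?_⟩⟩
  rw [rs_smul, map_pow, ← e, ← mul_smul, ← pow_add, Nat.sub_add_cancel hn]

lemma denIn_zero (hU : X.basicOpen h ≤ U) : DenIn N (0 : Γ(M, U)) h :=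
  ⟨hU, 0, 0, N.zero_mem, by rw [map_zero, map_zero, smul_zero]⟩

lemma DenIn.add {t' : Γ(M, U)} (ht : DenIn N t h) (ht' : DenIn N t' h) : DenIn N (t + t') h := by
  obtain ⟨hU, n, H⟩ := ht.exists_le
  obtain ⟨_, n', H'⟩ := ht'.exists_le
  obtain ⟨m, hm, e⟩ := H (max n n') (le_max_left _ _)
  obtain ⟨m', hm', e'⟩ := H' (max n n') (le_max_right _ _)
  exact ⟨hU, _, m + m', N.add_mem hm hm', by rw [map_add, map_add, smul_add, e, e']⟩

lemma DenIn.smul (hV : IsAffineOpen V) (a : Γ(X, U)) (ht : DenIn N t h) : DenIn N (a • t) h := by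
  obtain ⟨hU, n, m, hm, e⟩ := ht
  obtain ⟨k, c, hc⟩ := IsAffineOpen.exists_rr_eq hV h (rr X hU a)
  refine ⟨hU, k + n, c • m, N.smul_mem _ hm, ?_⟩
  rw [rs_smul, rs_smul, hc, ← e, ← mul_smul, ← mul_smul]
  congr 1
  ring

lemma DenIn.mul_left (g : Γ(X, V)) (ht : DenIn N t h) : DenIn N t (g * h) := by
  obtain ⟨hU, n, m, hm, e⟩ := ht
  have hle : X.basicOpen (g * h) ≤ X.basicOpen h := by
    rw [Scheme.basicOpen_mul]
    exact inf_le_right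
  refine ⟨hle.trans hU, n, g ^ n • m, N.smul_mem _ hm, ?_⟩
  have e' := congrArg (rs M hle) e
  rw [rs_smul, map_pow, rr_rr, rs_rs, rs_rs] at e'
  rw [rs_smul, ← e', ← mul_smul, map_pow, map_mul, mul_pow]

/-- If `h ^ n • t` is the restriction of `m ∈ N`, then `h ^ n • τ` and `c • m` agree on `D(h)`,
hence after multiplication by a power of `h`. This turns a statement about fractions into membership
in `N`. -/
lemma DenIn.exists_pow_smul_mem (hM : Localizing M) (ht : DenIn N t h) (c : Γ(X, V)) (τ : Γ(M, V))
    (hτ : ∀ hU : X.basicOpen h ≤ U,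
      rs M (X.basicOpen_le h) τ = rr X (X.basicOpen_le h) c • rs M hU t) :
    ∃ n : ℕ, h ^ n • τ ∈ N := by
  obtain ⟨hU, n, m, hm, e⟩ := ht
  obtain ⟨k, hk⟩ := hM.exists_pow_smul_eq_zero h (h ^ n • τ - c • m) (by
    rw [map_sub, rs_smul, rs_smul, ← e, hτ hU, ← mul_smul, ← mul_smul, map_pow, mul_comm, sub_self])
  refine ⟨k + n, ?_⟩
  rw [smul_sub, sub_eq_zero, ← mul_smul, ← pow_add] at hk
  rw [hk]
  exact N.smul_mem _ (N.smul_mem _ hm)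

lemma denIn_of_local (hM : Localizing M) (hV : IsAffineOpen V) (hU : X.basicOpen h ≤ U)
    (H : ∀ x ∈ X.basicOpen h, ∃ g : Γ(X, V), x ∈ X.basicOpen g ∧ DenIn N t g) : DenIn N t h := by
  obtain ⟨a, τ, hτ⟩ := hM.exists_lift h (rs M hU t)
  obtain ⟨n, hn⟩ := IsAffineOpen.exists_pow_mem hV
    (N.comap (LinearMap.toSpanSingleton Γ(X, V) _ τ)) h (fun x hx ↦ by
      obtain ⟨g, hxg, hg⟩ := H x hx
      obtain ⟨n, hn⟩ := (hg.mul_left h).exists_pow_smul_mem hM (h ^ a) τ (fun hU' ↦ by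
        have hle : X.basicOpen (h * g) ≤ X.basicOpen h := by
          rw [Scheme.basicOpen_mul]
          exact inf_le_left
        have h1 := congrArg (rs M hle) hτ
        rw [rs_smul, rs_rs, rs_rs, map_pow, rr_rr] at h1
        rw [map_pow, h1])
      exact ⟨g, hxg, n, hn⟩)
  refine ⟨hU, n + a, h ^ n • τ, hn, ?_⟩
  rw [rs_smul, hτ, pow_add, mul_smul, map_pow]

end Denominators

section DenSub

variable {X : Scheme.{u}} {M : X.Modules} (hM : Localizing M) {ι : Type u} {V : ι → X.Opens}
  (hV : ∀ k, IsAffineOpen (V k)) (N : ∀ k, Submodule Γ(X, V k) Γ(M, V k))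

/-- The subsheaf of sections which belong to the given modules up to denominators. -/
def denSub : Sub M where
  obj U :=
    { carrier := {t | ∀ k (h : Γ(X, V k)), X.basicOpen h ≤ U → DenIn (N k) t h}
      zero_mem' := fun _ _ hU ↦ denIn_zero hU
      add_mem' := fun ht ht' k h hU ↦ (ht k h hU).add (ht' k h hU)
      smul_mem' := fun a _ ht k h hU ↦ (ht k h hU).smul (hV k) a }
  res hWU _ ht := fun k h hW ↦ (denIn_rs_iff hW).mpr (ht k h (hW.trans hWU))
  loc H := fun k h hU ↦ denIn_of_local hM (hV k) hU fun x hx ↦ by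
    obtain ⟨W, hWU, hxW, ht⟩ := H x (hU hx)
    obtain ⟨g, hg, hxg⟩ := (hV k).exists_basicOpen_le ⟨x, hxW⟩ (X.basicOpen_le h hx)
    exact ⟨g, hxg, (denIn_rs_iff hg).mp (ht k g hg)⟩

lemma denSub_obj_le (k : ι) : (denSub hM hV N).obj (V k) ≤ N k := by
  intro t ht
  obtain ⟨n, hn⟩ := (ht k 1 (X.basicOpen_le _)).exists_pow_smul_mem hM 1 t
    (fun _ ↦ by rw [map_one, one_smul])
  simpa using hn

/-- Together with `denSub_obj_le` and `localizing_denSub`, this makes `denSub` the largest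
localizing subsheaf with sections over `V k` in `N k`, for a finite family on a Noetherian scheme.
Directedness of the coherent Cartier submodules comes from it. -/
lemma Sub.mem_denSub_of_exists_lift (K : Sub M) (hK : Localizing K.toModules)
    (hKN : ∀ k, K.obj (V k) ≤ N k) : K ≤ denSub hM hV N := by
  intro U t ht k h hU
  obtain ⟨n, m, hm⟩ := hK.exists_lift h (K.sec (rs M hU t) (K.res hU ht))
  refine ⟨hU, n, K.ι.app _ m, hKN k (K.ι_mem m), ?_⟩
  rw [← app_rs, hm, app_smul, K.ι_sec]

lemma mem_denSub_of_cover [IsNoetherian X] {U : X.Opens} (t : Γ(M, U))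
    (S : ∀ k, Finset Γ(X, V k)) (hS : ∀ k, ∀ x ∈ U ⊓ V k, ∃ f ∈ S k, x ∈ X.basicOpen f)
    (ht : ∀ k, ∀ f ∈ S k, DenIn (N k) t f) : t ∈ (denSub hM hV N).obj U := by
  intro k h hU
  refine denIn_of_local hM (hV k) hU fun x hx ↦ ?_
  obtain ⟨f, hf, hxf⟩ := hS k x ⟨hU hx, X.basicOpen_le h hx⟩
  exact ⟨f, hxf, ht k f hf⟩

/-- A lift `t` to `M` only needs correction by a power of `f`. On `D(h) ⊆ U ∩ V k` write `g = h ^ a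
* f` with `g` defined on `V k`, and let `τ` restrict to `h ^ b • t`. As `D(h * g) ⊆ D(f)`, some `(h
* g) ^ e • τ` lies in `N k`, so `f ^ e • t` has denominator `h ^ (e + a * e + b)`. Finitely many `h`
suffice. -/
lemma localizing_denSub [IsNoetherian X] [Finite ι] : Localizing (denSub hM hV N).toModules := by
  set K := denSub hM hV N
  constructor
  · intro U f s
    obtain ⟨n, t, ht⟩ := hM.exists_lift f (K.ι.app _ s)
    have htK : rs M (X.basicOpen_le f) t ∈ K.obj (X.basicOpen f) := by
      rw [ht]
      exact (K.obj _).smul_mem _ (K.ι_mem s)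
    choose S hS hS' using fun k ↦ IsAffineOpen.exists_finset_basicOpen (hV k)
      (inf_le_right : U ⊓ V k ≤ V k)
    have key (k : ι) (h : S k) : ∃ e : ℕ, ∀ e' ≥ e, DenIn (N k) (f ^ e' • t) h.1 := by
      obtain ⟨h, hh⟩ := h
      have hhU : X.basicOpen h ≤ U := (hS k h hh).trans inf_le_left
      obtain ⟨a, g, hg⟩ := IsAffineOpen.exists_rr_eq (hV k) h (rr X hhU f)
      have hle : X.basicOpen (h * g) ≤ X.basicOpen h := by
        rw [Scheme.basicOpen_mul]
        exact inf_le_left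
      have hle' : X.basicOpen (h * g) ≤ X.basicOpen f := by
        rw [Scheme.basicOpen_mul, ← basicOpen_rr (X.basicOpen_le h), hg, Scheme.basicOpen_mul]
        refine inf_le_right.trans ?_
        rw [basicOpen_rr]
        exact inf_le_right
      have h1 : DenIn (N k) t (h * g) := (denIn_rs_iff hle').mp (htK k _ hle')
      obtain ⟨b, τ, hτ⟩ := hM.exists_lift h (rs M hhU t)
      obtain ⟨e, he⟩ := h1.exists_pow_smul_mem hM (h ^ b) τ (fun hU' ↦ by
        have h1 := congrArg (rs M hle) hτ
        rw [rs_smul, rs_rs, rs_rs, map_pow, rr_rr] at h1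
        rw [map_pow, h1])
      have h2 : DenIn (N k) (f ^ e • t) h := by
        refine ⟨hhU, e + a * e + b, _, he, ?_⟩
        rw [rs_smul, rs_smul, hτ, map_pow, map_pow, map_mul, hg, ← mul_smul, ← mul_smul]
        congr 1
        ring
      refine ⟨e, fun e' he' ↦ ?_⟩
      rw [← Nat.sub_add_cancel he', pow_add, mul_smul]
      exact h2.smul (hV k) _
    choose e he using key
    obtain ⟨E, hE⟩ : ∃ E, ∀ k (h : S k), e k h ≤ E := by
      obtain ⟨E, hE⟩ := (Set.finite_range fun x : Σ k, S k ↦ e x.1 x.2).bddAbove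
      exact ⟨E, fun k h ↦ hE ⟨⟨k, h⟩, rfl⟩⟩
    have hfin : f ^ E • t ∈ K.obj U := mem_denSub_of_cover hM hV N _ S hS'
      fun k h hh ↦ he k ⟨h, hh⟩ E (hE k _)
    refine ⟨E + n, K.sec _ hfin, K.ι_injective _ ?_⟩
    rw [app_rs, K.ι_sec, app_smul, rs_smul, ht, ← mul_smul, pow_add, map_pow]
  · intro U f t ht
    obtain ⟨n, hn⟩ := hM.exists_pow_smul_eq_zero f (K.ι.app U t) (by rw [← app_rs, ht, map_zero])
    refine ⟨n, K.ι_injective U ?_⟩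
    rw [app_smul, hn, map_zero]

end DenSub

end CartierModules

/-! ### Locally finite Cartier modules are ind-coherent. -/

namespace CartierModules

open TopologicalSpace Opposite

variable {p : ℕ} [Fact p.Prime] {r : ℕ} {X : Scheme.{u}} [IsFpScheme p X]

section Union

variable (M : CartierModule p r X)

lemma cartierHom_ext {M N : CartierModule p r X} {f g : M ⟶ N}
    (H : ∀ U (s : Γ(M.a, U)), f.f.app U s = g.f.app U s) : f = g :=
  Endofunctor.Algebra.Hom.ext (modHom_ext H)

lemma cartier_comp_app {M N L : CartierModule p r X} (f : M ⟶ N) (g : N ⟶ L) (U : X.Opens)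
    (s : Γ(M.a, U)) : (f ≫ g).f.app U s = g.f.app U (f.f.app U s) := rfl

/-- The inclusion between stable subsheaves. -/
noncomputable def Sub.cartierInclusion {M : CartierModule p r X} {K L : Sub M.a} (hK : K.Stable M)
    (hL : L.Stable M) (h : K ≤ L) : K.toCartier hK ⟶ L.toCartier hL :=
  cartierHomMk (L.lift K.ι fun U s ↦ h U (K.ι_mem s)) fun _ _ ↦ rfl

/-- The stable subsheaves with a given property. -/
abbrev StableSub (P : Sub M.a → Prop) : Type u := {K : Sub M.a // K.Stable M ∧ P K}

variable {M} (P : Sub M.a → Prop)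

/-- The diagram of the stable subsheaves with a given property. -/
noncomputable def stableSubDiagram : StableSub M P ⥤ CartierModule p r X where
  obj K := K.1.toCartier K.2.1
  map {K L} f := Sub.cartierInclusion K.2.1 L.2.1 f.le
  map_id _ := cartierHom_ext fun _ _ ↦ rfl
  map_comp _ _ := cartierHom_ext fun _ _ ↦ rfl

/-- A Cartier module is the colimit of a directed family of submodules exhausting its sections. -/
theorem ind_of_directed (hne : Nonempty (StableSub M P))
    (hdir : ∀ K L : StableSub M P, ∃ N : StableSub M P, K ≤ N ∧ L ≤ N)
    (hex : ∀ U (s : Γ(M.a, U)), ∃ K : StableSub M P, s ∈ K.1.obj U)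
    (Q : ObjectProperty (CartierModule p r X)) (hQ : ∀ K : StableSub M P, Q (K.1.toCartier K.2.1)) :
    ObjectProperty.ind.{u} Q M := by
  have : IsDirectedOrder (StableSub M P) := ⟨hdir⟩
  refine ⟨StableSub M P, inferInstance, inferInstance,
    { diag := stableSubDiagram P
      ι := { app K := K.1.cartierι K.2.1, naturality K L f := cartierHom_ext fun U s ↦ rfl }
      isColimit := ?_ }, fun K ↦ hQ K⟩
  choose K hK using hex
  -- The map out of `M` evaluates `s` in any member containing it; directedness makes the value
  -- independent of the member.
  have hwd (c : Limits.Cocone (stableSubDiagram P)) (U : X.Opens) (s : Γ(M.a, U))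
      (L L' : StableSub M P) (hL : s ∈ L.1.obj U) (hL' : s ∈ L'.1.obj U) :
      (c.ι.app L).f.app U (L.1.sec s hL) = (c.ι.app L').f.app U (L'.1.sec s hL') := by
    obtain ⟨N, h, h'⟩ := hdir L L'
    rw [← c.w (homOfLE h), ← c.w (homOfLE h')]
    rfl
  let d (c : Limits.Cocone (stableSubDiagram P)) (U : X.Opens) (s : Γ(M.a, U)) : Γ(c.pt.a, U) :=
    (c.ι.app (K U s)).f.app U ((K U s).1.sec s (hK U s))
  have hd (c : Limits.Cocone (stableSubDiagram P)) (U : X.Opens) (s : Γ(M.a, U))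
      (L : StableSub M P) (hL : s ∈ L.1.obj U) :
      d c U s = (c.ι.app L).f.app U (L.1.sec s hL) := hwd c U s _ _ _ _
  refine
    { desc c := cartierHomMk (modHomMk (fun U ↦
        { toFun := d c U
          map_zero' := ?_
          map_add' s t := ?_ }) (fun U a s ↦ ?_) (fun U V h s ↦ ?_)) (fun U s ↦ ?_)
      fac c L := ?_
      uniq c m hm := ?_ }
  · rw [hd c U 0 (K U 0) (Submodule.zero_mem _)]
    exact map_zero ((c.ι.app (K U 0)).f.app U).hom
  · obtain ⟨N, h, h'⟩ := hdir (K U s) (K U t)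
    have hs := h U (hK U s)
    have ht := h' U (hK U t)
    rw [hd c U s N hs, hd c U t N ht, hd c U _ N (Submodule.add_mem _ hs ht)]
    exact map_add ((c.ι.app N).f.app U).hom (N.1.sec s hs) (N.1.sec t ht)
  · have hs := hK U s
    change d c U (a • s) = a • d c U s
    rw [hd c U s _ hs, hd c U _ _ (Submodule.smul_mem _ a hs)]
    exact app_smul (c.ι.app (K U s)).f a ((K U s).1.sec s hs)
  · have hs := hK U s
    change d c V (rs M.a h s) = rs _ h (d c U s)
    rw [hd c U s _ hs, hd c V _ _ ((K U s).1.res h hs)]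
    exact app_rs (c.ι.app (K U s)).f h ((K U s).1.sec s hs)
  · have hs := hK U s
    change d c U (kap M U s) = kap _ U (d c U s)
    rw [hd c U s _ hs, hd c U _ _ ((K U s).2.1 U s hs)]
    exact hom_kap (c.ι.app (K U s)) U ((K U s).1.sec s hs)
  · refine cartierHom_ext fun U s ↦ ?_
    exact hd c U _ L (L.1.ι_mem s)
  · refine cartierHom_ext fun U s ↦ ?_
    change _ = d c U s
    rw [hd c U s _ (hK U s), ← hm]
    rfl

end Union

section DenSub

variable {M : CartierModule p r X} (hM : Localizing M.a) {ι : Type u} {V : ι → X.Opens}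
  (hV : ∀ k, IsAffineOpen (V k)) (N : ∀ k, Submodule Γ(X, V k) Γ(M.a, V k))

/-- Raise the denominator to a `p ^ r`-th power before applying the structure map: if `h ^ (n * p ^
r) • s` is the restriction of `m`, then `h ^ n • κ s` is that of `κ m`. -/
lemma stable_denSub (hN : ∀ k, ∀ n ∈ N k, kap M (V k) n ∈ N k) : (denSub hM hV N).Stable M := by
  intro U s hs k h hU
  obtain ⟨_, n, H⟩ := (hs k h hU).exists_le
  have hq : 0 < p ^ r := pow_pos (Fact.out : p.Prime).pos r
  obtain ⟨m, hm, e⟩ := H (n * p ^ r) (Nat.le_mul_of_pos_right n hq)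
  refine ⟨hU, n, kap M (V k) m, hN k m hm, ?_⟩
  rw [← kap_rs, ← kap_rs, ← e, pow_mul, kap_smul]

/-- A localizing Cartier module whose sections over an affine cover are locally finite is
ind-coherent. -/
theorem isIndCoherent_of_isLocFinite [IsNoetherian X] [Finite ι] (hM : Localizing M.a)
    (hV : ∀ k, IsAffineOpen (V k)) (hcov : ∀ x : X, ∃ k, x ∈ V k)
    (hfin : ∀ k (s : Γ(M.a, V k)), IsLocFinite Γ(X, V k) (kap M (V k)) s) :
    isIndCoherent p r X M := by
  refine ⟨isQuasicoherent_of_localizing hM, ?_⟩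
  -- Stable subsheaves with this property are coherent. Finitely generated stable modules `N k`
  -- produce one through `denSub`, whose sections over `V k` lie in the Noetherian module `N k`.
  let P (K : Sub M.a) : Prop := Localizing K.toModules ∧ ∀ k, (K.obj (V k)).FG
  have hnoeth (k : ι) : IsNoetherianRing Γ(X, V k) :=
    IsLocallyNoetherian.component_noetherian ⟨V k, hV k⟩
  have hden (N : ∀ k, Submodule Γ(X, V k) Γ(M.a, V k)) (hfg : ∀ k, (N k).FG)
      (hN : ∀ k, ∀ n ∈ N k, kap M (V k) n ∈ N k) :
      (denSub hM hV N).Stable M ∧ P (denSub hM hV N) := by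
    refine ⟨stable_denSub hM hV N hN, localizing_denSub hM hV N, fun k ↦ ?_⟩
    have : IsNoetherian Γ(X, V k) (N k) := isNoetherian_of_fg_of_noetherian _ (hfg k)
    exact Submodule.FG.of_le_of_isNoetherian (denSub_obj_le hM hV N k)
  have hcommon (S : ∀ k, Set Γ(M.a, V k)) (hS : ∀ k, (S k).Finite) :
      ∃ N : ∀ k, Submodule Γ(X, V k) Γ(M.a, V k), (∀ k, (N k).FG) ∧
        (∀ k, ∀ n ∈ N k, kap M (V k) n ∈ N k) ∧ ∀ k, S k ⊆ N k := by
    choose N h₁ h₂ h₃ using fun k ↦ IsLocFinite.exists_common (hS k) fun s _ ↦ hfin k s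
    exact ⟨N, h₁, h₂, h₃⟩
  refine ind_of_directed P ?_ ?_ ?_ _ ?_
  · obtain ⟨N, h₁, h₂, -⟩ := hcommon (fun _ ↦ ∅) (fun _ ↦ Set.finite_empty)
    exact ⟨⟨_, hden N h₁ h₂⟩⟩
  · intro K L
    choose S hS using fun k ↦ K.2.2.2 k
    choose T hT using fun k ↦ L.2.2.2 k
    obtain ⟨N, h₁, h₂, h₃⟩ := hcommon (fun k ↦ S k ∪ T k)
      (fun k ↦ (S k).finite_toSet.union (T k).finite_toSet)
    refine ⟨⟨_, hden N h₁ h₂⟩, ?_, ?_⟩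
    · refine Sub.mem_denSub_of_exists_lift hM hV N K.1 K.2.2.1 fun k ↦ ?_
      rw [← hS k, Submodule.span_le]
      exact Set.subset_union_left.trans (h₃ k)
    · refine Sub.mem_denSub_of_exists_lift hM hV N L.1 L.2.2.1 fun k ↦ ?_
      rw [← hT k, Submodule.span_le]
      exact Set.subset_union_right.trans (h₃ k)
  · intro U s
    choose S hS hS' using fun k ↦ IsAffineOpen.exists_finset_basicOpen (hV k)
      (inf_le_right : U ⊓ V k ≤ V k)
    choose n t ht using fun k (h : S k) ↦ hM.exists_lift h.1
      (rs M.a ((hS k h.1 h.2).trans inf_le_left) s)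
    obtain ⟨N, h₁, h₂, h₃⟩ := hcommon (fun k ↦ Set.range (t k)) (fun k ↦ Set.finite_range _)
    refine ⟨⟨_, hden N h₁ h₂⟩, mem_denSub_of_cover hM hV N s S hS' fun k h hh ↦ ?_⟩
    exact ⟨(hS k h hh).trans inf_le_left, n k ⟨h, hh⟩, t k ⟨h, hh⟩, h₃ k ⟨_, rfl⟩,
      (ht k ⟨h, hh⟩).symm⟩
  · intro K
    refine isCoherentModule_of_localizing K.2.2.1 V hV hcov fun k ↦ ?_
    have : Module.Finite Γ(X, V k) (K.1.obj (V k)) := Module.Finite.iff_fg.mpr (K.2.2.2 k)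
    exact this

end DenSub

/-! ### Ind-coherent Cartier modules are locally finite. -/

section LocFinite

/-- Sections of an ind-coherent Cartier module over affine opens are locally finite. -/
theorem isLocFinite_of_isIndCoherent [IsNoetherian X] {M : CartierModule p r X}
    (hM : isIndCoherent p r X M) {V : X.Opens} (hV : IsAffineOpen V) (s : Γ(M.a, V)) :
    IsLocFinite Γ(X, V) (kap M V) s := by
  obtain ⟨hqc, J, _, _, pres, hcoh⟩ := hM
  have hloc : Localizing M.a := localizing_of_isQuasicoherent
  let D := pres.diag
  let φ (j : J) : D.obj j ⟶ M := pres.ι.app j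
  have hφ {i j : J} (f : i ⟶ j) (U : X.Opens) (d : Γ((D.obj i).a, U)) :
      (φ j).f.app U ((D.map f).f.app U d) = (φ i).f.app U d := by
    rw [← cartier_comp_app]
    have : D.map f ≫ φ j = φ i := (pres.ι.naturality f).trans (Category.comp_id _)
    rw [this]
  -- `T` consists of the sections that locally come from the diagram. The colimit need not be
  -- computed: the cocone factors through `T`, so by the universal property the inclusion of `T` has
  -- a section and `T` is everything.
  let T : Sub M.a :=
    { obj U :=
        { carrier := {s | ∀ x ∈ U, ∃ (W : X.Opens) (h : W ≤ U), x ∈ W ∧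
            ∃ (j : J) (d : Γ((D.obj j).a, W)), (φ j).f.app W d = rs M.a h s}
          zero_mem' := fun x hx ↦ ⟨U, le_rfl, hx, IsFiltered.nonempty.some, 0, by
            rw [map_zero, map_zero]⟩
          add_mem' := fun {s t} hs ht x hx ↦ by
            obtain ⟨W, hW, hxW, j, d, e⟩ := hs x hx
            obtain ⟨W', hW', hxW', j', d', e'⟩ := ht x hx
            refine ⟨W ⊓ W', inf_le_left.trans hW, ⟨hxW, hxW'⟩, IsFiltered.max j j',
              (D.map (IsFiltered.leftToMax j j')).f.app _ (rs _ inf_le_left d) +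
              (D.map (IsFiltered.rightToMax j j')).f.app _ (rs _ inf_le_right d'), ?_⟩
            rw [map_add, hφ, hφ, app_rs, app_rs, e, e', rs_rs, rs_rs, map_add]
          smul_mem' := fun a s hs x hx ↦ by
            obtain ⟨W, hW, hxW, j, d, e⟩ := hs x hx
            refine ⟨W, hW, hxW, j, rr X hW a • d, ?_⟩
            rw [app_smul, e, rs_smul] }
      res := fun {U U'} h s hs x hx ↦ by
        obtain ⟨W, hW, hxW, j, d, e⟩ := hs x (h hx)
        refine ⟨W ⊓ U', inf_le_right, ⟨hxW, hx⟩, j, rs _ inf_le_left d, ?_⟩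
        rw [app_rs, e, rs_rs, rs_rs]
      loc := fun {U s} H x hx ↦ by
        obtain ⟨U', hU', hxU', hs⟩ := H x hx
        obtain ⟨W, hW, hxW, j, d, e⟩ := hs x hxU'
        exact ⟨W, hW.trans hU', hxW, j, d, by rw [e, rs_rs]⟩ }
  have hT : T.Stable M := by
    intro U s hs x hx
    obtain ⟨W, hW, hxW, j, d, e⟩ := hs x hx
    exact ⟨W, hW, hxW, j, kap _ W d, by rw [hom_kap, e, kap_rs]⟩
  have hφT (j : J) (U : X.Opens) (d : Γ((D.obj j).a, U)) : (φ j).f.app U d ∈ T.obj U :=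
    fun x hx ↦ ⟨U, le_rfl, hx, j, d, (rs_self _ _ _).symm⟩
  have hTtop (U : X.Opens) (s : Γ(M.a, U)) : s ∈ T.obj U := by
    let c : Limits.Cocone D :=
      { pt := T.toCartier hT
        ι :=
          { app j := cartierHomMk (T.lift (φ j).f (hφT j)) fun U s ↦ T.ι_injective U
              (hom_kap (φ j) U s)
            naturality i j f := cartierHom_ext fun U s ↦ T.ι_injective U (hφ f U s) } }
    have h1 : pres.isColimit.desc c ≫ T.cartierι hT = 𝟙 M := by
      refine pres.isColimit.hom_ext fun j ↦ ?_
      rw [← Category.assoc, pres.isColimit.fac c j]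
      exact (Category.comp_id _).symm
    have h2 := congrArg (fun f : M ⟶ M ↦ f.f.app U s) h1
    have h3 : T.ι.app U ((pres.isColimit.desc c).f.app U s) = s := h2
    rw [← h3]
    exact T.ι_mem _
  have h4 (x : V) : ∃ h : Γ(X, V), x.1 ∈ X.basicOpen h ∧
      ∃ (j : J) (d : Γ((D.obj j).a, X.basicOpen h)),
        (φ j).f.app _ d = rs M.a (X.basicOpen_le h) s := by
    obtain ⟨W, hW, hxW, j, d, e⟩ := hTtop V s x.1 x.2
    obtain ⟨h, hh, hx⟩ := hV.exists_basicOpen_le ⟨x.1, hxW⟩ x.2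
    exact ⟨h, hx, j, rs _ hh d, by rw [app_rs, e, rs_rs]⟩
  choose h hx j d hd using h4
  obtain ⟨F, hF⟩ := (NoetherianSpace.isCompact (V : Set X)).elim_finite_subcover
    (fun x : V ↦ (X.basicOpen (h x) : Set X)) (fun x ↦ (X.basicOpen (h x)).isOpen)
    (fun x hxV ↦ Set.mem_iUnion.mpr ⟨⟨x, hxV⟩, hx _⟩)
  classical
  -- By quasi-compactness one index carries all local lifts of `s`; the image of its sections over
  -- `V` is the required stable finitely generated submodule.
  obtain ⟨j₀, hj₀⟩ := IsFiltered.sup_objs_exists (F.image j)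
  have hlocD : Localizing (D.obj j₀).a := by
    have := (hcoh j₀).1
    exact localizing_of_isQuasicoherent
  let ψ : Γ((D.obj j₀).a, V) →ₗ[Γ(X, V)] Γ(M.a, V) :=
    { ((φ j₀).f.app V).hom with map_smul' := fun a d ↦ app_smul (φ j₀).f a d }
  have hψ (d : Γ((D.obj j₀).a, V)) : ψ d = (φ j₀).f.app V d := rfl
  have := IsCoherentModule.finite (hcoh j₀) hV
  refine ⟨LinearMap.range ψ, ?_, ?_, ?_⟩
  · rw [LinearMap.range_eq_map]
    exact this.fg_top.map _
  · rintro _ ⟨d, rfl⟩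
    exact ⟨kap _ V d, hom_kap (φ j₀) V d⟩
  -- Applied with `h = 1`, so that the resulting power of `h` imposes nothing and `s` itself is in
  -- the range.
  · obtain ⟨n, hn⟩ := IsAffineOpen.exists_pow_mem hV
      ((LinearMap.range ψ).comap (LinearMap.toSpanSingleton Γ(X, V) _ s)) 1 (fun x hx1 ↦ by
        obtain ⟨y, hyF, hxy⟩ := Set.mem_iUnion₂.mp (hF (X.basicOpen_le _ hx1))
        refine ⟨h y, hxy, ?_⟩
        obtain ⟨f⟩ := hj₀ (Finset.mem_image_of_mem j hyF)
        obtain ⟨n, t, ht⟩ := hlocD.exists_lift (h y) ((D.map f).f.app _ (d y))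
        obtain ⟨k, hk⟩ := hloc.exists_pow_smul_eq_zero (h y) (ψ t - h y ^ n • s) (by
          rw [map_sub, hψ, ← app_rs, ht, app_smul, hφ, hd, rs_smul, map_pow, sub_self])
        refine ⟨k + n, ?_⟩
        rw [smul_sub, sub_eq_zero, ← mul_smul, ← pow_add] at hk
        rw [one_mul]
        change h y ^ (k + n) • s ∈ LinearMap.range ψ
        rw [← hk]
        exact Submodule.smul_mem _ _ ⟨t, rfl⟩)
    simpa using hn

end LocFinite

end CartierModules

/-! ### Finiteness of Frobenius and injective hulls on a Noetherian spectrum. -/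

namespace CartierModules

open TopologicalSpace Opposite

section Frobenius

lemma exists_finset_of_finite {A B : Type*} [CommRing A] [CommRing B] (φ : A →+* B)
    (hφ : φ.Finite) : ∃ S : Finset B, ∀ b, ∃ c : B → A, b = ∑ s ∈ S, φ (c s) * s := by
  let := φ.toAlgebra
  obtain ⟨S, hS⟩ := hφ.fg_top
  refine ⟨S, fun b ↦ ?_⟩
  obtain ⟨c, -, hc⟩ := Submodule.mem_span_finset.mp (hS.ge (Submodule.mem_top (x := b)))
  exact ⟨c, hc.symm⟩

variable (p : ℕ) [Fact p.Prime] (r : ℕ) (X : Scheme.{u}) [IsFpScheme p X]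

theorem isFinite_frobenius [h : IsFFinite p X] : IsFinite (frobenius p r X) := by
  have := h.isFinite_frobenius
  induction r with
  | zero =>
    rw [frobenius_zero]
    infer_instance
  | succ r ih =>
    rw [frobenius_succ]
    infer_instance

variable {X} in
theorem IsAffineOpen.powFinite [IsFFinite p X] {V : X.Opens} (hV : IsAffineOpen V) :
    PowFinite (p ^ r) Γ(X, V) := by
  have := isFinite_frobenius p r X
  have hfin : ((frobenius p r X).app V).hom.Finite := IsFinite.finite_app _ V hV
  let φ : Γ(X, V) →+* Γ(X, V) := ((frobenius p r X).app V).hom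
  have hφ : φ.Finite := hfin
  exact exists_finset_of_finite φ hφ

end Frobenius

section Hull

variable {R : CommRingCat.{u}}

/-- The global section of `tilde E` defined by an element of `E`. -/
noncomputable def tildeSec (E : ModuleCat.{u} R) : E →+ Γ(tilde E, ⊤) :=
  (tilde.toOpen E ⊤).hom.toAddMonoidHom

lemma tildeSec_smul (E : ModuleCat.{u} R) (a : R) (e : E) :
    tildeSec E (a • e) = a • tildeSec E e :=
  toOpen_smul E ⊤ a e

lemma tildeSec_bijective (E : ModuleCat.{u} R) : Function.Bijective (tildeSec E) :=
  (ConcreteCategory.isIso_iff_bijective (tilde.toOpen E ⊤)).mp inferInstance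

lemma map_tildeSec {E E' : ModuleCat.{u} R} (f : E ⟶ E') (e : E) :
    (tilde.map f).app ⊤ (tildeSec E e) = tildeSec E' (f.hom e) :=
  congr(($(tilde.toOpen_map_app f ⊤)).hom e)

lemma fromTildeΓ_tildeSec (N : (Spec R).Modules)
    (m : (modulesSpecToSheaf.obj N).presheaf.obj (op ⊤)) :
    N.fromTildeΓ.app ⊤ (tildeSec _ m) = m :=
  congr(($(N.toOpen_fromTildeΓ_app ⊤)).hom m).trans (rs_self N le_top m)

lemma exists_moduleCat_hull (G : ModuleCat.{u} R) : ∃ (E : ModuleCat.{u} R) (f : G ⟶ E),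
    Module.Injective R E ∧ Function.Injective f.hom ∧
      ∀ e : E, e ≠ 0 → ∃ (r : R) (m : G), r • e ≠ 0 ∧ r • e = f.hom m := by
  obtain ⟨E, _, _, f, h₁, h₂, h₃⟩ := exists_injective_hull R G
  exact ⟨ModuleCat.of R E, ModuleCat.ofHom f, h₁, h₂, h₃⟩

/-- A quasi-coherent module on a Noetherian affine scheme embeds in an injective localizing module,
with essential image on global sections. -/
theorem exists_injective_sheaf_hull [IsNoetherianRing R] (N : (Spec R).Modules)
    [hN : N.IsQuasicoherent] : ∃ (F : (Spec R).Modules) (α : N ⟶ F), Injective F ∧ Localizing F ∧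
      Mono α ∧ ∀ e : Γ(F, ⊤), e ≠ 0 → ∃ (a : R) (n : Γ(N, ⊤)), a • e ≠ 0 ∧ a • e = α.app ⊤ n := by
  let G : ModuleCat.{u} R := (modulesSpecToSheaf.obj N).presheaf.obj (op ⊤)
  obtain ⟨E, f, hE, hf, hess⟩ := exists_moduleCat_hull G
  have hiso : IsIso N.fromTildeΓ := inferInstance
  let F := tilde E
  let α : N ⟶ F := inv N.fromTildeΓ ≫ tilde.map f
  have hF : Localizing F := localizing_of_isQuasicoherent
  have hNloc : Localizing N := localizing_of_isQuasicoherent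
  have hα (m : G) : α.app ⊤ m = tildeSec E (f.hom m) := by
    have h2 : (inv N.fromTildeΓ).app ⊤ m = tildeSec G m := by
      have h3 : (N.fromTildeΓ ≫ inv N.fromTildeΓ).app ⊤ (tildeSec G m) = tildeSec G m := by
        rw [IsIso.hom_inv_id]
        rfl
      refine Eq.trans ?_ h3
      exact congrArg ((inv N.fromTildeΓ).app ⊤) (fromTildeΓ_tildeSec N m).symm
    refine Eq.trans ?_ (map_tildeSec f m)
    exact congrArg ((tilde.map f).app ⊤) h2
  have hbij := tildeSec_bijective E
  have hαinj : Function.Injective (α.app ⊤) := by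
    intro m m' h
    have h1 := (hα m).symm.trans (h.trans (hα m'))
    exact hf (hbij.1 h1)
  refine ⟨F, α, injective_tilde _, hF, ?_, ?_⟩
  -- Injectivity on global sections is enough: on `D(g)` a section killed by `α` extends, up to a
  -- power of `g`, to a global section whose image is killed by a power of `g`.
  · refine mono_of_app_injective α fun W ↦ (injective_iff_map_eq_zero (α.app W).hom).mpr
      fun s hs ↦ section_ext N fun x hx ↦ ?_
    obtain ⟨g, hg, hxg⟩ := (isAffineOpen_top (Spec R)).exists_basicOpen_le ⟨x, hx⟩ (Opens.mem_top x)
    refine ⟨_, hg, hxg, ?_⟩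
    obtain ⟨n, t, ht⟩ := hNloc.exists_lift g (rs N hg s)
    obtain ⟨k, hk⟩ := hF.exists_pow_smul_eq_zero g (α.app ⊤ t) (by
      have hs' : α.app W s = 0 := hs
      rw [← app_rs, ht, app_smul, app_rs, hs', map_zero, smul_zero])
    have hk' : g ^ k • t = 0 := hαinj (by rw [app_smul, hk, map_zero])
    have h2 := congrArg (rs N ((Spec R).basicOpen_le g)) hk'
    rw [rs_smul, ht, ← mul_smul, map_pow, ← pow_add, map_zero] at h2
    rw [map_zero]
    exact smul_eq_zero_of_isUnit ((isUnit_rr g).pow _) h2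
  · intro e he
    obtain ⟨e₀, rfl⟩ := hbij.2 e
    have he₀ : e₀ ≠ 0 := by
      rintro rfl
      exact he (map_zero _)
    obtain ⟨a, m, h1, h2⟩ := hess e₀ he₀
    refine ⟨a, m, ?_, ?_⟩
    · intro h3
      have h4 := (tildeSec_smul E a e₀).trans h3
      exact h1 (hbij.1 (h4.trans (map_zero (tildeSec E)).symm))
    · exact (tildeSec_smul E a e₀).symm.trans ((congrArg (tildeSec E) h2).trans (hα m).symm)

end Hull

end CartierModules

/-! ### Pushforward and restriction of Cartier modules, and local hulls. -/

namespace CartierModules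

open TopologicalSpace Opposite

variable {p : ℕ} [Fact p.Prime] {r : ℕ} {X Y : Scheme.{u}} [IsFpScheme p X]

section Functoriality

lemma IsFpScheme.of_hom (j : Y ⟶ X) : IsFpScheme p Y :=
  ⟨⟨j ≫ (IsFpScheme.nonempty_hom (p := p) (X := X)).some⟩⟩

variable [IsFpScheme p Y] (j : Y ⟶ X)

/-- The pushforward of a Cartier module. -/
noncomputable def pushCartier (F : CartierModule p r Y) : CartierModule p r X where
  a := (Scheme.Modules.pushforward j).obj F.a
  str := frobHomMk (fun U ↦ (kap F (j ⁻¹ᵁ U) : Γ(F.a, j ⁻¹ᵁ U) →+ Γ(F.a, j ⁻¹ᵁ U)))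
    (fun U a s ↦ by
      refine Eq.trans ?_ (kap_smul F (j ⁻¹ᵁ U) ((j.app U).hom a) s)
      rw [← map_pow]
      rfl)
    (fun U V h s ↦ kap_rs F (j.preimage_mono h) s)

lemma pushCartier_smul (F : Y.Modules) {U : X.Opens} (a : Γ(X, U))
    (s : Γ((Scheme.Modules.pushforward j).obj F, U)) :
    a • s = ((j.app U).hom a • (show Γ(F, j ⁻¹ᵁ U) from s) : Γ(F, j ⁻¹ᵁ U)) := rfl

/-- The preimage of `D(f)` is the basic open of the pulled-back function. The preimage of `U` need
not be affine, which is why `Localizing` is stated for all opens. -/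
lemma localizing_pushforward {F : Y.Modules} (hF : Localizing F) :
    Localizing ((Scheme.Modules.pushforward j).obj F) := by
  have hpre {U : X.Opens} (f : Γ(X, U)) :
      j ⁻¹ᵁ X.basicOpen f = Y.basicOpen ((j.app U).hom f) := Scheme.preimage_basicOpen j f
  refine ⟨fun {U} f s ↦ ?_, fun {U} f t ht ↦ ?_⟩
  · let s' : Γ(F, j ⁻¹ᵁ X.basicOpen f) := s
    obtain ⟨n, t, ht⟩ := hF.exists_lift ((j.app U).hom f) (rs F (hpre f).ge s')
    refine ⟨n, t, ?_⟩
    have h1 := congrArg (rs F (hpre f).le) ht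
    rw [rs_rs, rs_smul, rs_rs, rs_self, map_pow, rr_rr] at h1
    refine h1.trans ?_
    rw [pushCartier_smul, map_pow]
    congr 2
    exact congr($(j.naturality (homOfLE (X.basicOpen_le f)).op).hom f).symm
  · let t' : Γ(F, j ⁻¹ᵁ U) := t
    obtain ⟨n, hn⟩ := hF.exists_pow_smul_eq_zero ((j.app U).hom f) t' (by
      refine (rs_rs F (j.preimage_mono (X.basicOpen_le f)) (hpre f).ge t').symm.trans ?_
      exact (congrArg _ ht).trans (map_zero _))
    refine ⟨n, ?_⟩
    rw [pushCartier_smul, map_pow]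
    exact hn

variable [IsOpenImmersion j]

/-- The restriction of a Cartier module along an open immersion. -/
noncomputable def restrictCartier (M : CartierModule p r X) : CartierModule p r Y where
  a := M.a.restrict j
  str := frobHomMk (fun U ↦ ((unres M.a j U).symm.toAddMonoidHom.comp (kap M (j ''ᵁ U))).comp
      (unres M.a j U).toAddMonoidHom)
    (fun U a s ↦ (unres M.a j U).injective (by
      refine Eq.trans ?_ (kap_smul M (j ''ᵁ U) ((j.appIso U).inv.hom a) (unres M.a j U s))
      rw [← map_pow]
      rfl))
    (fun U V h s ↦ kap_rs M (j.image_mono h) (unres M.a j U s))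

/-- The restriction of a section to an open subscheme. -/
noncomputable def toRestrict (M : X.Modules) (U : X.Opens) : Γ(M, U) →+ Γ(M.restrict j, j ⁻¹ᵁ U) :=
  (unres M j (j ⁻¹ᵁ U)).symm.toAddMonoidHom.comp (rs M (j.image_preimage_le U))

lemma unres_toRestrict (M : X.Modules) (U : X.Opens) (s : Γ(M, U)) :
    unres M j _ (toRestrict j M U s) = rs M (j.image_preimage_le U) s := rfl

lemma toRestrict_smul (M : X.Modules) (U : X.Opens) (a : Γ(X, U)) (s : Γ(M, U)) :
    toRestrict j M U (a • s) = (j.app U).hom a • toRestrict j M U s := by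
  apply (unres M j (j ⁻¹ᵁ U)).injective
  rw [unres_smul, unres_toRestrict, unres_toRestrict, rs_smul,
    ← appIso_inv_rr j (j.image_preimage_le U) le_rfl a, rr_self]

lemma toRestrict_rs (M : X.Modules) {U V : X.Opens} (h : V ≤ U) (s : Γ(M, U)) :
    toRestrict j M V (rs M h s) = rs _ (j.preimage_mono h) (toRestrict j M U s) := by
  apply (unres M j (j ⁻¹ᵁ V)).injective
  rw [unres_rs, unres_toRestrict, unres_toRestrict, rs_rs, rs_rs]

lemma toRestrict_injective (M : X.Modules) {U : X.Opens} (hU : U ≤ j.opensRange) :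
    Function.Injective (toRestrict j M U) := by
  intro s t h
  have h1 := congrArg (unres M j _) h
  rw [unres_toRestrict, unres_toRestrict] at h1
  have hle : U ≤ j ''ᵁ j ⁻¹ᵁ U := by
    rw [j.image_preimage_eq_opensRange_inf]
    exact le_inf hU le_rfl
  have h2 := congrArg (rs M hle) h1
  rwa [rs_rs, rs_rs, rs_self, rs_self] at h2

/-- The adjoint of a morphism out of a restriction. -/
noncomputable def toPushCartier {M : CartierModule p r X} {F : CartierModule p r Y}
    (α : restrictCartier j M ⟶ F) : M ⟶ pushCartier j F :=
  cartierHomMk (modHomMk (fun U ↦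
    ((α.f.app (j ⁻¹ᵁ U)).hom.comp (toRestrict j M.a U) : Γ(M.a, U) →+ Γ(F.a, j ⁻¹ᵁ U)))
    (fun U a s ↦ by
      refine Eq.trans ?_ (app_smul α.f ((j.app U).hom a) (toRestrict j M.a U s))
      exact congrArg (α.f.app _) (toRestrict_smul j M.a U a s))
    (fun U V h s ↦ by
      refine Eq.trans ?_ (app_rs α.f (j.preimage_mono h) (toRestrict j M.a U s))
      exact congrArg (α.f.app _) (toRestrict_rs j M.a h s)))
    (fun U s ↦ by
      refine Eq.trans ?_ (hom_kap α (j ⁻¹ᵁ U) (toRestrict j M.a U s))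
      refine congrArg (α.f.app _) ((unres M.a j (j ⁻¹ᵁ U)).injective ?_)
      exact (kap_rs M (j.image_preimage_le U) s).symm)

lemma toPushCartier_app {M : CartierModule p r X} {F : CartierModule p r Y}
    (α : restrictCartier j M ⟶ F) (U : X.Opens) (s : Γ(M.a, U)) :
    (toPushCartier j α).f.app U s = α.f.app (j ⁻¹ᵁ U) (toRestrict j M.a U s) := rfl

-- Pushforward is right adjoint to restriction, which preserves monomorphisms since its sections are
-- sections over image opens.
omit [IsFpScheme p X] [IsFpScheme p Y] in
lemma injective_pushforward (F : Y.Modules) [Injective F] :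
    Injective ((Scheme.Modules.pushforward j).obj F) := by
  have : (Scheme.Modules.restrictFunctor j).PreservesMonomorphisms :=
    ⟨fun f _ ↦ mono_of_app_injective _ fun U ↦ app_injective f (j ''ᵁ U)⟩
  exact Injective.injective_of_adjoint (Scheme.Modules.restrictAdjunction j) F

end Functoriality

section LocalHull

/-- Every quasi-coherent Cartier module embeds over an affine open subscheme in a Cartier module
whose underlying module is injective, with essential image over this affine open. -/
theorem exists_local_hull [IsNoetherian X] (M : CartierModule p r X) [hM : M.a.IsQuasicoherent]
    {V : X.Opens} (hV : IsAffineOpen V) :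
    ∃ (J : CartierModule p r X) (β : M ⟶ J), Injective J.a ∧ Localizing J.a ∧
      (∀ U ≤ V, Function.Injective (β.f.app U)) ∧
      (∀ (U : X.Opens) (e : Γ(J.a, U)), rs J.a (inf_le_left : U ⊓ V ≤ U) e = 0 → e = 0) ∧
      ∀ e : Γ(J.a, V), e ≠ 0 → ∃ (a : Γ(X, V)) (m : Γ(M.a, V)),
        a • e ≠ 0 ∧ a • e = β.f.app V m := by
  let j := hV.fromSpec
  have : IsFpScheme p (Spec Γ(X, V)) := IsFpScheme.of_hom j
  have : IsNoetherianRing Γ(X, V) := IsLocallyNoetherian.component_noetherian ⟨V, hV⟩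
  let N := restrictCartier j M
  have : N.a.IsQuasicoherent := inferInstanceAs
    ((Scheme.Modules.restrictFunctor j).obj M.a).IsQuasicoherent
  obtain ⟨F, α, hF, hFloc, hα, hess⟩ := exists_injective_sheaf_hull N.a
  -- `F` is injective and `F^r_* α` is a monomorphism, so the structure map of `N` followed by `α`
  -- extends to `F^r_* F`. Any extension will do.
  let F' : CartierModule p r (Spec Γ(X, V)) :=
    { a := F
      str := Injective.factorThru (N.str ≫ α)
        ((Scheme.Modules.pushforward (frobenius p r (Spec Γ(X, V)))).map α) }
  let α' : N ⟶ F' :=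
    { f := α
      h := Injective.comp_factorThru _ _ }
  have hrange : j.opensRange = V := hV.opensRange_fromSpec
  have htop : (⊤ : (Spec Γ(X, V)).Opens) ≤ j ⁻¹ᵁ V := hV.fromSpec_preimage_self.ge
  refine ⟨pushCartier j F', toPushCartier j α', injective_pushforward j F,
    localizing_pushforward j hFloc, fun U hU ↦ ?_, fun U e he ↦ ?_, fun e he ↦ ?_⟩
  · exact (app_injective α (j ⁻¹ᵁ U)).comp (toRestrict_injective j M.a (hU.trans hrange.ge))
  · have hle : j ⁻¹ᵁ U ≤ j ⁻¹ᵁ (U ⊓ V) := fun x hx ↦ ⟨hx, htop (Opens.mem_top x)⟩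
    have h1 := congrArg (rs F hle) he
    refine Eq.trans ?_ (h1.trans (map_zero (rs F hle)))
    refine Eq.trans ?_ (rs_rs F (j.preimage_mono inf_le_left) hle (e : Γ(F, j ⁻¹ᵁ U))).symm
    exact (rs_self F _ _).symm
  · let e' : Γ(F, j ⁻¹ᵁ V) := e
    have hback (s : Γ(F, j ⁻¹ᵁ V)) : rs F le_top (rs F htop s) = s := by rw [rs_rs, rs_self]
    have he' : rs F htop e' ≠ 0 := fun h ↦ he ((hback e').symm.trans (by rw [h, map_zero]; rfl))
    obtain ⟨a, n, h1, h2⟩ := hess _ he'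
    have hring : rr (Spec Γ(X, V)) le_top (rr (Spec Γ(X, V)) (le_top : (⊤ : (Spec Γ(X, V)).Opens) ≤ ⊤)
        ((Scheme.ΓSpecIso Γ(X, V)).inv.hom a)) = (j.app V).hom a :=
      (rr_rr _ _ _).trans congr($(hV.fromSpec_app_self).hom a).symm
    have hsm : a • e = rs F le_top (a • rs F htop e') := by
      change ((j.app V).hom a • e' : Γ(F, j ⁻¹ᵁ V)) = _
      refine Eq.trans ?_ (congrArg (rs F le_top) (Scheme.Modules.smul_Spec_def a (rs F htop e'))).symm
      refine Eq.trans ?_ (rs_smul F (le_top : j ⁻¹ᵁ V ≤ ⊤) _ _).symm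
      rw [hback]
      exact congrArg (· • e') hring.symm
    refine ⟨a, rs M.a (IsAffineOpen.le_image_top hV) (unres M.a j ⊤ n), ?_, ?_⟩
    · rw [hsm]
      intro h3
      apply h1
      have h4 := congrArg (rs F htop) h3
      rw [rs_rs, rs_self] at h4
      exact h4.trans (map_zero (rs F htop))
    · rw [hsm, h2, toPushCartier_app, ← app_rs]
      refine congrArg (α.app _) ((unres M.a j _).injective ?_)
      exact (unres_rs M.a j _ n).trans (rs_rs M.a _ _ _).symm

end LocalHull

end CartierModules

/-! ### Spreading essentiality from one affine open to all others. -/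

namespace CartierModules

open TopologicalSpace Opposite

section Essential

variable {X : Scheme.{u}}

/-- Essentiality of a morphism of localizing modules spreads from an affine open to every affine
open, if sections of the target are determined on the first affine open. -/
lemma exists_smul_eq_app [IsNoetherian X] {M J : X.Modules} (hM : Localizing M) (hJ : Localizing J)
    (β : M ⟶ J) {V : X.Opens} (hV : IsAffineOpen V)
    (hb : ∀ (U : X.Opens) (e : Γ(J, U)), rs J (inf_le_left : U ⊓ V ≤ U) e = 0 → e = 0)
    (hc : ∀ e : Γ(J, V), e ≠ 0 → ∃ (a : Γ(X, V)) (m : Γ(M, V)), a • e ≠ 0 ∧ a • e = β.app V m)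
    {W : X.Opens} (hW : IsAffineOpen W) (e : Γ(J, W)) (he : e ≠ 0) :
    ∃ (a : Γ(X, W)) (s : Γ(M, W)), a • e ≠ 0 ∧ a • e = β.app W s := by
  have hnoeth : IsNoetherianRing Γ(X, V) := IsLocallyNoetherian.component_noetherian ⟨V, hV⟩
  -- By `hb`, `e` does not vanish on `W ⊓ V`, hence it is nonzero near some point `x` there. The
  -- comparison of `W` with `V` takes place on a neighbourhood of `x` that is basic in both.
  obtain ⟨x, hx, hex⟩ : ∃ x ∈ W ⊓ V, ∀ (D : X.Opens) (h : D ≤ W), x ∈ D → rs J h e ≠ 0 := by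
    by_contra! hcon
    refine he (hb W e (section_ext J fun x hx ↦ ?_))
    obtain ⟨D, hD, hxD, h0⟩ := hcon x hx
    refine ⟨D ⊓ (W ⊓ V), inf_le_right, ⟨hxD, hx⟩, ?_⟩
    rw [map_zero, rs_rs, ← rs_rs J hD inf_le_left, h0, map_zero]
  obtain ⟨f, g, hfg, hxf⟩ := exists_basicOpen_le_affine_inter hW hV x hx
  have hDW := X.basicOpen_le f
  have hDV : X.basicOpen f ≤ V := hfg.le.trans (X.basicOpen_le g)
  have hgunit : IsUnit (rr X hDV g) := isUnit_rr_of_le g hfg.le hDV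
  have heD := hex _ hDW hxf
  have hkill (t : Γ(J, V)) (ht : rs J hDV t = 0) : ∃ n, g ^ n • t = 0 :=
    hJ.exists_pow_smul_eq_zero g t (by
      rw [← rs_rs J hDV hfg.ge, ht, map_zero])
  obtain ⟨n, t, ht⟩ : ∃ (n : ℕ) (t : Γ(J, V)), rs J hDV t = rr X hDV g ^ n • rs J hDW e := by
    obtain ⟨n, t, ht⟩ := hJ.exists_lift g (rs J hfg.ge (rs J hDW e))
    refine ⟨n, t, ?_⟩
    have h1 := congrArg (rs J hfg.le) ht
    rwa [rs_rs, rs_smul, map_pow, rr_rr, rs_rs, rs_self] at h1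
  -- The annihilators of `g ^ k • t` increase with `k`. Once they are stable, no nonzero multiple of
  -- `g ^ k • t` is `g`-power torsion, so the multiple given by essentiality stays nonzero on
  -- `D(g)`.
  obtain ⟨k, hk⟩ := monotone_stabilizes_iff_noetherian.mpr hnoeth
    ⟨fun k ↦ LinearMap.ker (LinearMap.toSpanSingleton Γ(X, V) Γ(J, V) (g ^ k • t)),
      fun k l hkl a ha ↦ by
        rw [LinearMap.mem_ker, LinearMap.toSpanSingleton_apply] at ha ⊢
        rw [← Nat.sub_add_cancel hkl, pow_add, mul_smul, smul_comm, ha, smul_zero]⟩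
  have htf (i : ℕ) (a : Γ(X, V)) (h : g ^ i • a • g ^ k • t = 0) : a • g ^ k • t = 0 := by
    have h1 := hk (k + i) (Nat.le_add_right k i)
    have h2 : a ∈ LinearMap.ker (LinearMap.toSpanSingleton Γ(X, V) Γ(J, V) (g ^ (k + i) • t)) := by
      rw [LinearMap.mem_ker, LinearMap.toSpanSingleton_apply, add_comm, pow_add, mul_smul, smul_comm]
      exact h
    exact h1.ge h2
  have htD : rs J hDV (g ^ k • t) = rr X hDV g ^ (k + n) • rs J hDW e := by
    rw [rs_smul, ht, map_pow, pow_add, mul_smul]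
  obtain ⟨a, m, ham, ham'⟩ := hc (g ^ k • t) fun h ↦ heD
    (smul_eq_zero_of_isUnit (hgunit.pow (k + n)) (by rw [← htD, h, map_zero]))
  have hmD : β.app _ (rs M hDV m) = (rr X hDV a * rr X hDV g ^ (k + n)) • rs J hDW e := by
    rw [app_rs, ← ham', rs_smul, htD, mul_smul]
  have hmD0 : β.app _ (rs M hDV m) ≠ 0 := by
    intro h
    rw [app_rs, ← ham'] at h
    obtain ⟨i, hi⟩ := hkill _ h
    exact ham (htf i a hi)
  -- Back to `W`: clear the `f`-denominators of the coefficient and of `m`, then absorb the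
  -- remaining `f`-power torsion.
  obtain ⟨l, c, hcl⟩ := IsAffineOpen.exists_rr_eq hW f (rr X hDV a * rr X hDV g ^ (k + n))
  obtain ⟨h, s, hs⟩ := hM.exists_lift f (rs M hDV m)
  have hD1 : rs J hDW ((f ^ h * c) • e) = rr X hDW f ^ (h + l) • β.app _ (rs M hDV m) := by
    rw [rs_smul, map_mul, map_pow, hcl, hmD, pow_add _ h l, ← mul_smul, mul_assoc]
  have hD2 : rs J hDW (β.app W (f ^ l • s)) = rr X hDW f ^ (h + l) • β.app _ (rs M hDV m) := by
    rw [← app_rs, rs_smul, hs, app_smul, app_smul, map_pow, ← mul_smul, pow_add, mul_comm]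
  obtain ⟨i, hi⟩ := hJ.exists_pow_smul_eq_zero f ((f ^ h * c) • e - β.app W (f ^ l • s)) (by
    rw [map_sub, hD1, hD2, sub_self])
  rw [smul_sub, sub_eq_zero, ← app_smul, ← mul_smul] at hi
  refine ⟨_, _, fun h0 ↦ hmD0 ?_, hi⟩
  have h1 := congrArg (rs J hDW) h0
  rw [mul_smul, rs_smul, hD1, map_zero, map_pow] at h1
  exact smul_eq_zero_of_isUnit ((isUnit_rr f).pow _) (smul_eq_zero_of_isUnit ((isUnit_rr f).pow _) h1)

end Essential

variable {p : ℕ} [Fact p.Prime] {r : ℕ} {X : Scheme.{u}} [IsFpScheme p X]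

lemma IsLocFinite.app {M J : CartierModule p r X} (β : M ⟶ J) {W : X.Opens} {s : Γ(M.a, W)}
    (hs : IsLocFinite Γ(X, W) (kap M W) s) :
    IsLocFinite Γ(X, W) (kap J W) (β.f.app W s) := by
  obtain ⟨N, hN, hκ, hs⟩ := hs
  let ψ : Γ(M.a, W) →ₗ[Γ(X, W)] Γ(J.a, W) :=
    { (β.f.app W).hom with map_smul' := fun a d ↦ app_smul β.f a d }
  refine ⟨N.map ψ, hN.map _, ?_, ⟨s, hs, rfl⟩⟩
  rintro _ ⟨n, hn, rfl⟩
  exact ⟨kap M W n, hκ n hn, hom_kap β W n⟩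

/-! ### Finite direct sums of Cartier modules. -/

section Biproduct

open Limits

instance : HasFiniteBiproducts X.Modules := Abelian.hasFiniteBiproducts

variable {ι : Type u} [Finite ι]

/-- The direct sum of a finite family of Cartier modules. -/
noncomputable def directSum (J : ι → CartierModule p r X) : CartierModule p r X where
  a := ⨁ fun k ↦ (J k).a
  str := biproduct.lift fun k ↦
    (Scheme.Modules.pushforward (frobenius p r X)).map (biproduct.π _ k) ≫ (J k).str

variable (J : ι → CartierModule p r X)

/-- The projections from a direct sum of Cartier modules. -/
noncomputable def directSumπ (k : ι) : directSum J ⟶ J k where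
  f := biproduct.π _ k
  h := (biproduct.lift_π (fun k ↦ (Scheme.Modules.pushforward (frobenius p r X)).map
    (biproduct.π (fun k ↦ (J k).a) k) ≫ (J k).str) k).symm

/-- The inclusions in a direct sum of Cartier modules. -/
noncomputable def directSumι (k : ι) : J k ⟶ directSum J where
  f := biproduct.ι (fun k ↦ (J k).a) k
  h := by
    classical
    refine biproduct.hom_ext _ _ fun l ↦ ?_
    simp only [directSum, Category.assoc, biproduct.lift_π]
    rw [← Functor.map_comp_assoc, biproduct.ι_π]
    split_ifs with h
    · subst h
      simp
    · simp

/-- Morphisms to a direct sum of Cartier modules. -/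
noncomputable def directSumLift {M : CartierModule p r X} (β : ∀ k, M ⟶ J k) : M ⟶ directSum J where
  f := biproduct.lift fun k ↦ (β k).f
  h := by
    refine biproduct.hom_ext _ _ fun l ↦ ?_
    simp only [directSum, Category.assoc, biproduct.lift_π]
    rw [← Functor.map_comp_assoc, biproduct.lift_π]
    exact (β l).h

/-- A section is the sum of its components. Stated for subgroups, this reduces vanishing, lifting up
to powers and local finiteness alike to a single summand. -/
lemma directSum_mem {U : X.Opens} (P : AddSubgroup Γ((directSum J).a, U)) (s : Γ((directSum J).a, U))
    (h : ∀ k, (directSumι J k).f.app U ((directSumπ J k).f.app U s) ∈ P) : s ∈ P := by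
  have := Fintype.ofFinite ι
  have key (T : Finset ι) :
      (∑ k ∈ T, (directSumπ J k).f ≫ (directSumι J k).f).app U s ∈ P := by
    classical
    induction T using Finset.induction_on with
    | empty => exact P.zero_mem
    | insert k T hk ih =>
      rw [Finset.sum_insert hk]
      exact P.add_mem (h k) ih
  have htot : ∑ k, biproduct.π (fun k ↦ (J k).a) k ≫ biproduct.ι (fun k ↦ (J k).a) k =
      𝟙 (⨁ fun k ↦ (J k).a) := by
    classical
    refine biproduct.hom_ext _ _ fun l ↦ ?_
    simp [Preadditive.sum_comp, biproduct.ι_π, comp_dite]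
  have h1 : (∑ k, (directSumπ J k).f ≫ (directSumι J k).f).app U s = s :=
    congrArg (fun φ : (directSum J).a ⟶ (directSum J).a ↦ φ.app U s) htot
  exact h1 ▸ key Finset.univ

lemma directSum_ext {U : X.Opens} {s t : Γ((directSum J).a, U)}
    (h : ∀ k, (directSumπ J k).f.app U s = (directSumπ J k).f.app U t) : s = t := by
  rw [← sub_eq_zero]
  refine directSum_mem J ⊥ _ fun k ↦ ?_
  rw [map_sub, h k, sub_self, map_zero]
  rfl

lemma directSumLift_π {M : CartierModule p r X} (β : ∀ k, M ⟶ J k) (k : ι) {U : X.Opens}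
    (s : Γ(M.a, U)) :
    (directSumπ J k).f.app U ((directSumLift J β).f.app U s) = (β k).f.app U s :=
  congrArg (fun φ : M.a ⟶ (J k).a ↦ φ.app U s) (biproduct.lift_π (fun k ↦ (β k).f) k)

lemma localizing_directSum (hJ : ∀ k, Localizing (J k).a) : Localizing (directSum J).a := by
  refine ⟨fun {U} f s ↦ ?_, fun {U} f t ht ↦ ?_⟩
  · let P : AddSubgroup Γ((directSum J).a, X.basicOpen f) :=
      { carrier := {s | ∃ (n : ℕ) (t : Γ((directSum J).a, U)),
          rs _ (X.basicOpen_le f) t = rr X (X.basicOpen_le f) f ^ n • s}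
        zero_mem' := ⟨0, 0, by rw [map_zero, smul_zero]⟩
        add_mem' := fun {s s'} ⟨n, t, h⟩ ⟨n', t', h'⟩ ↦ ⟨n + n', f ^ n' • t + f ^ n • t', by
          rw [map_add, rs_smul, rs_smul, h, h', map_pow, map_pow, smul_add, ← mul_smul, ← mul_smul,
            pow_add, mul_comm (_ ^ n')]⟩
        neg_mem' := fun {s} ⟨n, t, h⟩ ↦ ⟨n, -t, by rw [map_neg, h, smul_neg]⟩ }
    refine directSum_mem J P s fun k ↦ ?_
    obtain ⟨n, t, h⟩ := (hJ k).exists_lift f ((directSumπ J k).f.app _ s)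
    exact ⟨n, (directSumι J k).f.app U t, by rw [← app_rs, h, app_smul]⟩
  · choose n hn using fun k ↦ (hJ k).exists_pow_smul_eq_zero f ((directSumπ J k).f.app U t)
      (by rw [← app_rs, ht, map_zero])
    obtain ⟨N, hN⟩ := (Set.finite_range n).bddAbove
    refine ⟨N, directSum_ext J fun k ↦ ?_⟩
    rw [app_smul, ← Nat.sub_add_cancel (hN ⟨k, rfl⟩), pow_add, mul_smul, hn, smul_zero, map_zero]

instance injective_directSum [∀ k, Injective (J k).a] : Injective (directSum J).a :=
  inferInstanceAs (Injective (⨁ fun k ↦ (J k).a))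

end Biproduct

/-! ### The embedding in an ind-coherent module that is injective, and the conclusion. -/

/-- Every ind-coherent Cartier module embeds in an ind-coherent Cartier module whose underlying
module is injective. -/
theorem exists_indCoherent_injective [IsNoetherian X] [IsFFinite p X] {M : CartierModule p r X}
    (hM : isIndCoherent p r X M) : ∃ (J : CartierModule p r X) (β : M ⟶ J),
      isIndCoherent p r X J ∧ Injective J.a ∧ ∀ U, Function.Injective (β.f.app U) := by
  have := hM.1
  have hMloc : Localizing M.a := localizing_of_isQuasicoherent
  obtain ⟨S, hS, hSV, hcov⟩ := exists_finite_affine_cover (X := X) ⊤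
  have := hS.to_subtype
  choose J β hJinj hJloc hβ hb hc using fun k : S ↦ exists_local_hull M (hSV k.1 k.2).1
  have hloc := localizing_directSum J hJloc
  -- Ind-coherence of the sum is tested on every member of the cover, so `J k` must be locally
  -- finite over affine opens other than the `k`-th.
  have hfin (k : S) {W : X.Opens} (hW : IsAffineOpen W) (s : Γ((J k).a, W)) :
      IsLocFinite Γ(X, W) (kap (J k) W) s := by
    have : IsNoetherianRing Γ(X, W) := IsLocallyNoetherian.component_noetherian ⟨W, hW⟩
    refine isLocFinite_of_essential (pow_ne_zero r (Fact.out : p.Prime).ne_zero)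
      (IsAffineOpen.powFinite p r hW) (kap_smul (J k) W) (fun e he ↦ ?_) s
    obtain ⟨a, m, h1, h2⟩ := exists_smul_eq_app hMloc (hJloc k) (β k).f (hSV k.1 k.2).1 (hb k)
      (hc k) hW e he
    exact ⟨a, h1, h2 ▸ (isLocFinite_of_isIndCoherent hM hW m).app (β k)⟩
  refine ⟨directSum J, directSumLift J β, ?_, inferInstance, fun U ↦ ?_⟩
  · refine isIndCoherent_of_isLocFinite (V := fun k : S ↦ k.1) hloc (fun k ↦ (hSV k.1 k.2).1)
      (fun x ↦ ?_) fun k s ↦ ?_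
    · obtain ⟨V, hV, hx⟩ := hcov x trivial
      exact ⟨⟨V, hV⟩, hx⟩
    · refine directSum_mem J (locFinite Γ(X, k.1) (kap (directSum J) k.1)).toAddSubgroup s fun l ↦ ?_
      exact (hfin l (hSV k.1 k.2).1 _).app (directSumι J l)
  · intro s t hst
    refine section_ext M.a fun x hx ↦ ?_
    obtain ⟨V, hV, hxV⟩ := hcov x trivial
    refine ⟨U ⊓ V, inf_le_left, ⟨hx, hxV⟩, hβ ⟨V, hV⟩ _ inf_le_right ?_⟩
    rw [app_rs, app_rs, ← directSumLift_π J β, hst, directSumLift_π]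

/-- The module underlying an injective ind-coherent Cartier module is injective. -/
theorem injective_of_injective_indCoh [IsNoetherian X] [IsFFinite p X] (I : IndCoh p r X)
    [Injective I] : Injective I.obj.a := by
  obtain ⟨J, β, hJ, hJinj, hβ⟩ := exists_indCoherent_injective I.property
  let b : I ⟶ (⟨J, hJ⟩ : IndCoh p r X) := ObjectProperty.homMk β
  have : Mono b := ⟨fun {Z} f g h ↦ by
    refine ObjectProperty.hom_ext _ (cartierHom_ext fun U s ↦ hβ U ?_)
    exact congr(($h).hom.f.app U s)⟩
  let ρ := Injective.factorThru (𝟙 I) b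
  have h : β.f ≫ ρ.hom.f = 𝟙 I.obj.a := congr(($(Injective.comp_factorThru (𝟙 I) b)).hom.f)
  exact (Retract.mk β.f ρ.hom.f h).injective

end CartierModules

theorem mainTheorem7 (p : ℕ) [Fact p.Prime] (r : ℕ) (hr : 1 ≤ r) (X : Scheme.{u})
    [IsNoetherian X] [CartierModules.IsFpScheme p X] [CartierModules.IsFFinite p X]
    (I : CartierModules.IndCoh p r X) (hI : Injective I) :
    Injective I.obj.a := by
  exact CartierModules.injective_of_injective_indCoh I
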